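/- Let $\Omega\subset\mathbb R^d$ be a connected compact set with smooth boundary (near each boundary point, $\Omega=\{\rho\le 0\}$ for a smooth $\rho$ with non-vanishing differential), and let $\lambda$ be Lebesgue measure. Derivatives are taken in the distributional sense on the interior of $\Omega$, and $L^2(\Omega)$, $H^1(\Omega)$ are taken with respect to $\lambda$. Let $\mathcal P_2(\Omega)$ be the set of probability measures $\mu$ on $\Omega$ with $\mu\ll\lambda$ whose density, again denoted $\mu(\cdot)$, lies in $H^1(\Omega)$ and is nonzero $\lambda$-almost everywhere on $\Omega$. The Stein class $\mathcal S(\mu)$ is the set of $\phi\in H^1(\Omega)^d$ with $\oint_{\partial\Omega}\mu(x)\,\phi(x)\cdot\vec n(x)\,\mathrm dS(x)=0$, where $\vec n$ is the outward unit normal and boundary values are traces; a scalar function $h$ is said to be in $\mathcal S(\mu)$ if $h\,e_i\in\mathcal S(\mu)$ for every vector $e_i$ of the standard basis. Let $\mu,\pi\in\mathcal P_2(\Omega)$. Assume that $\log\pi$ is weakly differentiable on the interior of $\Omega$ (it is locally integrable and its distributional gradient is a locally integrable function) and that $\mu(\cdot)\nabla\log\pi\in L^2(\Omega)$. For a weakly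 differentiable vector field $\phi$ let $\mathcal A_\pi\phi=\nabla\log\pi\cdot\phi+\nabla\cdot\phi$. Let $k:\Omega\times\Omega\to\mathbb R$ be continuous, symmetric and integrally positive definite (that is, $\int_\Omega\int_\Omega g(x)k(x,y)g(y)\,\mathrm dx\,\mathrm dy>0$ for every nonzero $g\in L^2(\Omega)$), such that $k(\cdot,x)\in\mathcal S(\mu)\cap\mathcal S(\pi)$ for every $x\in\Omega$ and $\partial_{x_i}\partial_{y_j}k\in L^2(\Omega\times\Omega)$ for all $i,j$. Let $\mathcal H_0$ be the reproducing kernel Hilbert space of real functions on $\Omega$ with kernel $k$, and let $\mathcal H=\mathcal H_0^d$ with $\langle f,g\rangle_{\mathcal H}=\sum_{i=1}^d\langle f_i,g_i\rangle_{\mathcal H_0}$. Then every $f\in\mathcal H$ is weakly differentiable with $\mathcal A_\pi f\in L^1(\mu)$, the kernelized Stein discrepancy $$\mathfrak K(\mu|\pi)=\max\{\mathbb E_{x\sim\mu}[\mathcal A_\pi f(x)] : f\in\mathcal H,\ \|f\|_{\mathcal H}\le 1\}$$ exists (the maximum is attained), and $$\mu=\pi\iff\mathfrak K(\mu|\pi)=0.$$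 -/

import Mathlib

open MeasureTheory Filter Topology
open scoped ContDiff ENNReal

namespace SteinKSD

/-- The ambient Euclidean space `ℝ^d`. -/
abbrev Eucl (d : ℕ) : Type := EuclideanSpace ℝ (Fin d)

noncomputable section

/-! ### The domain and its boundary -/

/-- `Ω` is a connected compact subset of `ℝ^d` with smooth boundary: near each of its boundary
points it is the sublevel set `{ρ ≤ 0}` of a smooth function with non-vanishing differential. -/
structure IsSmoothCompactDomain {d : ℕ} (Ω : Set (Eucl d)) : Prop where
  isCompact : IsCompact Ω
  isConnected : IsConnected Ω
  smooth_boundary : ∀ x ∈ frontier Ω, ∃ (V : Set (Eucl d)) (ρ : Eucl d → ℝ),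
    IsOpen V ∧ x ∈ V ∧ ContDiff ℝ ∞ ρ ∧ fderiv ℝ ρ x ≠ 0 ∧ ∀ y ∈ V, (y ∈ Ω ↔ ρ y ≤ 0)

/-- `v` is the outward unit normal of `Ω` at the boundary point `x`: directions in the open half
space `⟪v, w⟫ < 0` enter `Ω`, those in the opposite open half space leave it. There is at most
one such `v`, and at a boundary point of a smooth domain it is `∇ρ / ‖∇ρ‖`. -/
def IsOutwardUnitNormal {d : ℕ} (Ω : Set (Eucl d)) (x v : Eucl d) : Prop :=
  ‖v‖ = 1 ∧
  (∀ w : Eucl d, inner ℝ v w < 0 → ∀ᶠ t : ℝ in 𝓝[>] 0, x + t • w ∈ Ω) ∧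
  (∀ w : Eucl d, 0 < inner ℝ v w → ∀ᶠ t : ℝ in 𝓝[>] 0, x + t • w ∉ Ω)

open Classical in
/-- The outward unit normal field (with the value `0` where there is no normal). -/
def outwardNormal {d : ℕ} (Ω : Set (Eucl d)) (x : Eucl d) : Eucl d :=
  if h : ∃ v, IsOutwardUnitNormal Ω x v then h.choose else 0

/-- The surface measure of `∂Ω`: the `(d-1)`-dimensional Hausdorff measure restricted to the
topological boundary (Mathlib's Hausdorff measure differs from the surface area by a positive
constant factor that depends on `d` only). -/
def surfaceMeasure {d : ℕ} (Ω : Set (Eucl d)) : Measure (Eucl d) :=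
  (Measure.hausdorffMeasure ((d : ℝ) - 1)).restrict (frontier Ω)

/-! ### Weak gradients and Sobolev functions -/

/-- `G` is a weak (distributional) gradient of `u` on `Ω`; test functions are smooth with compact
support in the interior of `Ω`. -/
def IsWeakGrad {d : ℕ} (Ω : Set (Eucl d)) (u : Eucl d → ℝ) (G : Eucl d → Eucl d) : Prop :=
  LocallyIntegrableOn u (interior Ω) ∧ LocallyIntegrableOn G (interior Ω) ∧
  ∀ φ : Eucl d → ℝ, ContDiff ℝ ∞ φ → HasCompactSupport φ → tsupport φ ⊆ interior Ω →
    ∀ v : Eucl d, ∫ x in Ω, u x * fderiv ℝ φ x v = - ∫ x in Ω, φ x * inner ℝ (G x) v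

/-- `u` is weakly differentiable on `Ω`: it is locally integrable and its distributional gradient
is a locally integrable function. -/
def WeaklyDifferentiable {d : ℕ} (Ω : Set (Eucl d)) (u : Eucl d → ℝ) : Prop :=
  ∃ G, IsWeakGrad Ω u G

open Classical in
/-- The weak gradient of a weakly differentiable function (unique up to null sets). -/
def weakGrad {d : ℕ} (Ω : Set (Eucl d)) (u : Eucl d → ℝ) : Eucl d → Eucl d :=
  if h : WeaklyDifferentiable Ω u then h.choose else 0

/-- The Sobolev space `H¹(Ω) = W^{1,2}(Ω)`. -/
def MemH1 {d : ℕ} (Ω : Set (Eucl d)) (u : Eucl d → ℝ) : Prop :=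
  MemLp u 2 (volume.restrict Ω) ∧ WeaklyDifferentiable Ω u ∧
    MemLp (weakGrad Ω u) 2 (volume.restrict Ω)

/-- `t` is the boundary trace of `u ∈ H¹(Ω)`: functions that are smooth up to the boundary
converge to `u` in `H¹(Ω)` while their boundary values converge to `t` in `L²(∂Ω)`. -/
def IsTrace {d : ℕ} (Ω : Set (Eucl d)) (u t : Eucl d → ℝ) : Prop :=
  MemLp t 2 (surfaceMeasure Ω) ∧
  ∃ w : ℕ → Eucl d → ℝ, (∀ n, ContDiff ℝ ∞ (w n)) ∧
    Tendsto (fun n => eLpNorm (fun x => w n x - u x) 2 (volume.restrict Ω)) atTop (𝓝 0) ∧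
    Tendsto (fun n => eLpNorm (fun x => gradient (w n) x - weakGrad Ω u x) 2
      (volume.restrict Ω)) atTop (𝓝 0) ∧
    Tendsto (fun n => eLpNorm (fun x => w n x - t x) 2 (surfaceMeasure Ω)) atTop (𝓝 0)

/-! ### The class `P₂(Ω)` and the Stein class -/

/-- The density of `μ` with respect to Lebesgue measure. -/
def density {d : ℕ} (μ : Measure (Eucl d)) (x : Eucl d) : ℝ := (μ.rnDeriv volume x).toReal

/-- `μ ∈ P₂(Ω)`: a probability measure on `Ω` with a Lebesgue density that belongs to `H¹(Ω)` and
does not vanish on `Ω` (almost everywhere, a density being defined only up to null sets). -/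
structure MemP2 {d : ℕ} (Ω : Set (Eucl d)) (μ : Measure (Eucl d)) : Prop where
  isProbabilityMeasure : IsProbabilityMeasure μ
  measure_compl : μ Ωᶜ = 0
  absolutelyContinuous : μ ≪ volume
  memH1_density : MemH1 Ω (density μ)
  density_ne_zero : ∀ᵐ x ∂(volume.restrict Ω), density μ x ≠ 0

/-- The Stein class `S(μ)`: vector fields `φ ∈ H¹(Ω)^d` with `∮_{∂Ω} μ(x) φ(x) · n(x) dS(x) = 0`,
the boundary values being taken in the sense of traces. -/
def MemSteinClass {d : ℕ} (Ω : Set (Eucl d)) (μ : Measure (Eucl d)) (φ : Eucl d → Eucl d) : Prop :=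
  (∀ i, MemH1 Ω (fun x => φ x i)) ∧
  ∃ (tμ : Eucl d → ℝ) (tφ : Eucl d → Eucl d),
    IsTrace Ω (density μ) tμ ∧ (∀ i, IsTrace Ω (fun x => φ x i) (fun x => tφ x i)) ∧
    ∫ x, tμ x * inner ℝ (tφ x) (outwardNormal Ω x) ∂(surfaceMeasure Ω) = 0

/-! ### The Stein operator -/

/-- The weak gradient `∇ log π`. -/
def score {d : ℕ} (Ω : Set (Eucl d)) (π : Measure (Eucl d)) : Eucl d → Eucl d :=
  weakGrad Ω (fun x => Real.log (density π x))

/-- The score `∇ log π` exists as a function, in the distributional sense, and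
`μ(·) ∇ log π ∈ L²(Ω)`. -/
def HasSquareIntegrableScore {d : ℕ} (Ω : Set (Eucl d)) (μ π : Measure (Eucl d)) : Prop :=
  WeaklyDifferentiable Ω (fun x => Real.log (density π x)) ∧
  MemLp (fun x => density μ x • score Ω π x) 2 (volume.restrict Ω)

/-- The Stein operator `A_π φ = ∇ log π · φ + ∇ · φ`, with weak derivatives. -/
def steinOp {d : ℕ} (Ω : Set (Eucl d)) (π : Measure (Eucl d)) (φ : Eucl d → Eucl d)
    (x : Eucl d) : ℝ :=
  inner ℝ (score Ω π x) (φ x) + ∑ i, weakGrad Ω (fun y => φ y i) x i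

/-! ### Kernels, the product RKHS and the discrepancy -/

/-- `k` is integrally positive definite on `Ω`: `∬ g(x) k(x,y) g(y) dx dy > 0` for every nonzero
`g ∈ L²(Ω)`. -/
def IntegrallyPosDef {d : ℕ} (Ω : Set (Eucl d)) (k : Eucl d → Eucl d → ℝ) : Prop :=
  ∀ g : Eucl d → ℝ, MemLp g 2 (volume.restrict Ω) → ¬ (g =ᵐ[volume.restrict Ω] 0) →
    0 < ∫ x in Ω, ∫ y in Ω, g x * k x y * g y

/-- `m` is the weak mixed derivative `∂_{x_i} ∂_{y_j} k(x, y)` on `Ω × Ω`. -/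
def IsWeakMixedDeriv {d : ℕ} (Ω : Set (Eucl d)) (k : Eucl d → Eucl d → ℝ) (i j : Fin d)
    (m : Eucl d × Eucl d → ℝ) : Prop :=
  ∀ ψ : Eucl d × Eucl d → ℝ, ContDiff ℝ ∞ ψ → HasCompactSupport ψ →
    tsupport ψ ⊆ interior Ω ×ˢ interior Ω →
    ∫ p, k p.1 p.2 *
        fderiv ℝ (fun q => fderiv ℝ ψ q (0, EuclideanSpace.single j (1 : ℝ))) p
          (EuclideanSpace.single i (1 : ℝ), 0)
        ∂((volume.restrict Ω).prod (volume.restrict Ω)) =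
      ∫ p, m p * ψ p ∂((volume.restrict Ω).prod (volume.restrict Ω))

/-- The kernels that generate the product RKHS for the pair `(μ, π)`. The scalar function
`k(·, x)` is in a Stein class when all the vector fields `k(·, x) e_i` are. -/
structure IsSteinKernel {d : ℕ} (Ω : Set (Eucl d)) (μ π : Measure (Eucl d))
    (k : Eucl d → Eucl d → ℝ) : Prop where
  continuousOn : ContinuousOn (Function.uncurry k) (Ω ×ˢ Ω)
  symm : ∀ x ∈ Ω, ∀ y ∈ Ω, k x y = k y x
  integrallyPosDef : IntegrallyPosDef Ω k
  memSteinClass_left : ∀ x ∈ Ω, ∀ i,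
    MemSteinClass Ω μ (fun y => k y x • EuclideanSpace.single i (1 : ℝ))
  memSteinClass_right : ∀ x ∈ Ω, ∀ i,
    MemSteinClass Ω π (fun y => k y x • EuclideanSpace.single i (1 : ℝ))
  mixedDeriv : ∀ i j, ∃ m : Eucl d × Eucl d → ℝ,
    MemLp m 2 ((volume.restrict Ω).prod (volume.restrict Ω)) ∧ IsWeakMixedDeriv Ω k i j m

/-- The product space `H = H₀ × ⋯ × H₀` (`d` factors), with `⟪f, g⟫ = ∑ i, ⟪f i, g i⟫`. -/
abbrev ProductRKHS (d : ℕ) (H₀ : Type*) : Type _ := PiLp 2 (fun _ : Fin d => H₀)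

section RKHSfields

variable {d : ℕ} {Ω : Set (Eucl d)} {H₀ : Type*} [NormedAddCommGroup H₀] [InnerProductSpace ℝ H₀]
  [RKHS ℝ H₀ Ω ℝ]

/-- The vector field on `Ω` given by an element of the product RKHS (extended by `0` to `ℝ^d`). -/
def toField (f : ProductRKHS d H₀) : Eucl d → Eucl d :=
  fun x => WithLp.toLp 2 (fun i => Function.extend Subtype.val (f i : Ω → ℝ) 0 x)

variable (Ω H₀) in
/-- The values `E_{x ∼ μ}[A_π f(x)]` for `f` in the closed unit ball of the product RKHS. -/
def steinValues (μ π : Measure (Eucl d)) : Set ℝ :=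
  {r | ∃ f : ProductRKHS d H₀, ‖f‖ ≤ 1 ∧ r = ∫ x, steinOp Ω π (toField f) x ∂μ}

variable (Ω H₀) in
/-- The kernelized Stein discrepancy `𝔎(μ | π)`. -/
def ksd (μ π : Measure (Eucl d)) : ℝ := sSup (steinValues Ω H₀ μ π)

end RKHSfields

end

end SteinKSD

/-!
For `f` in the product space `H`, the expectation `E_μ[A_π f]` is a bounded linear functional of
`f`, hence equal to `⟪a, f⟫` for some `a ∈ H`; its maximum over the unit ball is `‖a‖`, attained at
`a / ‖a‖`. Boundedness amounts to a bound of `∂_i : H₀ → L²(Ω)`, which is dual to the estimate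
`(∫ f ∂_i φ)² ≤ ‖f‖² ∬ ∂_i φ(x) k(x, y) ∂_i φ(y) = ‖f‖² ∬ φ(x) ∂_{x_i} ∂_{y_i} k(x, y) φ(y)` for
test functions `φ`, by the reproducing property.

Since `k(·, x)` is in the Stein class of `μ`, integration by parts gives
`⟪a_i, k(·, x)⟫ = ∫ (μ ∂_i log π - ∂_i μ) k(·, x)`. As `k` is integrally positive definite, `a = 0`
if and only if `∇μ = μ ∇ log π`. In that case `log μ - log π` has gradient zero, so it is constant
on the interior of `Ω`, which is connected, and two proportional probability densities agree.

Integration by parts rests on the divergence theorem for the Hausdorff measure of `∂Ω`. Near a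
boundary point, both sides of `∫_Ω ∂_e w = ∮ w ⟪n, e⟫` are within `η ∮ w` of each other for every
`w ≥ 0` with small support: for `e` normal this is the fundamental theorem of calculus below a graph
with small Lipschitz constant, and for `e` tangential the left side is small because translations in
the directions of a wide cone map `Ω` into itself. A partition of unity adds up these errors to
`η ∮ w`, and `η` is arbitrary.
-/

namespace SteinKSD

noncomputable section

/-! ### Mollification -/

section LOneConvergence

variable {α ι F : Type*} [MeasurableSpace α] {μ : Measure α} [NormedAddCommGroup F]

/-- Scheffé's lemma, in the form of F. Riesz. -/
theorem tendsto_integral_norm_sub_of_integral_norm_le {l : Filter ι} [l.IsCountablyGenerated]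
    {u : ι → α → F} {v : α → F} (hu : ∀ i, Integrable (u i) μ) (hv : Integrable v μ)
    (hle : ∀ i, ∫ x, ‖u i x‖ ∂μ ≤ ∫ x, ‖v x‖ ∂μ)
    (hlim : ∀ᵐ x ∂μ, Tendsto (fun i => u i x) l (𝓝 (v x))) :
    Tendsto (fun i => ∫ x, ‖u i x - v x‖ ∂μ) l (𝓝 0) := by
  -- The difference `‖u i - v‖ - ‖u i‖` is dominated by `‖v‖`, although `‖u i‖` itself need not be.
  have hdiff : Tendsto (fun i => ∫ x, (‖u i x - v x‖ - ‖u i x‖) ∂μ) l (𝓝 (∫ x, -‖v x‖ ∂μ)) := by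
    refine tendsto_integral_filter_of_dominated_convergence (fun x => ‖v x‖)
      (.of_forall fun i => (((hu i).sub hv).norm.sub (hu i).norm).aestronglyMeasurable)
      (.of_forall fun i => .of_forall fun x => ?_) hv.norm ?_
    · simpa using abs_norm_sub_norm_le (u i x - v x) (u i x)
    · filter_upwards [hlim] with x hx
      simpa using (hx.sub_const (v x)).norm.sub hx.norm
  have hbound : Tendsto (fun i => (∫ x, (‖u i x - v x‖ - ‖u i x‖) ∂μ) + ∫ x, ‖v x‖ ∂μ) l (𝓝 0) := by
    simpa [integral_neg] using hdiff.add_const (∫ x, ‖v x‖ ∂μ)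
  refine squeeze_zero (fun i => integral_nonneg fun x => norm_nonneg _) (fun i => ?_) hbound
  have hsub := integral_sub ((hu i).sub hv).norm (hu i).norm
  simp only [Pi.sub_apply] at hsub
  linarith [hle i]

theorem tendsto_integral_abs_sub_of_tendsto_of_abs_le {w : ℕ → α → ℝ} {u b : α → ℝ}
    (hw : ∀ n, Integrable (w n) μ) (hu : Integrable u μ) (hb : Integrable b μ)
    (hwb : ∀ n, ∀ᵐ x ∂μ, |w n x| ≤ b x)
    (hlim : ∀ᵐ x ∂μ, Tendsto (fun n => w n x) atTop (𝓝 (u x))) :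
    Tendsto (fun n => ∫ x, |w n x - u x| ∂μ) atTop (𝓝 0) := by
  rw [← integral_zero α ℝ (μ := μ)]
  refine tendsto_integral_of_dominated_convergence (fun x => b x + |u x|)
    (fun n => ((hw n).sub hu).abs.aestronglyMeasurable) (hb.add hu.abs) (fun n => ?_) ?_
  · filter_upwards [hwb n] with x hx
    rw [Real.norm_eq_abs, abs_abs]
    linarith [abs_sub (w n x) (u x)]
  · filter_upwards [hlim] with x hx
    simpa using (hx.sub_const (u x)).abs

theorem tendsto_integral_abs_mul_sub_mul {b w : ℕ → α → ℝ} {c u : α → ℝ} {C : ℝ}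
    (hb : ∀ n, AEStronglyMeasurable (b n) μ) (hc : AEStronglyMeasurable c μ)
    (hbC : ∀ n x, |b n x| ≤ C) (hcC : ∀ x, |c x| ≤ C)
    (hw : ∀ n, Integrable (w n) μ) (hu : Integrable u μ)
    (hbc : ∀ᵐ x ∂μ, Tendsto (fun n => b n x) atTop (𝓝 (c x)))
    (hwu : Tendsto (fun n => ∫ x, |w n x - u x| ∂μ) atTop (𝓝 0)) :
    Tendsto (fun n => ∫ x, |b n x * w n x - c x * u x| ∂μ) atTop (𝓝 0) := by
  have hbu : ∀ n, Integrable (fun x => b n x * u x) μ := fun n =>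
    hu.bdd_mul (hb n) (.of_forall (hbC n))
  have hcu : Integrable (fun x => c x * u x) μ := hu.bdd_mul hc (.of_forall hcC)
  have hfirst : Tendsto (fun n => ∫ x, |b n x * u x - c x * u x| ∂μ) atTop (𝓝 0) :=
    tendsto_integral_abs_sub_of_tendsto_of_abs_le hbu hcu (hu.abs.const_mul C)
      (fun n => .of_forall fun x => by
        rw [abs_mul]
        exact mul_le_mul_of_nonneg_right (hbC n x) (abs_nonneg _))
      (hbc.mono fun x hx => hx.mul_const (u x))
  have hsum := (hwu.const_mul C).add hfirst
  rw [mul_zero, add_zero] at hsum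
  refine squeeze_zero (fun n => integral_nonneg fun x => abs_nonneg _) (fun n => ?_) hsum
  have hwu_int : Integrable (fun x => C * |w n x - u x|) μ := ((hw n).sub hu).abs.const_mul C
  have hbc_int : Integrable (fun x => |b n x * u x - c x * u x|) μ := ((hbu n).sub hcu).abs
  rw [← integral_const_mul, ← integral_add hwu_int hbc_int]
  refine integral_mono_of_nonneg (.of_forall fun x => abs_nonneg _) (hwu_int.add hbc_int)
    (.of_forall fun x => ?_)
  calc |b n x * w n x - c x * u x|
      ≤ |b n x * w n x - b n x * u x| + |b n x * u x - c x * u x| := abs_sub_le _ _ _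
    _ ≤ C * |w n x - u x| + |b n x * u x - c x * u x| := by
      rw [← mul_sub, abs_mul]
      gcongr
      exact hbC n x

theorem tendsto_integral_abs_comp_sub {F : ℝ → ℝ} {C : ℝ} {w : ℕ → α → ℝ} {u : α → ℝ}
    (hF : ∀ s t, |F s - F t| ≤ C * |s - t|) (hw : ∀ n, Integrable (w n) μ) (hu : Integrable u μ)
    (hwu : Tendsto (fun n => ∫ x, |w n x - u x| ∂μ) atTop (𝓝 0)) :
    Tendsto (fun n => ∫ x, |F (w n x) - F (u x)| ∂μ) atTop (𝓝 0) := by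
  have hbound := hwu.const_mul C
  rw [mul_zero] at hbound
  refine squeeze_zero (fun n => integral_nonneg fun x => abs_nonneg _) (fun n => ?_) hbound
  rw [← integral_const_mul]
  exact integral_mono_of_nonneg (.of_forall fun x => abs_nonneg _)
    (((hw n).sub hu).abs.const_mul C) (.of_forall fun x => hF _ _)

theorem tendsto_setIntegral_abs_of_subset {f : ℕ → α → ℝ} {s t : Set α} (hst : s ⊆ t)
    (hf : ∀ n, IntegrableOn (f n) t μ) (h : Tendsto (fun n => ∫ x in t, |f n x| ∂μ) atTop (𝓝 0)) :
    Tendsto (fun n => ∫ x in s, |f n x| ∂μ) atTop (𝓝 0) :=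
  squeeze_zero (fun _ => integral_nonneg fun _ => abs_nonneg _)
    (fun n => setIntegral_mono_set (hf n).abs (.of_forall fun _ => abs_nonneg _)
      hst.eventuallyLE) h

end LOneConvergence

open scoped Manifold in
theorem exists_contDiff_eq_one_nhdsSet {E : Type*} [NormedAddCommGroup E] [NormedSpace ℝ E]
    [FiniteDimensional ℝ E] {K U : Set E} (hK : IsCompact K) (hU : IsOpen U) (h : K ⊆ U) :
    ∃ χ : E → ℝ, ContDiff ℝ ∞ χ ∧ HasCompactSupport χ ∧ tsupport χ ⊆ U ∧
      (∀ᶠ x in 𝓝ˢ K, χ x = 1) ∧ ∀ x, χ x ∈ Set.Icc (0 : ℝ) 1 := by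
  obtain ⟨K', hK', hKK', hK'U⟩ := exists_compact_between hK hU h
  obtain ⟨χ, hχ_one, hχ_zero, hχ⟩ := exists_contMDiffMap_one_nhds_of_subset_interior (n := ⊤)
    𝓘(ℝ, E) hK.isClosed hKK'
  have hs : tsupport χ ⊆ K' :=
    closure_minimal (fun x hx => by_contra fun hx' => hx (hχ_zero x hx')) hK'.isClosed
  exact ⟨χ, χ.contMDiff.contDiff, hK'.of_isClosed_subset (isClosed_tsupport _) hs,
    hs.trans hK'U, hχ_one, hχ⟩

theorem continuous_fderiv_apply_of_contDiff {E : Type*} [NormedAddCommGroup E] [NormedSpace ℝ E]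
    {φ : E → ℝ} {n : WithTop ℕ∞} (hφ : ContDiff ℝ n φ) (hn : n ≠ 0) (a : E) :
    Continuous fun x => fderiv ℝ φ x a :=
  (hφ.continuous_fderiv hn).clm_apply continuous_const

section Mollification

open ContinuousLinearMap
open scoped Convolution

variable {E : Type*} [NormedAddCommGroup E]

variable (E) in
/-- The bump functions used for mollification: a sequence shrinking to the origin, with outer
radius comparable to the inner one so that Lebesgue's differentiation theorem applies. -/
def stdBump (n : ℕ) : ContDiffBump (0 : E) where
  rIn := 1 / ((n : ℝ) + 1)
  rOut := 2 / ((n : ℝ) + 1)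
  rIn_pos := by positivity
  rIn_lt_rOut := by gcongr; norm_num

theorem tendsto_stdBump_rOut : Tendsto (fun n => (stdBump E n).rOut) atTop (𝓝 0) := by
  simpa [stdBump, div_eq_mul_inv] using
    (tendsto_one_div_add_atTop_nhds_zero_nat (𝕜 := ℝ)).const_mul 2

variable [NormedSpace ℝ E] [FiniteDimensional ℝ E] [MeasureSpace E] [BorelSpace E]
  [(volume : Measure E).IsAddHaarMeasure]

/-- Convolution of `v` with the normalized bump function `ρ`. -/
def mollify (ρ : ContDiffBump (0 : E)) (v : E → ℝ) : E → ℝ :=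
  ρ.normed volume ⋆[lsmul ℝ ℝ, volume] v

variable {v : E → ℝ} (ρ : ContDiffBump (0 : E))

theorem mollify_eq_convolution (v : E → ℝ) :
    mollify ρ v = v ⋆[mul ℝ ℝ, volume] ρ.normed volume := by
  ext x
  rw [mollify, convolution_lsmul_swap, convolution_mul]
  simp only [smul_eq_mul, mul_comm]

theorem mollify_apply (v : E → ℝ) (x : E) :
    mollify ρ v x = ∫ t, v t * ρ.normed volume (x - t) := by
  rw [mollify_eq_convolution, convolution_mul]

theorem contDiff_mollify (hv : LocallyIntegrable v) : ContDiff ℝ ∞ (mollify ρ v) := by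
  rw [mollify_eq_convolution]
  exact ρ.hasCompactSupport_normed.contDiff_convolution_right _ hv ρ.contDiff_normed

theorem fderiv_mollify_apply (hv : LocallyIntegrable v) (x a : E) :
    fderiv ℝ (mollify ρ v) x a = ∫ t, v t * fderiv ℝ (ρ.normed volume) (x - t) a := by
  rw [mollify_eq_convolution, (ρ.hasCompactSupport_normed.hasFDerivAt_convolution_right _ hv
    ρ.contDiff_normed x).fderiv, convolution_precompR_apply _ hv
    (ρ.hasCompactSupport_normed.fderiv ℝ)
    ((ρ.contDiff_normed (n := 1)).continuous_fderiv one_ne_zero), convolution_mul]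

theorem ae_tendsto_mollify (hv : LocallyIntegrable v) :
    ∀ᵐ x, Tendsto (fun n => mollify (stdBump E n) v x) atTop (𝓝 (v x)) :=
  ContDiffBump.ae_convolution_tendsto_right_of_locallyIntegrable (K := 2) tendsto_stdBump_rOut
    (.of_forall fun n => by simp [stdBump, div_eq_mul_inv]) hv

theorem integrable_mollify (hv : Integrable v) : Integrable (mollify ρ v) :=
  ρ.integrable_normed.integrable_convolution _ hv

theorem integral_mollify (hv : Integrable v) : ∫ x, mollify ρ v x = ∫ x, v x := by
  rw [mollify, integral_convolution _ ρ.integrable_normed hv]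
  simp [ρ.integral_normed]

theorem abs_mollify_le (v : E → ℝ) (x : E) : |mollify ρ v x| ≤ mollify ρ (fun y => |v y|) x := by
  rw [mollify_apply, mollify_apply]
  refine abs_integral_le_integral_abs.trans_eq (integral_congr_ae (.of_forall fun t => ?_))
  simp only [abs_mul, abs_of_nonneg (ρ.nonneg_normed _)]

theorem tendsto_integral_abs_mollify_sub (hv : Integrable v) :
    Tendsto (fun n => ∫ x, |mollify (stdBump E n) v x - v x|) atTop (𝓝 0) :=
  tendsto_integral_norm_sub_of_integral_norm_le (fun _ => integrable_mollify _ hv) hv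
    (fun _ => (integral_mono (integrable_mollify _ hv).norm (integrable_mollify _ hv.norm)
      (abs_mollify_le _ v)).trans_eq (integral_mollify _ hv.norm))
    (ae_tendsto_mollify hv.locallyIntegrable)

end Mollification

/-! ### Weak directional derivatives -/

theorem integrable_mul_of_locallyIntegrableOn {E : Type*} [NormedAddCommGroup E] [MeasureSpace E]
    [BorelSpace E] {U : Set E} {u ψ : E → ℝ} (hu : LocallyIntegrableOn u U) (hψ : Continuous ψ)
    (hc : HasCompactSupport ψ) (hs : tsupport ψ ⊆ U) :
    Integrable (fun x => u x * ψ x) := by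
  have hi : IntegrableOn u (tsupport ψ) := hu.integrableOn_compact_subset hs hc.isCompact
  refine (integrableOn_iff_integrable_of_support_subset (s := tsupport ψ) fun x hx => ?_).1
    (hi.mul_continuousOn hψ.continuousOn hc.isCompact)
  exact subset_tsupport _ (right_ne_zero_of_mul hx)

section WeakDeriv

variable {E : Type*} [NormedAddCommGroup E] [NormedSpace ℝ E] [MeasureSpace E]
  {U V : Set E} {u v g h : E → ℝ} {a : E}

/-- `g` is the weak (distributional) derivative of `u` in the direction `a` on the open set `U`.
The integrals extend over the whole space: test functions vanish outside `U`, and so the values of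
`u` and `g` there are irrelevant. -/
structure HasWeakDeriv (U : Set E) (u : E → ℝ) (a : E) (g : E → ℝ) : Prop where
  locallyIntegrableOn : LocallyIntegrableOn u U
  locallyIntegrableOn_deriv : LocallyIntegrableOn g U
  integral_eq : ∀ φ : E → ℝ, ContDiff ℝ ∞ φ → HasCompactSupport φ → tsupport φ ⊆ U →
    ∫ x, u x * fderiv ℝ φ x a = - ∫ x, φ x * g x

theorem HasWeakDeriv.mono (hu : HasWeakDeriv U u a g) (hVU : V ⊆ U) : HasWeakDeriv V u a g :=
  ⟨hu.1.mono_set hVU, hu.2.mono_set hVU, fun φ hφ hc hs => hu.3 φ hφ hc (hs.trans hVU)⟩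

theorem HasWeakDeriv.const_mul (c : ℝ) (hu : HasWeakDeriv U u a g) :
    HasWeakDeriv U (fun x => c * u x) a (fun x => c * g x) := by
  refine ⟨hu.1.smul c, hu.2.smul c, fun φ hφ hc hs => ?_⟩
  simp only [mul_assoc, mul_left_comm _ c, integral_const_mul, hu.integral_eq φ hφ hc hs, mul_neg]

theorem HasWeakDeriv.congr_ae (hu : HasWeakDeriv U u a g)
    (huv : u =ᵐ[volume.restrict U] v) (hgh : g =ᵐ[volume.restrict U] h) :
    HasWeakDeriv U v a h := by
  refine ⟨hu.1.congr huv, hu.2.congr hgh, fun φ hφ hc hs => ?_⟩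
  have hint : ∀ {ψ f : E → ℝ}, tsupport ψ ⊆ U → ∫ x, f x * ψ x = ∫ x in U, f x * ψ x :=
    fun hψ => (setIntegral_eq_integral_of_forall_compl_eq_zero fun x hx => by
      rw [image_eq_zero_of_notMem_tsupport fun hx' => hx (hψ hx'), mul_zero]).symm
  have hcongr : ∀ {ψ f₁ f₂ : E → ℝ}, tsupport ψ ⊆ U → f₁ =ᵐ[volume.restrict U] f₂ →
      ∫ x, f₁ x * ψ x = ∫ x, f₂ x * ψ x := fun hψ hf => by
    rw [hint hψ, hint hψ]
    exact integral_congr_ae (hf.mono fun x hx => by simp only [hx])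
  have hφ := hu.integral_eq φ hφ hc hs
  simp only [mul_comm (φ _)] at hφ ⊢
  rw [← hcongr ((tsupport_fderiv_apply_subset ℝ a).trans hs) huv, ← hcongr hs hgh, hφ]

theorem HasWeakDeriv.of_forall_isCompact [FiniteDimensional ℝ E] (hU : IsOpen U)
    (h : ∀ K ⊆ U, IsCompact K → ∃ V, K ⊆ V ∧ HasWeakDeriv V u a g) : HasWeakDeriv U u a g where
  locallyIntegrableOn := (locallyIntegrableOn_iff hU.isLocallyClosed).2 fun K hKU hK =>
    let ⟨_, hKV, hV⟩ := h K hKU hK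
    hV.locallyIntegrableOn.integrableOn_compact_subset hKV hK
  locallyIntegrableOn_deriv := (locallyIntegrableOn_iff hU.isLocallyClosed).2 fun K hKU hK =>
    let ⟨_, hKV, hV⟩ := h K hKU hK
    hV.locallyIntegrableOn_deriv.integrableOn_compact_subset hKV hK
  integral_eq φ hφ hc hs :=
    let ⟨_, hKV, hV⟩ := h _ hs hc.isCompact
    hV.integral_eq φ hφ hc hKV

variable [BorelSpace E]

theorem integrable_mul_fderiv_of_locallyIntegrableOn (hu : LocallyIntegrableOn u U) {φ : E → ℝ}
    (hφ : ContDiff ℝ 1 φ) (hc : HasCompactSupport φ) (hs : tsupport φ ⊆ U) :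
    Integrable (fun x => u x * fderiv ℝ φ x a) :=
  integrable_mul_of_locallyIntegrableOn hu
    ((hφ.continuous_fderiv one_ne_zero).clm_apply continuous_const)
    (hc.fderiv_apply ℝ a) ((tsupport_fderiv_apply_subset ℝ a).trans hs)

theorem HasWeakDeriv.add (hu : HasWeakDeriv U u a g) (hv : HasWeakDeriv U v a h) :
    HasWeakDeriv U (fun x => u x + v x) a (fun x => g x + h x) := by
  refine ⟨hu.1.add hv.1, hu.2.add hv.2, fun φ hφ hc hs => ?_⟩
  have hug := integrable_mul_of_locallyIntegrableOn hu.2 hφ.continuous hc hs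
  have hvh := integrable_mul_of_locallyIntegrableOn hv.2 hφ.continuous hc hs
  have hφ' : ContDiff ℝ 1 φ := hφ.of_le (by simp)
  simp only [mul_comm (φ _), add_mul]
  rw [integral_add (integrable_mul_fderiv_of_locallyIntegrableOn hu.1 hφ' hc hs)
    (integrable_mul_fderiv_of_locallyIntegrableOn hv.1 hφ' hc hs), integral_add hug hvh,
    hu.integral_eq φ hφ hc hs, hv.integral_eq φ hφ hc hs]
  simp only [mul_comm (φ _), neg_add]

theorem HasWeakDeriv.sub (hu : HasWeakDeriv U u a g) (hv : HasWeakDeriv U v a h) :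
    HasWeakDeriv U (fun x => u x - v x) a (fun x => g x - h x) := by
  simpa [sub_eq_add_neg] using hu.add (hv.const_mul (-1))

theorem HasWeakDeriv.sum_smul {ι : Type*} {s : Finset ι} {e : ι → E} {G : ι → E → ℝ}
    (hu : LocallyIntegrableOn u U) (hG : ∀ i ∈ s, HasWeakDeriv U u (e i) (G i)) (c : ι → ℝ) :
    HasWeakDeriv U u (∑ i ∈ s, c i • e i) (fun x => ∑ i ∈ s, c i * G i x) := by
  have hsum : LocallyIntegrableOn (∑ i ∈ s, fun x => c i * G i x) U :=
    Finset.sum_induction _ (LocallyIntegrableOn · U) (fun _ _ => .add) locallyIntegrableOn_zero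
      fun i hi => (hG i hi).2.smul (c i)
  refine ⟨hu, by rwa [Finset.sum_fn] at hsum, fun φ hφ hc hs => ?_⟩
  have hφ' : ContDiff ℝ 1 φ := hφ.of_le (by simp)
  have hint : ∀ i ∈ s, Integrable fun x => φ x * G i x := fun i hi =>
    (integrable_mul_of_locallyIntegrableOn (hG i hi).2 hφ.continuous hc hs).congr
      (.of_forall fun x => mul_comm _ _)
  simp only [map_sum, map_smul, smul_eq_mul, Finset.mul_sum, mul_left_comm _ (c _)]
  rw [integral_finsetSum _ fun i _ =>
      (integrable_mul_fderiv_of_locallyIntegrableOn hu hφ' hc hs).const_mul (c i),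
    integral_finsetSum _ fun i hi => (hint i hi).const_mul (c i), ← Finset.sum_neg_distrib]
  exact Finset.sum_congr rfl fun i hi => by
    rw [integral_const_mul, integral_const_mul, (hG i hi).integral_eq φ hφ hc hs, mul_neg]

variable [FiniteDimensional ℝ E]

theorem HasWeakDeriv.unique (hU : IsOpen U) (hg : HasWeakDeriv U u a g)
    (hh : HasWeakDeriv U u a h) : g =ᵐ[volume.restrict U] h := by
  have hzero : ∀ᵐ x, x ∈ U → g x - h x = 0 :=
    hU.ae_eq_zero_of_integral_contDiff_smul_eq_zero
      (hg.locallyIntegrableOn_deriv.sub hh.locallyIntegrableOn_deriv) fun φ hφ hc hs => by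
        have hint := (hg.sub hh).integral_eq φ hφ hc hs
        simpa using hint.symm
  rw [EventuallyEq, ae_restrict_iff' hU.measurableSet]
  exact hzero.mono fun x hx hxU => sub_eq_zero.1 (hx hxU)

end WeakDeriv

section WeakDerivLimits

variable {E : Type*} [NormedAddCommGroup E] [MeasureSpace E] {U : Set E} {u g : E → ℝ} {a : E}

theorem locallyIntegrableOn_of_tendsto_of_abs_le {w : ℕ → E → ℝ} {b : E → ℝ} [LocallyCompactSpace E]
    (hU : IsOpen U) (hw : ∀ n, LocallyIntegrableOn (w n) U) (hb : LocallyIntegrableOn b U)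
    (hwb : ∀ n, ∀ᵐ x ∂(volume.restrict U), |w n x| ≤ b x)
    (hlim : ∀ᵐ x ∂(volume.restrict U), Tendsto (fun n => w n x) atTop (𝓝 (u x))) :
    LocallyIntegrableOn u U := by
  simp only [locallyIntegrableOn_iff hU.isLocallyClosed] at hw hb ⊢
  intro K hKU hK
  have hlimK := ae_restrict_of_ae_restrict_of_subset hKU hlim
  refine (hb K hKU hK).mono' (aestronglyMeasurable_of_tendsto_ae atTop
    (fun n => (hw n K hKU hK).aestronglyMeasurable) hlimK) ?_
  filter_upwards [hlimK, ae_restrict_of_ae_restrict_of_subset hKU (ae_all_iff.2 hwb)] with x hx hxb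
  exact le_of_tendsto hx.norm (.of_forall hxb)

variable [BorelSpace E]

theorem tendsto_integral_mul_of_tendsto_setIntegral_abs_sub {ι : Type*} {l : Filter ι}
    {w : ι → E → ℝ} {ψ : E → ℝ} (hw : ∀ᶠ i in l, LocallyIntegrableOn (w i) U)
    (hu : LocallyIntegrableOn u U) (hψ : Continuous ψ) (hc : HasCompactSupport ψ)
    (hs : tsupport ψ ⊆ U) (hlim : Tendsto (fun i => ∫ x in tsupport ψ, |w i x - u x|) l (𝓝 0)) :
    Tendsto (fun i => ∫ x, w i x * ψ x) l (𝓝 (∫ x, u x * ψ x)) := by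
  obtain ⟨C, hC⟩ := hψ.bounded_above_of_compact_support hc
  rw [tendsto_iff_norm_sub_tendsto_zero]
  have hbound : Tendsto (fun i => (∫ x in tsupport ψ, |w i x - u x|) * C) l (𝓝 0) := by
    simpa using hlim.mul_const C
  refine squeeze_zero' (.of_forall fun i => norm_nonneg _) (hw.mono fun i hi => ?_) hbound
  have hdiff : IntegrableOn (fun x => w i x - u x) (tsupport ψ) :=
    (hi.sub hu).integrableOn_compact_subset hs hc.isCompact
  calc ‖(∫ x, w i x * ψ x) - ∫ x, u x * ψ x‖
      = ‖∫ x in tsupport ψ, (w i x - u x) * ψ x‖ := by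
        rw [← integral_sub (integrable_mul_of_locallyIntegrableOn hi hψ hc hs)
          (integrable_mul_of_locallyIntegrableOn hu hψ hc hs),
          setIntegral_eq_integral_of_forall_compl_eq_zero fun x hx => by
            rw [image_eq_zero_of_notMem_tsupport hx, mul_zero]]
        simp only [sub_mul]
    _ ≤ ∫ x in tsupport ψ, |w i x - u x| * C :=
        norm_integral_le_of_norm_le (hdiff.abs.mul_const C) (.of_forall fun x => by
          rw [norm_mul]
          exact mul_le_mul_of_nonneg_left (hC x) (norm_nonneg _))
    _ = (∫ x in tsupport ψ, |w i x - u x|) * C := integral_mul_const _ _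

variable [NormedSpace ℝ E]

theorem HasWeakDeriv.of_tendsto_setIntegral_abs_sub {ι : Type*} {l : Filter ι} [l.NeBot]
    {w f : ι → E → ℝ} (hw : ∀ᶠ i in l, HasWeakDeriv U (w i) a (f i))
    (hu : LocallyIntegrableOn u U) (hg : LocallyIntegrableOn g U)
    (hwu : ∀ K ⊆ U, IsCompact K → Tendsto (fun i => ∫ x in K, |w i x - u x|) l (𝓝 0))
    (hfg : ∀ K ⊆ U, IsCompact K → Tendsto (fun i => ∫ x in K, |f i x - g x|) l (𝓝 0)) :
    HasWeakDeriv U u a g := by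
  refine ⟨hu, hg, fun φ hφ hc hs => ?_⟩
  have hs' := (tsupport_fderiv_apply_subset ℝ a).trans hs
  have hc' := hc.fderiv_apply ℝ a
  have hlim_u := tendsto_integral_mul_of_tendsto_setIntegral_abs_sub
    (hw.mono fun i hi => hi.locallyIntegrableOn) hu
    (continuous_fderiv_apply_of_contDiff hφ (by simp) a) hc' hs' (hwu _ hs' hc'.isCompact)
  have hlim_g := tendsto_integral_mul_of_tendsto_setIntegral_abs_sub
    (hw.mono fun i hi => hi.locallyIntegrableOn_deriv) hg hφ.continuous hc hs
    (hfg _ hs hc.isCompact)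
  simp only [mul_comm _ (φ _)] at hlim_g
  exact tendsto_nhds_unique hlim_u
    (hlim_g.neg.congr' (hw.mono fun i hi => (hi.integral_eq φ hφ hc hs).symm))

theorem HasWeakDeriv.of_tendsto_of_abs_le [LocallyCompactSpace E] (hU : IsOpen U)
    {w f : ℕ → E → ℝ} {b c : E → ℝ} (hw : ∀ n, HasWeakDeriv U (w n) a (f n))
    (hb : LocallyIntegrableOn b U) (hc : LocallyIntegrableOn c U)
    (hwb : ∀ n, ∀ᵐ x ∂(volume.restrict U), |w n x| ≤ b x)
    (hfc : ∀ n, ∀ᵐ x ∂(volume.restrict U), |f n x| ≤ c x)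
    (hwu : ∀ᵐ x ∂(volume.restrict U), Tendsto (fun n => w n x) atTop (𝓝 (u x)))
    (hfg : ∀ᵐ x ∂(volume.restrict U), Tendsto (fun n => f n x) atTop (𝓝 (g x))) :
    HasWeakDeriv U u a g := by
  have hu := locallyIntegrableOn_of_tendsto_of_abs_le hU (fun n => (hw n).1) hb hwb hwu
  have hg := locallyIntegrableOn_of_tendsto_of_abs_le hU (fun n => (hw n).2) hc hfc hfg
  refine .of_tendsto_setIntegral_abs_sub (l := atTop) (.of_forall hw) hu hg
    (fun K hKU hK => ?_) (fun K hKU hK => ?_)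
  · exact tendsto_integral_abs_sub_of_tendsto_of_abs_le
      (fun n => (hw n).1.integrableOn_compact_subset hKU hK) (hu.integrableOn_compact_subset hKU hK)
      (hb.integrableOn_compact_subset hKU hK)
      (fun n => ae_restrict_of_ae_restrict_of_subset hKU (hwb n))
      (ae_restrict_of_ae_restrict_of_subset hKU hwu)
  · exact tendsto_integral_abs_sub_of_tendsto_of_abs_le
      (fun n => (hw n).2.integrableOn_compact_subset hKU hK) (hg.integrableOn_compact_subset hKU hK)
      (hc.integrableOn_compact_subset hKU hK)
      (fun n => ae_restrict_of_ae_restrict_of_subset hKU (hfc n))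
      (ae_restrict_of_ae_restrict_of_subset hKU hfg)

end WeakDerivLimits

theorem locallyIntegrableOn_comp_of_abs_sub_le {E : Type*} [NormedAddCommGroup E] [MeasureSpace E]
    [LocallyCompactSpace E] [IsFiniteMeasureOnCompacts (volume : Measure E)] {U : Set E}
    {u : E → ℝ} (hU : IsOpen U) {F : ℝ → ℝ} {C : ℝ} (hF : Continuous F)
    (hlip : ∀ s t, |F s - F t| ≤ C * |s - t|) (hu : LocallyIntegrableOn u U) :
    LocallyIntegrableOn (fun x => F (u x)) U := by
  rw [locallyIntegrableOn_iff hU.isLocallyClosed] at hu ⊢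
  intro K hKU hK
  have hbound : IntegrableOn (fun x => |F 0| + C * |u x|) K :=
    (integrableOn_const hK.measure_lt_top.ne).add ((hu K hKU hK).abs.const_mul C)
  refine hbound.mono' (hF.comp_aestronglyMeasurable (hu K hKU hK).aestronglyMeasurable)
    (.of_forall fun x => ?_)
  have hF0 := hlip (u x) 0
  rw [sub_zero] at hF0
  rw [Real.norm_eq_abs]
  linarith [abs_sub_abs_le_abs_sub (F (u x)) (F 0)]

section ChainRule

variable {E : Type*} [NormedAddCommGroup E] [NormedSpace ℝ E] [FiniteDimensional ℝ E]
  [MeasureSpace E] [BorelSpace E] [(volume : Measure E).IsAddHaarMeasure]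
  {U : Set E} {u g : E → ℝ} {a : E}

theorem hasWeakDeriv_of_contDiff (hu : ContDiff ℝ 1 u) :
    HasWeakDeriv U u a (fun x => fderiv ℝ u x a) := by
  have hu' := continuous_fderiv_apply_of_contDiff hu one_ne_zero a
  refine ⟨hu.continuous.locallyIntegrable.locallyIntegrableOn _,
    hu'.locallyIntegrable.locallyIntegrableOn _, fun φ hφ hc _ => ?_⟩
  have hφ' := continuous_fderiv_apply_of_contDiff hφ (by simp) a
  rw [integral_mul_fderiv_eq_neg_fderiv_mul_of_integrable
    ((hu'.mul hφ.continuous).integrable_of_hasCompactSupport hc.mul_left)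
    ((hu.continuous.mul hφ').integrable_of_hasCompactSupport (hc.fderiv_apply ℝ a).mul_left)
    ((hu.continuous.mul hφ.continuous).integrable_of_hasCompactSupport hc.mul_left)
    (fun x _ => hu.differentiable one_ne_zero x)
    (fun x _ => hφ.differentiable (by simp) x)]
  simp only [mul_comm]

theorem HasWeakDeriv.fderiv_mollify {v : E → ℝ} (hv : LocallyIntegrable v)
    (hw : HasWeakDeriv U v a g) (ρ : ContDiffBump (0 : E)) {x : E}
    (hx : Metric.closedBall x ρ.rOut ⊆ U) : fderiv ℝ (mollify ρ v) x a = mollify ρ g x := by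
  have hρ : ContDiff ℝ ∞ (ρ.normed volume) := ρ.contDiff_normed
  have hs : tsupport (fun t => ρ.normed volume (x - t)) ⊆ Metric.closedBall x ρ.rOut := by
    refine closure_minimal (fun t ht => ?_) Metric.isClosed_closedBall
    have hxt : x - t ∈ Function.support (ρ.normed volume) := ht
    rw [ρ.support_normed_eq, mem_ball_zero_iff] at hxt
    rw [Metric.mem_closedBall, dist_comm, dist_eq_norm]
    exact hxt.le
  have hc : HasCompactSupport fun t => ρ.normed volume (x - t) :=
    (isCompact_closedBall x ρ.rOut).of_isClosed_subset (isClosed_tsupport _) hs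
  have hderiv : ∀ t, fderiv ℝ (fun t => ρ.normed volume (x - t)) t a =
      - fderiv ℝ (ρ.normed volume) (x - t) a := fun t => by
    have hcomp := ((hρ.differentiable (by simp) (x - t)).hasFDerivAt).comp t
      ((hasFDerivAt_id t).const_sub x)
    rw [show (fun t => ρ.normed volume (x - t)) = ρ.normed volume ∘ (x - ·) from rfl,
      hcomp.fderiv]
    simp
  have hint := hw.integral_eq (fun t => ρ.normed volume (x - t))
    (hρ.comp (contDiff_const.sub contDiff_id)) hc (hs.trans hx)
  simp only [hderiv, mul_neg, integral_neg, neg_inj] at hint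
  rw [fderiv_mollify_apply ρ hv, hint, mollify_apply]
  simp only [mul_comm]

/-- A local form of the Meyers–Serrin theorem. -/
theorem HasWeakDeriv.exists_contDiff_tendsto (hU : IsOpen U) (hu : HasWeakDeriv U u a g)
    {K : Set E} (hK : IsCompact K) (hKU : K ⊆ U) :
    ∃ W, K ⊆ W ∧ IsCompact (closure W) ∧ closure W ⊆ U ∧ ∃ w : ℕ → E → ℝ,
      (∀ n, ContDiff ℝ ∞ (w n)) ∧
      Tendsto (fun n => ∫ x in W, |w n x - u x|) atTop (𝓝 0) ∧
      Tendsto (fun n => ∫ x in W, |fderiv ℝ (w n) x a - g x|) atTop (𝓝 0) ∧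
      ∀ᵐ x ∂(volume.restrict W), Tendsto (fun n => w n x) atTop (𝓝 (u x)) := by
  obtain ⟨V, hV, hKV, hVU, hVc⟩ := exists_open_between_and_isCompact_closure hK hU hKU
  obtain ⟨W, hW, hKW, hWV, hWc⟩ := exists_open_between_and_isCompact_closure hK hV hKV
  have huV := (hu.1.integrableOn_compact_subset hVU hVc).mono_set subset_closure
  have hgV := (hu.2.integrableOn_compact_subset hVU hVc).mono_set subset_closure
  have huV' : Integrable (V.indicator u) := (integrable_indicator_iff hV.measurableSet).2 huV
  have hgV' : Integrable (V.indicator g) := (integrable_indicator_iff hV.measurableSet).2 hgV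
  have hweak : HasWeakDeriv V (V.indicator u) a (V.indicator g) :=
    (hu.mono (subset_closure.trans hVU)).congr_ae
      (indicator_ae_eq_restrict hV.measurableSet).symm
      (indicator_ae_eq_restrict hV.measurableSet).symm
  have hWV' : W ⊆ V := subset_closure.trans hWV
  have hL1 : ∀ {v : E → ℝ}, Integrable (V.indicator v) → Tendsto (fun n => ∫ x in W,
      |mollify (stdBump E n) (V.indicator v) x - v x|) atTop (𝓝 0) := fun {v} hv => by
    refine squeeze_zero (fun n => integral_nonneg fun x => abs_nonneg _) (fun n => ?_)
      (tendsto_integral_abs_mollify_sub hv)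
    rw [setIntegral_congr_fun (μ := volume)
      (g := fun x => |mollify (stdBump E n) (V.indicator v) x - V.indicator v x|)
      hW.measurableSet fun x hx => by simp only [Set.indicator_of_mem (hWV' hx)]]
    exact setIntegral_le_integral ((integrable_mollify _ hv).sub hv).abs
      (.of_forall fun x => abs_nonneg _)
  refine ⟨W, hKW, hWc, hWV.trans (subset_closure.trans hVU),
    fun n => mollify (stdBump E n) (V.indicator u),
    fun n => contDiff_mollify _ huV'.locallyIntegrable, hL1 huV', (hL1 hgV').congr' ?_, ?_⟩
  · obtain ⟨δ, hδ, hδV⟩ := hWc.exists_cthickening_subset_open hV hWV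
    filter_upwards [(tendsto_stdBump_rOut (E := E)).eventually (gt_mem_nhds hδ)] with n hn
    refine setIntegral_congr_fun hW.measurableSet fun x hx => ?_
    have hball : Metric.closedBall x (stdBump E n).rOut ⊆ V :=
      (Metric.closedBall_subset_cthickening (subset_closure hx) _).trans
        ((Metric.cthickening_mono hn.le _).trans hδV)
    simp only [hweak.fderiv_mollify huV'.locallyIntegrable _ hball]
  · filter_upwards [ae_restrict_of_ae (ae_tendsto_mollify huV'.locallyIntegrable),
      ae_restrict_mem hW.measurableSet] with x hx hxW
    rwa [Set.indicator_of_mem (hWV' hxW)] at hx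

theorem HasWeakDeriv.comp (hU : IsOpen U) (hu : HasWeakDeriv U u a g) {F F' : ℝ → ℝ} {C : ℝ}
    (hF : ∀ s, HasDerivAt F (F' s) s) (hF' : Continuous F') (hC : ∀ s, |F' s| ≤ C) :
    HasWeakDeriv U (fun x => F (u x)) a (fun x => F' (u x) * g x) := by
  have hlip : ∀ s t, |F s - F t| ≤ C * |s - t| := fun s t => by
    simpa using convex_univ.norm_image_sub_le_of_norm_hasDerivWithin_le (f := F) (f' := F')
      (x := t) (y := s) (C := C)
      (fun r _ => (hF r).hasDerivWithinAt) (fun r _ => hC r) trivial trivial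
  have hF_contDiff : ContDiff ℝ 1 F :=
    contDiff_one_iff_deriv.2 ⟨fun s => (hF s).differentiableAt, by rwa [deriv_eq hF]⟩
  have hF_int := locallyIntegrableOn_comp_of_abs_sub_le hU hF_contDiff.continuous hlip hu.1
  have hF'_int : LocallyIntegrableOn (fun x => F' (u x) * g x) U :=
    (locallyIntegrableOn_iff hU.isLocallyClosed).2 fun K hKU hK =>
      (hu.2.integrableOn_compact_subset hKU hK).bdd_mul (hF'.comp_aestronglyMeasurable
        (hu.1.integrableOn_compact_subset hKU hK).aestronglyMeasurable) (.of_forall fun x => hC _)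
  refine .of_forall_isCompact hU fun K hKU hK => ?_
  obtain ⟨W, hKW, hWc, hWU, w, hw, hwu, hwg, hae⟩ := hu.exists_contDiff_tendsto hU hK hKU
  have hw' : ∀ n, ContDiff ℝ 1 (w n) := fun n => (hw n).of_le (by simp)
  have hint : ∀ {f : E → ℝ}, Continuous f → IntegrableOn f W := fun hf =>
    (hf.continuousOn.integrableOn_compact hWc).mono_set subset_closure
  have hdw := fun n => continuous_fderiv_apply_of_contDiff (hw' n) one_ne_zero a
  have huW := (hu.1.integrableOn_compact_subset hWU hWc).mono_set subset_closure
  have hgW := (hu.2.integrableOn_compact_subset hWU hWc).mono_set subset_closure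
  have hchain : ∀ n x, fderiv ℝ (fun y => F (w n y)) x a = F' (w n x) * fderiv ℝ (w n) x a :=
    fun n x => by
      have := (hF (w n x)).comp_hasFDerivAt x ((hw' n).differentiable one_ne_zero x).hasFDerivAt
      rw [show (fun y => F (w n y)) = F ∘ w n from rfl, this.fderiv]
      simp
  refine ⟨W, hKW, .of_tendsto_setIntegral_abs_sub (l := atTop)
    (.of_forall fun n => hasWeakDeriv_of_contDiff (hF_contDiff.comp (hw' n)))
    (hF_int.mono_set (subset_closure.trans hWU)) (hF'_int.mono_set (subset_closure.trans hWU))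
    (fun L hLW _ => ?_) (fun L hLW _ => ?_)⟩
  · exact tendsto_integral_abs_comp_sub hlip (fun n => (hint (hw n).continuous).mono_set hLW)
      (huW.mono_set hLW) (tendsto_setIntegral_abs_of_subset hLW
        (fun n => (hint (hw n).continuous).sub huW) hwu)
  · simp only [Function.comp_def, hchain]
    exact tendsto_integral_abs_mul_sub_mul
      (fun n => (hF'.comp (hw n).continuous).aestronglyMeasurable)
      (hF'.comp_aestronglyMeasurable (huW.mono_set hLW).aestronglyMeasurable)
      (fun n x => hC _) (fun x => hC _)
      (fun n => (hint (hdw n)).mono_set hLW) (hgW.mono_set hLW)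
      ((ae_restrict_of_ae_restrict_of_subset hLW hae).mono fun x hx => (hF'.tendsto _).comp hx)
      (tendsto_setIntegral_abs_of_subset hLW (fun n => (hint (hdw n)).sub hgW) hwg)

end ChainRule

section Constancy

theorem exists_ae_eq_const_of_locally {X β : Type*} [TopologicalSpace X] [MeasurableSpace X]
    [OpensMeasurableSpace X] [SecondCountableTopology X] {μ : Measure X} [μ.IsOpenPosMeasure]
    [Nonempty β] {U : Set X} (hU : IsOpen U) (hUc : IsPreconnected U) {u : X → β}
    (hu : ∀ x ∈ U, ∃ V, IsOpen V ∧ x ∈ V ∧ ∃ c, ∀ᵐ y ∂(μ.restrict V), u y = c) :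
    ∃ c, ∀ᵐ x ∂(μ.restrict U), u x = c := by
  rcases U.eq_empty_or_nonempty with rfl | ⟨x₀, hx₀⟩
  · exact ⟨Classical.arbitrary β, by simp⟩
  choose! V hVo hxV c hc using hu
  have hconst : ∀ y ∈ U, c x₀ = c y := fun y hy => by
    refine hUc.induction₂ (fun x y => c x = c y) (fun x hx => ?_) (fun _ _ _ _ _ _ => Eq.trans)
      (fun _ _ _ _ => Eq.symm) hx₀ hy
    filter_upwards [self_mem_nhdsWithin,
      mem_nhdsWithin_of_mem_nhds ((hVo x hx).mem_nhds (hxV x hx))] with z hz hzx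
    have hpos : (ae (μ.restrict (V x ∩ V z))).NeBot := by
      rw [ae_neBot, Ne, Measure.restrict_eq_zero]
      exact (((hVo x hx).inter (hVo z hz)).measure_pos μ ⟨z, hzx, hxV z hz⟩).ne'
    obtain ⟨t, htx, htz⟩ := ((ae_restrict_of_ae_restrict_of_subset Set.inter_subset_left
      (hc x hx)).and (ae_restrict_of_ae_restrict_of_subset Set.inter_subset_right (hc z hz))).exists
    rw [← htx, ← htz]
  refine ⟨c x₀, ?_⟩
  rw [ae_restrict_iff' hU.measurableSet, ae_iff]
  refine measure_null_of_locally_null _ fun x hx => ?_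
  have hxU : x ∈ U := by_contra fun hxU => hx fun hxU' => absurd hxU' hxU
  refine ⟨_, inter_mem_nhdsWithin _ ((hVo x hxU).mem_nhds (hxV x hxU)), ?_⟩
  have hnull := hc x hxU
  rw [ae_restrict_iff' (hVo x hxU).measurableSet, ae_iff] at hnull
  refine measure_mono_null (fun y hy => ?_) hnull
  exact fun hy' => hy.1 fun _ => by rw [hconst x hxU, hy' hy.2]

variable {E : Type*} [NormedAddCommGroup E] [NormedSpace ℝ E] [FiniteDimensional ℝ E]
  [MeasureSpace E] [BorelSpace E] [(volume : Measure E).IsAddHaarMeasure]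
  {U : Set E} {u : E → ℝ}

theorem mollify_eq_of_hasWeakDeriv_zero {v : E → ℝ} (hv : LocallyIntegrable v) {x₀ : E} {r : ℝ}
    (hu : ∀ a, HasWeakDeriv (Metric.ball x₀ (2 * r)) v a 0) {ρ : ContDiffBump (0 : E)}
    (hρ : ρ.rOut < r) {x : E} (hx : x ∈ Metric.ball x₀ r) :
    mollify ρ v x = mollify ρ v x₀ := by
  refine Metric.isOpen_ball.is_const_of_fderiv_eq_zero (𝕜 := ℝ) (convex_ball x₀ r).isPreconnected
    ((contDiff_mollify ρ hv).differentiable (by simp)).differentiableOn (fun y hy => ?_) hx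
    (Metric.mem_ball_self (ρ.rOut_pos.trans hρ))
  ext a
  have hball : Metric.closedBall y ρ.rOut ⊆ Metric.ball x₀ (2 * r) := fun z hz => by
    rw [Metric.mem_closedBall] at hz
    rw [Metric.mem_ball] at hy ⊢
    linarith [dist_triangle z y x₀]
  rw [(hu a).fderiv_mollify hv ρ hball]
  simp [mollify_apply]

theorem exists_ae_eq_const_on_ball {x₀ : E} {r : ℝ} (hr : 0 < r)
    (hb : Metric.closedBall x₀ (2 * r) ⊆ U) (hu : ∀ a, HasWeakDeriv U u a 0) :
    ∃ c, ∀ᵐ x ∂(volume.restrict (Metric.ball x₀ r)), u x = c := by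
  set B := Metric.ball x₀ (2 * r)
  have hBU : B ⊆ U := Metric.ball_subset_closedBall.trans hb
  have hint : Integrable (B.indicator u) := by
    rw [integrable_indicator_iff Metric.isOpen_ball.measurableSet]
    exact ((hu 0).1.integrableOn_compact_subset hb (isCompact_closedBall _ _)).mono_set
      Metric.ball_subset_closedBall
  have hweak : ∀ a, HasWeakDeriv B (B.indicator u) a 0 := fun a =>
    ((hu a).mono hBU).congr_ae (indicator_ae_eq_restrict Metric.isOpen_ball.measurableSet).symm
      (.refl _ _)
  have hlim : ∀ᵐ x ∂(volume.restrict (Metric.ball x₀ r)),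
      Tendsto (fun n => mollify (stdBump E n) (B.indicator u) x₀) atTop (𝓝 (u x)) := by
    filter_upwards [ae_restrict_of_ae (ae_tendsto_mollify hint.locallyIntegrable),
      ae_restrict_mem Metric.isOpen_ball.measurableSet] with x hx hxb
    rw [Set.indicator_of_mem (Metric.ball_subset_ball (by linarith) hxb)] at hx
    refine hx.congr' ?_
    filter_upwards [(tendsto_stdBump_rOut (E := E)).eventually (gt_mem_nhds hr)] with n hn
    exact mollify_eq_of_hasWeakDeriv_zero hint.locallyIntegrable hweak hn hxb
  have hpos : (ae (volume.restrict (Metric.ball x₀ r))).NeBot := by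
    rw [ae_neBot, Ne, Measure.restrict_eq_zero]
    exact (Metric.measure_ball_pos volume x₀ hr).ne'
  obtain ⟨y, hy⟩ := hlim.exists
  exact ⟨u y, hlim.mono fun x hx => tendsto_nhds_unique hx hy⟩

theorem exists_ae_eq_const_of_hasWeakDeriv_zero (hU : IsOpen U) (hUc : IsPreconnected U)
    (hu : ∀ a, HasWeakDeriv U u a 0) : ∃ c, ∀ᵐ x ∂(volume.restrict U), u x = c := by
  refine exists_ae_eq_const_of_locally hU hUc fun x hx => ?_
  obtain ⟨r, hr, hrU⟩ := Metric.nhds_basis_closedBall.mem_iff.1 (hU.mem_nhds hx)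
  exact ⟨Metric.ball x (r / 2), Metric.isOpen_ball, Metric.mem_ball_self (half_pos hr),
    exists_ae_eq_const_on_ball (half_pos hr) (by rwa [mul_div_cancel₀ r two_ne_zero]) hu⟩

end Constancy

section WeakGrad

variable {d : ℕ} {Ω : Set (Eucl d)} {u v : Eucl d → ℝ} {G G' : Eucl d → Eucl d}

theorem setIntegral_eq_integral_of_tsupport_subset {X : Type*} [TopologicalSpace X]
    [MeasurableSpace X] {μ : Measure X} {S : Set X} {φ f : X → ℝ} (hs : tsupport φ ⊆ S)
    (hf : ∀ x ∉ tsupport φ, f x = 0) : ∫ x in S, f x ∂μ = ∫ x, f x ∂μ :=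
  setIntegral_eq_integral_of_forall_compl_eq_zero fun x hx => hf x fun h => hx (hs h)

theorem isWeakGrad_iff_hasWeakDeriv : IsWeakGrad Ω u G ↔ LocallyIntegrableOn G (interior Ω) ∧
    ∀ a, HasWeakDeriv (interior Ω) u a (fun x => inner ℝ (G x) a) := by
  have hint : ∀ {φ : Eucl d → ℝ} (a : Eucl d), tsupport φ ⊆ interior Ω →
      (∫ x in Ω, u x * fderiv ℝ φ x a = - ∫ x in Ω, φ x * inner ℝ (G x) a ↔
        ∫ x, u x * fderiv ℝ φ x a = - ∫ x, φ x * inner ℝ (G x) a) := fun {φ} a hs => by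
    have hφ : ∀ x ∉ tsupport φ, fderiv ℝ φ x a = 0 := fun x hx =>
      image_eq_zero_of_notMem_tsupport (f := fun y => fderiv ℝ φ y a)
        fun hx' => hx (tsupport_fderiv_apply_subset ℝ a hx')
    rw [setIntegral_eq_integral_of_tsupport_subset (hs.trans interior_subset)
        fun x hx => by rw [hφ x hx, mul_zero],
      setIntegral_eq_integral_of_tsupport_subset (hs.trans interior_subset)
        fun x hx => by rw [image_eq_zero_of_notMem_tsupport hx, zero_mul]]
  refine ⟨fun h => ⟨h.2.1, fun a => ⟨h.1, ?_, fun φ hφ hc hs =>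
    (hint a hs).1 (h.2.2 φ hφ hc hs a)⟩⟩, fun h => ⟨(h.2 0).1, h.1, fun φ hφ hc hs a =>
    (hint a hs).2 ((h.2 a).integral_eq φ hφ hc hs)⟩⟩
  exact (locallyIntegrableOn_iff isOpen_interior.isLocallyClosed).2 fun K hKU hK =>
    (h.2.1.integrableOn_compact_subset hKU hK).inner_const a

theorem IsWeakGrad.hasWeakDeriv (h : IsWeakGrad Ω u G) (a : Eucl d) :
    HasWeakDeriv (interior Ω) u a (fun x => inner ℝ (G x) a) :=
  (isWeakGrad_iff_hasWeakDeriv.1 h).2 a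

theorem IsWeakGrad.hasWeakDeriv_single (h : IsWeakGrad Ω u G) (i : Fin d) :
    HasWeakDeriv (interior Ω) u (EuclideanSpace.single i 1) (fun x => G x i) := by
  simpa [EuclideanSpace.inner_single_right] using h.hasWeakDeriv (EuclideanSpace.single i 1)

theorem isWeakGrad_of_hasWeakDeriv_single (hu : LocallyIntegrableOn u (interior Ω))
    (hG : LocallyIntegrableOn G (interior Ω))
    (h : ∀ i, HasWeakDeriv (interior Ω) u (EuclideanSpace.single i 1) (fun x => G x i)) :
    IsWeakGrad Ω u G := by
  refine isWeakGrad_iff_hasWeakDeriv.2 ⟨hG, fun a => ?_⟩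
  have ha : ∑ i, a i • EuclideanSpace.single i (1 : ℝ) = a := by
    simpa using (EuclideanSpace.basisFun (Fin d) ℝ).sum_repr a
  have hsum := HasWeakDeriv.sum_smul (s := Finset.univ) hu (fun i _ => h i) fun i => a i
  rw [ha] at hsum
  simpa [PiLp.inner_apply] using hsum

theorem IsWeakGrad.unique (h : IsWeakGrad Ω u G) (h' : IsWeakGrad Ω u G') :
    G =ᵐ[volume.restrict (interior Ω)] G' := by
  have hcoord := ae_all_iff.2 fun i =>
    (h.hasWeakDeriv_single i).unique isOpen_interior (h'.hasWeakDeriv_single i)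
  filter_upwards [hcoord] with x hx
  ext i
  exact hx i

theorem WeaklyDifferentiable.isWeakGrad (h : WeaklyDifferentiable Ω u) :
    IsWeakGrad Ω u (weakGrad Ω u) := by
  rw [weakGrad, dif_pos h]
  exact h.choose_spec

theorem IsWeakGrad.congr_ae (h : IsWeakGrad Ω u G) (huv : u =ᵐ[volume.restrict (interior Ω)] v) :
    IsWeakGrad Ω v G :=
  isWeakGrad_iff_hasWeakDeriv.2 ⟨h.2.1, fun a => (h.hasWeakDeriv a).congr_ae huv (.refl _ _)⟩

theorem IsWeakGrad.add (h : IsWeakGrad Ω u G) (h' : IsWeakGrad Ω v G') :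
    IsWeakGrad Ω (fun x => u x + v x) (fun x => G x + G' x) :=
  isWeakGrad_iff_hasWeakDeriv.2 ⟨h.2.1.add h'.2.1, fun a => by
    simpa only [inner_add_left] using (h.hasWeakDeriv a).add (h'.hasWeakDeriv a)⟩

theorem IsWeakGrad.const_mul (h : IsWeakGrad Ω u G) (c : ℝ) :
    IsWeakGrad Ω (fun x => c * u x) (fun x => c • G x) :=
  isWeakGrad_iff_hasWeakDeriv.2 ⟨h.2.1.smul c, fun a => by
    simpa only [real_inner_smul_left] using (h.hasWeakDeriv a).const_mul c⟩

end WeakGrad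

/-! ### The outward normal -/

section Normal

variable {d : ℕ} {Ω V : Set (Eucl d)} {ρ : Eucl d → ℝ} {x : Eucl d}

theorem IsOutwardUnitNormal.unique {v v' : Eucl d} (h : IsOutwardUnitNormal Ω x v)
    (h' : IsOutwardUnitNormal Ω x v') : v = v' := by
  by_contra hne
  have hlt : inner ℝ v v' < (1 : ℝ) := (inner_lt_one_iff_real_of_norm_eq_one h.1 h'.1).2 hne
  -- the direction `v' - v` enters `Ω` according to `v` and leaves it according to `v'`
  have henter := h.2.1 (v' - v) <| by
    rw [inner_sub_right, real_inner_self_eq_norm_sq, h.1]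
    linarith
  have hleave := h'.2.2 (v' - v) <| by
    rw [inner_sub_right, real_inner_self_eq_norm_sq, h'.1, real_inner_comm]
    linarith
  obtain ⟨t, hmem, hnotMem⟩ := (henter.and hleave).exists
  exact hnotMem hmem

theorem IsOutwardUnitNormal.outwardNormal_eq {v : Eucl d} (h : IsOutwardUnitNormal Ω x v) :
    outwardNormal Ω x = v := by
  have hex : ∃ v, IsOutwardUnitNormal Ω x v := ⟨v, h⟩
  rw [outwardNormal, dif_pos hex]
  exact hex.choose_spec.unique h

theorem tendsto_inv_mul_gradient {F : Type*} [NormedAddCommGroup F] [InnerProductSpace ℝ F]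
    [CompleteSpace F] {f : F → ℝ} {x : F} (hf : DifferentiableAt ℝ f x) (hx : f x = 0) (w : F) :
    Tendsto (fun t : ℝ => t⁻¹ * f (x + t • w)) (𝓝[>] 0) (𝓝 (inner ℝ (gradient f x) w)) := by
  rw [inner_gradient_left]
  simpa [hx] using (hf.hasFDerivAt.hasLineDerivAt w).tendsto_slope_zero_right

theorem continuous_gradient_of_contDiff {F : Type*} [NormedAddCommGroup F]
    [InnerProductSpace ℝ F] [CompleteSpace F] {f : F → ℝ} {n : WithTop ℕ∞} (hf : ContDiff ℝ n f)
    (hn : n ≠ 0) : Continuous (gradient f) :=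
  (LinearIsometryEquiv.continuous _).comp (hf.continuous_fderiv hn)

/-- `ρ` is a defining function of `Ω` on the open set `V`: a smooth function without critical
points whose sublevel set `{ρ ≤ 0}` is `Ω`. -/
structure IsDefiningFunction (Ω V : Set (Eucl d)) (ρ : Eucl d → ℝ) : Prop where
  isOpen : IsOpen V
  contDiff : ContDiff ℝ ∞ ρ
  gradient_ne_zero : ∀ y ∈ V, gradient ρ y ≠ 0
  mem_iff : ∀ y ∈ V, (y ∈ Ω ↔ ρ y ≤ 0)

theorem IsSmoothCompactDomain.exists_isDefiningFunction (hΩ : IsSmoothCompactDomain Ω)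
    (hx : x ∈ frontier Ω) : ∃ V ρ, x ∈ V ∧ IsDefiningFunction Ω V ρ := by
  obtain ⟨V, ρ, hV, hxV, hρ, hd, hVΩ⟩ := hΩ.smooth_boundary x hx
  have hdx : gradient ρ x ≠ 0 := by simpa [gradient] using hd
  exact ⟨V ∩ {y | gradient ρ y ≠ 0}, ρ, ⟨hxV, hdx⟩,
    hV.inter (isOpen_ne_fun (continuous_gradient_of_contDiff hρ (by simp)) continuous_const),
    hρ, fun y hy => hy.2, fun y hy => hVΩ y hy.1⟩

namespace IsDefiningFunction

theorem mem_interior (h : IsDefiningFunction Ω V ρ) (hx : x ∈ V) (hρx : ρ x < 0) :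
    x ∈ interior Ω := by
  rw [mem_interior_iff_mem_nhds]
  filter_upwards [h.isOpen.mem_nhds hx,
    h.contDiff.continuous.continuousAt.eventually (gt_mem_nhds hρx)] with z hz hρz
  exact (h.mem_iff z hz).2 hρz.le

theorem eq_zero (h : IsDefiningFunction Ω V ρ) (hΩ : IsClosed Ω) (hx : x ∈ V)
    (hxf : x ∈ frontier Ω) : ρ x = 0 :=
  le_antisymm ((h.mem_iff x hx).1 (hΩ.frontier_subset hxf))
    (not_lt.1 fun hlt => hxf.2 (h.mem_interior hx hlt))

theorem isOutwardUnitNormal (h : IsDefiningFunction Ω V ρ) (hx : x ∈ V) (hρx : ρ x = 0) :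
    IsOutwardUnitNormal Ω x (‖gradient ρ x‖⁻¹ • gradient ρ x) := by
  have hpos : 0 ≤ ‖gradient ρ x‖⁻¹ := by positivity
  have hmem : ∀ w : Eucl d, ∀ᶠ t : ℝ in 𝓝[>] 0, x + t • w ∈ V := fun w =>
    ((by fun_prop : ContinuousAt (fun t : ℝ => x + t • w) 0).eventually_mem
      (h.isOpen.mem_nhds (by simpa using hx))).filter_mono nhdsWithin_le_nhds
  have hslope := tendsto_inv_mul_gradient (h.contDiff.differentiable (by simp) x) hρx
  refine ⟨norm_smul_inv_norm (𝕜 := ℝ) (h.gradient_ne_zero x hx), fun w hw => ?_, fun w hw => ?_⟩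
  · rw [real_inner_smul_left] at hw
    filter_upwards [hmem w, (hslope w).eventually (gt_mem_nhds (neg_of_mul_neg_right hw hpos)),
      self_mem_nhdsWithin] with t htV hlt ht
    exact (h.mem_iff _ htV).2 (neg_of_mul_neg_right hlt (inv_pos.2 ht).le).le
  · rw [real_inner_smul_left] at hw
    filter_upwards [hmem w, (hslope w).eventually (lt_mem_nhds (pos_of_mul_pos_right hw hpos)),
      self_mem_nhdsWithin] with t htV hlt ht
    rw [h.mem_iff _ htV, not_le]
    exact pos_of_mul_pos_right hlt (inv_pos.2 ht).le

theorem outwardNormal_eq (h : IsDefiningFunction Ω V ρ) (hΩ : IsClosed Ω) (hx : x ∈ V)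
    (hxf : x ∈ frontier Ω) : outwardNormal Ω x = ‖gradient ρ x‖⁻¹ • gradient ρ x :=
  (h.isOutwardUnitNormal hx (h.eq_zero hΩ hx hxf)).outwardNormal_eq

end IsDefiningFunction

namespace IsSmoothCompactDomain

theorem norm_outwardNormal (hΩ : IsSmoothCompactDomain Ω) (hx : x ∈ frontier Ω) :
    ‖outwardNormal Ω x‖ = 1 := by
  obtain ⟨V, ρ, hxV, hρ⟩ := hΩ.exists_isDefiningFunction hx
  rw [hρ.outwardNormal_eq hΩ.isCompact.isClosed hxV hx]
  exact norm_smul_inv_norm (𝕜 := ℝ) (hρ.gradient_ne_zero x hxV)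

theorem continuousOn_outwardNormal (hΩ : IsSmoothCompactDomain Ω) :
    ContinuousOn (outwardNormal Ω) (frontier Ω) := by
  intro x hx
  obtain ⟨V, ρ, hxV, hρ⟩ := hΩ.exists_isDefiningFunction hx
  have hgrad := (continuous_gradient_of_contDiff hρ.contDiff (by simp)).continuousAt (x := x)
  have heq := fun y => hρ.outwardNormal_eq (x := y) hΩ.isCompact.isClosed
  refine ((hgrad.norm.inv₀ (norm_ne_zero_iff.2 (hρ.gradient_ne_zero x hxV))).smul
    hgrad).continuousWithinAt.congr_of_eventuallyEq ?_ (heq x hxV hx)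
  filter_upwards [self_mem_nhdsWithin, mem_nhdsWithin_of_mem_nhds (hρ.isOpen.mem_nhds hxV)]
    with y hy hyV
  exact heq y hyV hy

end IsSmoothCompactDomain

end Normal

/-! ### The cone property -/

section Cone

variable {F : Type*} [NormedAddCommGroup F] [InnerProductSpace ℝ F]

/-- `Ω` has the interior cone property around `x` with axis `n`, aperture `ε` and radius `r`:
inside the ball of radius `r` around `x`, moving from a point of `Ω` in a direction of the open
cone around `-n` leads into the interior of `Ω`. -/
def HasConeProperty (Ω : Set F) (x n : F) (ε r : ℝ) : Prop :=
  ∀ y ∈ Metric.ball x r, ∀ y' ∈ Metric.ball x r,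
    ε * ‖y - y'‖ < inner ℝ n (y - y') → y ∈ Ω → y' ∈ interior Ω

theorem IsSmoothCompactDomain.exists_hasConeProperty {d : ℕ} {Ω : Set (Eucl d)}
    (hΩ : IsSmoothCompactDomain Ω) {x : Eucl d} (hx : x ∈ frontier Ω) {ε : ℝ} (hε : 0 < ε) :
    ∃ r > 0, HasConeProperty Ω x (outwardNormal Ω x) ε r := by
  obtain ⟨V, ρ, hxV, hρ⟩ := hΩ.exists_isDefiningFunction hx
  have hpos : 0 < ‖gradient ρ x‖ := norm_pos_iff.2 (hρ.gradient_ne_zero x hxV)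
  -- strict differentiability compares `ρ y - ρ y'` with `⟪∇ρ x, y - y'⟫` for both points near `x`
  have hstrict : HasStrictFDerivAt ρ (fderiv ℝ ρ x) x :=
    hρ.contDiff.contDiffAt.hasStrictFDerivAt (by simp)
  have hlittle := hstrict.isLittleO.def (mul_pos hε hpos)
  rw [nhds_prod_eq] at hlittle
  obtain ⟨t, ht, htρ⟩ := eventually_prod_self_iff'.1 hlittle
  obtain ⟨r, hr, hball⟩ := Metric.mem_nhds_iff.1 (inter_mem ht (hρ.isOpen.mem_nhds hxV))
  refine ⟨r, hr, fun y hy y' hy' hlt hyΩ => hρ.mem_interior (hball hy').2 ?_⟩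
  have hρy := (hρ.mem_iff y (hball hy).2).1 hyΩ
  have hclose := htρ y (hball hy).1 y' (hball hy').1
  simp only [← inner_gradient_left, Real.norm_eq_abs] at hclose
  rw [hρ.outwardNormal_eq hΩ.isCompact.isClosed hxV hx, real_inner_smul_left,
    inv_mul_eq_div, lt_div_iff₀ hpos, mul_right_comm] at hlt
  linarith [(abs_le.1 hclose).1]

namespace HasConeProperty

variable {Ω : Set F} {x n y : F} {ε r t : ℝ}

theorem sub_smul_mem_interior (h : HasConeProperty Ω x n ε r) (hn : ‖n‖ = 1) (hε : ε < 1)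
    (hy : y ∈ Ω) (hyb : y ∈ Metric.ball x r) (ht : 0 < t) (htb : y - t • n ∈ Metric.ball x r) :
    y - t • n ∈ interior Ω := by
  refine h y hyb _ htb ?_ hy
  rw [sub_sub_cancel, norm_smul, inner_smul_right, real_inner_self_eq_norm_sq, hn,
    Real.norm_of_nonneg ht.le]
  nlinarith

theorem mem_closure_interior (h : HasConeProperty Ω x n ε r) (hn : ‖n‖ = 1) (hε : ε < 1)
    (hy : y ∈ Ω) (hyb : y ∈ Metric.ball x r) : y ∈ closure (interior Ω) := by
  have hlim : Tendsto (fun t : ℝ => y - t • n) (𝓝[>] 0) (𝓝 y) := by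
    have hcont : Continuous fun t : ℝ => y - t • n := by fun_prop
    simpa using (hcont.tendsto 0).mono_left nhdsWithin_le_nhds
  refine mem_closure_of_tendsto hlim ?_
  filter_upwards [hlim.eventually_mem (Metric.isOpen_ball.mem_nhds hyb), self_mem_nhdsWithin]
    with t htb ht
  exact h.sub_smul_mem_interior hn hε hy hyb ht htb

theorem sub_ne_smul_of_mem_frontier (h : HasConeProperty Ω x n ε r) (hn : ‖n‖ = 1)
    (hε : ε < 1) (hΩ : IsClosed Ω) {y' : F} (hy : y ∈ frontier Ω ∩ Metric.ball x r)
    (hy' : y' ∈ frontier Ω ∩ Metric.ball x r) (ht : 0 < t) : y - y' ≠ t • n := by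
  intro heq
  obtain rfl : y' = y - t • n := by rw [← heq, sub_sub_cancel]
  exact hy'.1.2 (h.sub_smul_mem_interior hn hε (hΩ.frontier_subset hy.1) hy.2 ht hy'.2)

end HasConeProperty

theorem measure_eq_zero_of_forall_sub_ne_smul {E : Type*} [NormedAddCommGroup E]
    [NormedSpace ℝ E] [FiniteDimensional ℝ E] [MeasurableSpace E] [BorelSpace E] (μ : Measure E)
    [μ.IsAddHaarMeasure] {S : Set E} (hS : MeasurableSet S) {a : E}
    (h : ∀ y ∈ S, ∀ y' ∈ S, ∀ t : ℝ, 0 < t → y - y' ≠ t • a) : μ S = 0 := by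
  refine Measure.addHaar_eq_zero_of_disjoint_translates μ
    (fun k : ℕ => (1 / ((k : ℝ) + 1)) • a) ?_ (fun k l hkl => ?_) hS
  · exact Metric.isBounded_range_of_tendsto _
      ((tendsto_one_div_add_atTop_nhds_zero_nat (𝕜 := ℝ)).smul_const a)
  wlog hlt : k < l generalizing k l
  · exact (this l k hkl.symm (hkl.lt_or_gt.resolve_left hlt)).symm
  simp only [Function.onFun, Set.singleton_add]
  rw [Set.disjoint_left]
  rintro _ ⟨y, hy, rfl⟩ ⟨y', hy', he⟩
  refine h y' hy' y hy (1 / ((k : ℝ) + 1) - 1 / ((l : ℝ) + 1))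
    (sub_pos.2 (Nat.one_div_lt_one_div hlt)) ?_
  simp only at he
  rw [sub_smul, sub_eq_sub_iff_add_eq_add, add_comm y', he]

namespace IsSmoothCompactDomain

variable {d : ℕ} {Ω : Set (Eucl d)}

theorem volume_frontier (hΩ : IsSmoothCompactDomain Ω) : volume (frontier Ω) = 0 := by
  refine measure_null_of_locally_null _ fun x hx => ?_
  obtain ⟨r, hr, hcone⟩ := hΩ.exists_hasConeProperty hx (ε := 1 / 2) (by norm_num)
  refine ⟨_, inter_mem_nhdsWithin _ (Metric.ball_mem_nhds x hr), ?_⟩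
  exact measure_eq_zero_of_forall_sub_ne_smul volume
    (isClosed_frontier.measurableSet.inter Metric.isOpen_ball.measurableSet)
    fun y hy y' hy' t ht => hcone.sub_ne_smul_of_mem_frontier (hΩ.norm_outwardNormal hx)
      (by norm_num) hΩ.isCompact.isClosed hy hy' ht

theorem restrict_interior (hΩ : IsSmoothCompactDomain Ω) :
    volume.restrict (interior Ω) = volume.restrict Ω :=
  Measure.restrict_congr_set (interior_ae_eq_of_null_frontier hΩ.volume_frontier)

theorem subset_closure_interior (hΩ : IsSmoothCompactDomain Ω) : Ω ⊆ closure (interior Ω) := by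
  intro x hx
  by_cases hxi : x ∈ interior Ω
  · exact subset_closure hxi
  have hxf : x ∈ frontier Ω := ⟨subset_closure hx, hxi⟩
  obtain ⟨r, hr, hcone⟩ := hΩ.exists_hasConeProperty hxf (ε := 1 / 2) (by norm_num)
  exact hcone.mem_closure_interior (hΩ.norm_outwardNormal hxf) (by norm_num) hx
    (Metric.mem_ball_self hr)

end IsSmoothCompactDomain

end Cone

/-! ### Connectedness of the interior -/

section Connectedness

theorem isPreconnected_of_subset_closure_of_locally {X : Type*} [TopologicalSpace X]
    {U S : Set X} (hUS : U ⊆ S) (hSU : S ⊆ closure U) (hS : IsPreconnected S)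
    (h : ∀ x ∈ S, ∃ V ∈ 𝓝 x, ∃ N ⊆ U, IsPreconnected N ∧ U ∩ V ⊆ N) : IsPreconnected U := by
  let R : X → X → Prop := fun x y =>
    ∃ N ⊆ U, IsPreconnected N ∧ x ∈ closure N ∧ y ∈ closure N
  have hlocal : ∀ x ∈ S, ∀ᶠ y in 𝓝[S] x, R x y := fun x hx => by
    obtain ⟨V, hV, N, hNU, hN, hVN⟩ := h x hx
    have hclosure : ∀ y ∈ S, V ∈ 𝓝 y → y ∈ closure N := fun y hy hVy =>
      closure_mono hVN (mem_closure_iff_nhds.2 fun W hW => by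
        simpa only [Set.inter_comm, Set.inter_assoc, Set.inter_left_comm] using
          mem_closure_iff_nhds.1 (hSU hy) _ (inter_mem hW hVy))
    filter_upwards [self_mem_nhdsWithin,
      mem_nhdsWithin_of_mem_nhds (eventually_mem_nhds_iff.2 hV)] with y hy hVy
    exact ⟨N, hNU, hN, hclosure x hx hV, hclosure y hy hVy⟩
  have htrans : ∀ x y z, x ∈ S → y ∈ S → z ∈ S → R x y → R y z → R x z := by
    rintro x y z - hy - ⟨N, hNU, hN, hxN, hyN⟩ ⟨N', hN'U, hN', hyN', hzN'⟩
    obtain ⟨V, hV, M, hMU, hM, hVM⟩ := h y hy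
    obtain ⟨p, hpV, hpN⟩ := mem_closure_iff_nhds.1 hyN V hV
    obtain ⟨q, hqV, hqN'⟩ := mem_closure_iff_nhds.1 hyN' V hV
    have hNM : IsPreconnected (N ∪ M) := hN.union p hpN (hVM ⟨hNU hpN, hpV⟩) hM
    exact ⟨N ∪ M ∪ N', by simp [hNU, hMU, hN'U],
      hNM.union q (.inr (hVM ⟨hN'U hqN', hqV⟩)) hqN' hN',
      closure_mono (fun _ h => .inl (.inl h)) hxN, closure_mono (fun _ h => .inr h) hzN'⟩
  refine isPreconnected_of_forall_pair fun x hx y hy => ?_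
  obtain ⟨N, hNU, hN, hxN, hyN⟩ := hS.induction₂ R hlocal htrans
    (fun _ _ _ _ ⟨N, hNU, hN, hx, hy⟩ => ⟨N, hNU, hN, hy, hx⟩) (hUS hx) (hUS hy)
  refine ⟨N ∪ {x, y}, Set.union_subset hNU (Set.pair_subset hx hy), by simp, by simp,
    hN.subset_closure Set.subset_union_left (Set.union_subset subset_closure ?_)⟩
  exact Set.pair_subset hxN hyN

variable {F : Type*} [NormedAddCommGroup F] [InnerProductSpace ℝ F] {Ω : Set F} {x n : F}
  {ε r : ℝ}

theorem convex_setOf_mul_norm_sub_lt_inner (hε : 0 ≤ ε) (x n : F) :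
    Convex ℝ {y | ε * ‖x - y‖ < inner ℝ n (x - y)} := by
  have hconvex : ConvexOn ℝ Set.univ fun y => ε * dist y x + inner ℝ n y :=
    ((convexOn_dist x convex_univ).smul hε).add ((innerₛₗ ℝ n).convexOn convex_univ)
  convert hconvex.convex_lt (inner ℝ n x) using 1
  ext y
  simp [inner_sub_right, dist_eq_norm, norm_sub_rev y x, lt_sub_iff_add_lt]

theorem HasConeProperty.subset_connectedComponentIn (h : HasConeProperty Ω x n (1 / 2) r)
    (hn : ‖n‖ = 1) (hr : 0 < r) (hx : x ∈ Ω) : interior Ω ∩ Metric.ball x (r / 8) ⊆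
      connectedComponentIn (interior Ω) (x - (r / 2) • n) := by
  set C := {y | 1 / 2 * ‖x - y‖ < inner ℝ n (x - y)} ∩ Metric.ball x r
  have hCΩ : C ⊆ interior Ω := fun y hy => h x (Metric.mem_ball_self hr) y hy.2 hy.1 hx
  have hC : Convex ℝ C :=
    (convex_setOf_mul_norm_sub_lt_inner (by norm_num) x n).inter (convex_ball x r)
  have hnn : inner ℝ n n = (1 : ℝ) := by rw [real_inner_self_eq_norm_sq, hn, one_pow]
  have hball : ∀ y ∈ Metric.ball x (r / 8), ∀ t, 0 ≤ t → t ≤ r / 2 →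
      y - t • n ∈ Metric.ball x r := fun y hy t ht htr => by
    rw [mem_ball_iff_norm] at hy ⊢
    have := norm_sub_le (y - x) (t • n)
    rw [norm_smul, hn, Real.norm_of_nonneg ht] at this
    rw [sub_right_comm]
    linarith
  have hend : ∀ y ∈ Metric.ball x (r / 8), y - (r / 2) • n ∈ C := fun y hy => by
    refine ⟨?_, hball y hy _ (by positivity) le_rfl⟩
    rw [mem_ball_iff_norm] at hy
    have hinner := (real_inner_le_norm n (y - x)).trans_eq (by rw [hn, one_mul])
    have hnorm := norm_sub_le ((r / 2) • n) (y - x)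
    rw [norm_smul, hn, Real.norm_of_nonneg (by positivity)] at hnorm
    rw [Set.mem_ofPred_eq, show x - (y - (r / 2) • n) = (r / 2) • n - (y - x) by abel,
      inner_sub_right, inner_smul_right, hnn]
    linarith
  rintro y ⟨hyΩ, hy⟩
  have hseg : segment ℝ y (y - (r / 2) • n) ⊆ interior Ω := by
    rw [segment_eq_image']
    rintro _ ⟨θ, hθ, rfl⟩
    have hpt : y + θ • (y - (r / 2) • n - y) = y - (θ * (r / 2)) • n := by
      rw [sub_sub_cancel_left, smul_neg, smul_smul, sub_eq_add_neg]
    simp only [hpt]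
    rcases hθ.1.eq_or_lt with rfl | hθ0
    · simpa using hyΩ
    · exact h.sub_smul_mem_interior hn (by norm_num) (interior_subset hyΩ)
        (Metric.ball_subset_ball (by linarith) hy) (by positivity)
        (hball y hy _ (by positivity) (mul_le_of_le_one_left (by positivity) hθ.2))
  have hconn : IsPreconnected (C ∪ segment ℝ y (y - (r / 2) • n)) :=
    hC.isPreconnected.union _ (hend y hy) (right_mem_segment ℝ _ _)
      (convex_segment _ _).isPreconnected
  exact hconn.subset_connectedComponentIn
    (.inl (hend x (Metric.mem_ball_self (by positivity)))) (Set.union_subset hCΩ hseg)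
    (.inr (left_mem_segment ℝ _ _))

theorem IsSmoothCompactDomain.isPreconnected_interior {d : ℕ} {Ω : Set (Eucl d)}
    (hΩ : IsSmoothCompactDomain Ω) : IsPreconnected (interior Ω) := by
  refine isPreconnected_of_subset_closure_of_locally interior_subset hΩ.subset_closure_interior
    hΩ.isConnected.isPreconnected fun x hx => ?_
  by_cases hxi : x ∈ interior Ω
  · obtain ⟨δ, hδ, hball⟩ := Metric.isOpen_iff.1 isOpen_interior x hxi
    exact ⟨_, Metric.ball_mem_nhds x hδ, _, hball, (convex_ball x δ).isPreconnected,
      Set.inter_subset_right⟩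
  · have hxf : x ∈ frontier Ω := ⟨subset_closure hx, hxi⟩
    obtain ⟨r, hr, hcone⟩ := hΩ.exists_hasConeProperty hxf (ε := 1 / 2) (by norm_num)
    exact ⟨_, Metric.ball_mem_nhds x (by positivity), _, connectedComponentIn_subset _ _,
      isPreconnected_connectedComponentIn,
      hcone.subset_connectedComponentIn (hΩ.norm_outwardNormal hxf) hr hx⟩

end Connectedness

/-! ### Graph charts at the boundary -/

section Charts

open scoped NNReal

variable {m : ℕ} {Ω : Set (Eucl (m + 1))} {n : Eucl (m + 1)}
  {Φ : (Eucl m × ℝ) ≃L[ℝ] Eucl (m + 1)} {z₀ : Eucl m} {t₀ a b ε : ℝ} {γ : Eucl m → ℝ}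

/-- `Φ` splits off the line spanned by the unit vector `n` isometrically, for the Euclidean norm
`√(‖z‖² + t²)` on the product. -/
structure IsSplitting (n : Eucl (m + 1)) (Φ : (Eucl m × ℝ) ≃L[ℝ] Eucl (m + 1)) : Prop where
  measurePreserving : MeasurePreserving Φ volume volume
  norm_sq : ∀ q, ‖Φ q‖ ^ 2 = ‖q.1‖ ^ 2 + q.2 ^ 2
  inner_eq : ∀ q, inner ℝ n (Φ q) = q.2
  map_one : Φ (0, 1) = n

theorem exists_isSplitting (hn : ‖n‖ = 1) : ∃ Φ, IsSplitting n Φ := by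
  have hfin : Module.finrank ℝ (WithLp 2 (Eucl m × ℝ)) = m + 1 := by
    rw [(WithLp.linearEquiv 2 ℝ (Eucl m × ℝ)).finrank_eq]
    simp
  have e₀ : WithLp 2 (Eucl m × ℝ) ≃ₗᵢ[ℝ] Eucl (m + 1) :=
    ((stdOrthonormalBasis ℝ (WithLp 2 (Eucl m × ℝ))).reindex (finCongr hfin)).repr
  set v := e₀ (WithLp.toLp 2 (0, 1)) with hv
  have hvn : ‖v‖ = ‖n‖ := by rw [hv, e₀.norm_map, hn]; simp
  let e : WithLp 2 (Eucl m × ℝ) ≃ₗᵢ[ℝ] Eucl (m + 1) :=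
    e₀.trans (Submodule.reflection (ℝ ∙ (v - n))ᗮ)
  have hen : e (WithLp.toLp 2 (0, 1)) = n := by
    simp only [e, LinearIsometryEquiv.trans_apply, ← hv]
    exact Submodule.reflection_sub hvn
  let Φ : (Eucl m × ℝ) ≃L[ℝ] Eucl (m + 1) :=
    (WithLp.prodContinuousLinearEquiv 2 ℝ (Eucl m) ℝ).symm.trans e.toContinuousLinearEquiv
  have hΦe : ∀ q, Φ q = e (WithLp.toLp 2 q) := fun q => rfl
  refine ⟨Φ, e.measurePreserving.comp (WithLp.volume_preserving_toLp (Eucl m) ℝ), fun q => ?_,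
    fun q => ?_, ?_⟩
  · rw [hΦe, e.norm_map, WithLp.prod_norm_sq_eq_of_L2]
    simp
  · rw [hΦe, ← hen, e.inner_map_map, WithLp.prod_inner_apply]
    simp
  · rw [hΦe, hen]

namespace IsSplitting

theorem norm_fst_le (h : IsSplitting n Φ) (q : Eucl m × ℝ) : ‖q.1‖ ≤ ‖Φ q‖ := by
  refine le_of_sq_le_sq ?_ (norm_nonneg _)
  rw [h.norm_sq]
  nlinarith

theorem abs_snd_le (h : IsSplitting n Φ) (q : Eucl m × ℝ) : |q.2| ≤ ‖Φ q‖ := by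
  refine le_of_sq_le_sq ?_ (norm_nonneg _)
  rw [h.norm_sq, sq_abs]
  nlinarith [sq_nonneg ‖q.1‖]

theorem norm_le (h : IsSplitting n Φ) (q : Eucl m × ℝ) : ‖Φ q‖ ≤ ‖q.1‖ + |q.2| := by
  refine le_of_sq_le_sq ?_ (by positivity)
  rw [h.norm_sq, add_sq, sq_abs]
  nlinarith [mul_nonneg (norm_nonneg q.1) (abs_nonneg q.2)]

theorem lipschitzWith_fst_symm (h : IsSplitting n Φ) :
    LipschitzWith 1 (fun y => (Φ.symm y).1) := by
  refine LipschitzWith.of_dist_le_mul fun y y' => ?_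
  rw [dist_eq_norm, dist_eq_norm, NNReal.coe_one, one_mul]
  have := h.norm_fst_le (Φ.symm (y - y'))
  rwa [Φ.apply_symm_apply, map_sub] at this

theorem apply_sub_apply (z z' : Eucl m) (t t' : ℝ) :
    Φ (z, t) - Φ (z', t') = Φ (z - z', t - t') := by
  rw [← map_sub, Prod.mk_sub_mk]

theorem apply_mem_ball (h : IsSplitting n Φ) {z : Eucl m} {t : ℝ} (hz : z ∈ Metric.ball z₀ a)
    (ht : |t - t₀| < b) : Φ (z, t) ∈ Metric.ball (Φ (z₀, t₀)) (a + b) := by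
  rw [mem_ball_iff_norm] at hz ⊢
  rw [apply_sub_apply]
  exact (h.norm_le (z - z₀, t - t₀)).trans_lt (add_lt_add hz ht)

theorem mem_ball_and_abs_sub_lt (h : IsSplitting n Φ) {z : Eucl m} {t : ℝ}
    (hzt : Φ (z, t) ∈ Metric.ball (Φ (z₀, t₀)) a) : z ∈ Metric.ball z₀ a ∧ |t - t₀| < a := by
  rw [mem_ball_iff_norm, apply_sub_apply] at hzt
  rw [mem_ball_iff_norm]
  exact ⟨(h.norm_fst_le (z - z₀, t - t₀)).trans_lt hzt,
    (h.abs_snd_le (z - z₀, t - t₀)).trans_lt hzt⟩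

theorem mem_interior_of_hasConeProperty (h : IsSplitting n Φ) {x : Eucl (m + 1)} {r : ℝ}
    (hcone : HasConeProperty Ω x n ε r) (hε : 0 ≤ ε) {z z' : Eucl m} {t t' : ℝ}
    (hy : Φ (z, t) ∈ Metric.ball x r) (hy' : Φ (z', t') ∈ Metric.ball x r)
    (hlt : ε * (‖z - z'‖ + |t - t'|) < t - t') (hmem : Φ (z, t) ∈ Ω) :
    Φ (z', t') ∈ interior Ω := by
  refine hcone _ hy _ hy' ?_ hmem
  rw [apply_sub_apply, h.inner_eq]
  exact (mul_le_mul_of_nonneg_left (h.norm_le (z - z', t - t')) hε).trans_lt hlt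

theorem exists_height (h : IsSplitting n Φ) (hΩ : IsClosed Ω) (ha : 0 < a) (hε : 0 ≤ ε)
    (hε' : ε ≤ 1 / 2) (hx : Φ (z₀, t₀) ∈ frontier Ω)
    (hcone : HasConeProperty Ω (Φ (z₀, t₀)) n ε (4 * a)) {z : Eucl m}
    (hz : z ∈ Metric.ball z₀ a) :
    ∃ s : ℝ, |s - t₀| ≤ a ∧ Φ (z, s) ∈ Ω ∧
      ∀ t ∈ Set.Ioo s (t₀ + 2 * a), Φ (z, t) ∉ Ω := by
  have hcenter : Φ (z₀, t₀) ∈ Metric.ball (Φ (z₀, t₀)) (4 * a) :=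
    Metric.mem_ball_self (by positivity)
  have hball {t : ℝ} (ht : |t - t₀| < 2 * a) : Φ (z, t) ∈ Metric.ball (Φ (z₀, t₀)) (4 * a) :=
    Metric.ball_subset_ball (by linarith) (h.apply_mem_ball hz ht)
  have hz' := mem_ball_iff_norm.1 hz
  have hbot : Φ (z, t₀ - a) ∈ Ω := by
    refine interior_subset (h.mem_interior_of_hasConeProperty hcone hε hcenter (hball ?_) ?_
      (hΩ.frontier_subset hx))
    · rw [sub_sub_cancel_left, abs_neg, abs_of_pos ha]; linarith
    · rw [sub_sub_cancel, abs_of_pos ha, norm_sub_rev]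
      nlinarith [norm_nonneg (z - z₀)]
  have htop : ∀ t, t₀ + a ≤ t → t < t₀ + 2 * a → Φ (z, t) ∉ Ω := by
    intro t ht ht' hmem
    have hpos : 0 < t - t₀ := by linarith
    refine hx.2 (h.mem_interior_of_hasConeProperty hcone hε (hball ?_) hcenter ?_ hmem)
    · rw [abs_of_pos hpos]; linarith
    · rw [abs_of_pos hpos]
      nlinarith [norm_nonneg (z - z₀)]
  have hcompact : IsCompact (Set.Icc (t₀ - a) (t₀ + a) ∩ (fun t => Φ (z, t)) ⁻¹' Ω) :=
    isCompact_Icc.inter_right (hΩ.preimage (by fun_prop))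
  obtain ⟨s, ⟨hs, hsΩ⟩, hmax⟩ :=
    hcompact.exists_isGreatest ⟨t₀ - a, ⟨le_rfl, by linarith⟩, hbot⟩
  refine ⟨s, abs_le.2 ⟨by linarith [hs.1], by linarith [hs.2]⟩, hsΩ, fun t ht hmem => ?_⟩
  rcases le_or_gt (t₀ + a) t with htop' | htop'
  · exact htop t htop' ht.2 hmem
  · exact ht.1.not_ge (hmax ⟨⟨hs.1.trans ht.1.le, htop'.le⟩, hmem⟩)

theorem lipschitzOnWith_graph (h : IsSplitting n Φ) (hε : ε < 1) {s : Set (Eucl m)}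
    (hγ : ∀ z ∈ s, ∀ z' ∈ s, γ z - γ z' ≤ ε * ‖Φ (z - z', γ z - γ z')‖) :
    LipschitzOnWith (Real.toNNReal (1 - ε)⁻¹) (fun z => Φ (z, γ z)) s := by
  have hpos : 0 < 1 - ε := sub_pos.2 hε
  refine LipschitzOnWith.of_dist_le_mul fun z hz z' hz' => ?_
  rw [dist_eq_norm, dist_eq_norm, Real.coe_toNNReal _ (inv_nonneg.2 hpos.le), apply_sub_apply]
  have hle := hγ z' hz' z hz
  rw [← neg_sub z z', ← neg_sub (γ z) (γ z'), ← Prod.neg_mk, map_neg, norm_neg] at hle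
  have habs : |γ z - γ z'| ≤ ε * ‖Φ (z - z', γ z - γ z')‖ :=
    abs_le.2 ⟨by linarith, hγ z hz z' hz'⟩
  have hnorm : ‖Φ (z - z', γ z - γ z')‖ ≤ ‖z - z'‖ + |γ z - γ z'| := h.norm_le _
  rw [inv_mul_eq_div, le_div_iff₀ hpos]
  linarith

end IsSplitting

theorem mem_frontier_of_forall_notMem {X : Type*} [TopologicalSpace X] {S : Set X} {c : ℝ → X}
    {s : ℝ} (hc : ContinuousAt c s) (hsb : s < b) (hs : c s ∈ S)
    (hnot : ∀ t ∈ Set.Ioo s b, c t ∉ S) : c s ∈ frontier S := by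
  refine ⟨subset_closure hs, fun hint => ?_⟩
  have hmem : ∀ᶠ t in 𝓝[>] s, c t ∈ S :=
    ((hc.eventually_mem (isOpen_interior.mem_nhds hint)).filter_mono nhdsWithin_le_nhds).mono
      fun _ ht => interior_subset ht
  obtain ⟨t, htS, ht⟩ := (hmem.and (Ioo_mem_nhdsGT hsb)).exists
  exact hnot t ht htS

/-- In the coordinates `Φ`, the set `Ω` is the region below the graph of the Lipschitz function
`γ` over the ball of radius `a` around `z₀`, within height `2 * a` of `t₀`. -/
structure IsGraphChart (Ω : Set (Eucl (m + 1))) (Φ : (Eucl m × ℝ) ≃L[ℝ] Eucl (m + 1))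
    (z₀ : Eucl m) (t₀ a : ℝ) (K : ℝ≥0) (γ : Eucl m → ℝ) : Prop where
  abs_sub_le : ∀ z ∈ Metric.ball z₀ a, |γ z - t₀| ≤ a
  mem_frontier : ∀ z ∈ Metric.ball z₀ a, Φ (z, γ z) ∈ frontier Ω
  mem_interior : ∀ z ∈ Metric.ball z₀ a, ∀ t ∈ Set.Ioo (t₀ - 2 * a) (γ z), Φ (z, t) ∈ interior Ω
  notMem : ∀ z ∈ Metric.ball z₀ a, ∀ t ∈ Set.Ioo (γ z) (t₀ + 2 * a), Φ (z, t) ∉ Ω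
  lipschitzOnWith : LipschitzOnWith K (fun z => Φ (z, γ z)) (Metric.ball z₀ a)

theorem exists_isGraphChart (hΩ : IsClosed Ω) (hΦ : IsSplitting n Φ) (ha : 0 < a) (hε : 0 ≤ ε)
    (hε' : ε ≤ 1 / 2) (hx : Φ (z₀, t₀) ∈ frontier Ω)
    (hcone : HasConeProperty Ω (Φ (z₀, t₀)) n ε (4 * a)) :
    ∃ γ, IsGraphChart Ω Φ z₀ t₀ a (Real.toNNReal (1 - ε)⁻¹) γ := by
  have hball {z : Eucl m} (hz : z ∈ Metric.ball z₀ a) {t : ℝ} (ht : |t - t₀| < 2 * a) :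
      Φ (z, t) ∈ Metric.ball (Φ (z₀, t₀)) (4 * a) :=
    Metric.ball_subset_ball (by linarith) (hΦ.apply_mem_ball hz ht)
  have hheight := fun z hz => hΦ.exists_height (z := z) hΩ ha hε hε' hx hcone hz
  choose! γ hγle hγmem hγnot using hheight
  have hγlt {z : Eucl m} (hz : z ∈ Metric.ball z₀ a) : |γ z - t₀| < 2 * a :=
    (hγle z hz).trans_lt (by linarith)
  have hγfrontier : ∀ z ∈ Metric.ball z₀ a, Φ (z, γ z) ∈ frontier Ω := fun z hz =>
    mem_frontier_of_forall_notMem (c := fun t => Φ (z, t)) (by fun_prop)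
      (by linarith [(abs_lt.1 (hγlt hz)).2]) (hγmem z hz) (hγnot z hz)
  refine ⟨γ, hγle, hγfrontier, fun z hz t ht => ?_, hγnot, ?_⟩
  · have hγz := abs_le.1 (hγle z hz)
    refine hΦ.mem_interior_of_hasConeProperty hcone hε (hball hz (hγlt hz))
      (hball hz (abs_lt.2 ⟨by linarith [ht.1], by linarith [ht.2]⟩)) ?_ (hγmem z hz)
    rw [sub_self, norm_zero, zero_add, abs_of_pos (sub_pos.2 ht.2)]
    nlinarith [sub_pos.2 ht.2]
  · refine hΦ.lipschitzOnWith_graph (by linarith) fun z hz z' hz' => ?_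
    by_contra! hlt
    refine (hγfrontier z' hz').2 (hcone _ (hball hz (hγlt hz)) _ (hball hz' (hγlt hz')) ?_
      (hγmem z hz))
    rwa [IsSplitting.apply_sub_apply, hΦ.inner_eq]

end Charts

section ChartIntegrals

open scoped NNReal MeasureTheory Measure

variable {m : ℕ} {Ω : Set (Eucl (m + 1))} {n : Eucl (m + 1)}
  {Φ : (Eucl m × ℝ) ≃L[ℝ] Eucl (m + 1)} {z₀ : Eucl m} {t₀ a : ℝ} {K : ℝ≥0} {γ : Eucl m → ℝ}

theorem IsSplitting.hasDerivAt_line (hΦ : IsSplitting n Φ) (z : Eucl m) (t : ℝ) :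
    HasDerivAt (fun t => Φ (z, t)) n t := by
  have hline : HasDerivAt (fun t : ℝ => (z, t)) (0, 1) t :=
    (hasDerivAt_const t z).prodMk (hasDerivAt_id t)
  rw [← hΦ.map_one]
  exact Φ.hasFDerivAt.comp_hasDerivAt t hline

theorem IsGraphChart.indicator_slice (hΩ : IsClosed Ω) (hΦ : IsSplitting n Φ)
    (hγ : IsGraphChart Ω Φ z₀ t₀ a K γ) {f : Eucl (m + 1) → ℝ}
    (hf : ∀ y ∉ Metric.ball (Φ (z₀, t₀)) a, f y = 0) {z : Eucl m} (hz : z ∈ Metric.ball z₀ a) :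
    (fun t => Ω.indicator f (Φ (z, t))) =
      (Set.Ioc (t₀ - 2 * a) (γ z)).indicator (fun t => f (Φ (z, t))) := by
  have ha : 0 < a := Metric.pos_of_mem_ball hz
  ext t
  by_cases ht : |t - t₀| < a
  · obtain ⟨hlow, hup⟩ := abs_lt.1 ht
    rcases lt_trichotomy t (γ z) with htγ | rfl | htγ
    · rw [Set.indicator_of_mem (interior_subset (hγ.mem_interior z hz t ⟨by linarith, htγ⟩)),
        Set.indicator_of_mem (Set.mem_Ioc.2 ⟨by linarith, htγ.le⟩)]
    · rw [Set.indicator_of_mem (hΩ.frontier_subset (hγ.mem_frontier z hz)),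
        Set.indicator_of_mem (Set.mem_Ioc.2 ⟨by linarith, le_rfl⟩)]
    · rw [Set.indicator_of_notMem (hγ.notMem z hz t ⟨htγ, by linarith⟩),
        Set.indicator_of_notMem fun h => h.2.not_gt htγ]
  · have hzero : f (Φ (z, t)) = 0 := hf _ fun h => ht (hΦ.mem_ball_and_abs_sub_lt h).2
    rw [Set.indicator_apply_eq_zero.2 fun _ => hzero, eq_comm]
    exact Set.indicator_apply_eq_zero.2 fun _ => hzero

theorem fderiv_apply_eq_zero_of_tsupport_subset {E : Type*} [NormedAddCommGroup E]
    [NormedSpace ℝ E] {w : E → ℝ} {S : Set E} (hs : tsupport w ⊆ S) (v : E) {y : E} (hy : y ∉ S) :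
    fderiv ℝ w y v = 0 :=
  image_eq_zero_of_notMem_tsupport (f := fun x => fderiv ℝ w x v)
    fun h => hy (hs (tsupport_fderiv_apply_subset ℝ v h))

theorem IsGraphChart.integral_slice (hΩ : IsClosed Ω) (hΦ : IsSplitting n Φ)
    (hγ : IsGraphChart Ω Φ z₀ t₀ a K γ) {w : Eucl (m + 1) → ℝ} (hw : ContDiff ℝ 1 w)
    (hs : tsupport w ⊆ Metric.ball (Φ (z₀, t₀)) a) {z : Eucl m} (hz : z ∈ Metric.ball z₀ a) :
    ∫ t, Ω.indicator (fun y => fderiv ℝ w y n) (Φ (z, t)) = w (Φ (z, γ z)) := by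
  have ha : 0 < a := Metric.pos_of_mem_ball hz
  have hderiv : ∀ t, HasDerivAt (fun t => w (Φ (z, t))) (fderiv ℝ w (Φ (z, t)) n) t := fun t =>
    (hw.differentiable (by simp)).differentiableAt.hasFDerivAt.comp_hasDerivAt t
      (hΦ.hasDerivAt_line z t)
  have hint : IntervalIntegrable (fun t => fderiv ℝ w (Φ (z, t)) n) volume (t₀ - 2 * a) (γ z) :=
    ((continuous_fderiv_apply_of_contDiff hw (by simp) n).comp
      (by fun_prop : Continuous fun t => Φ (z, t))).intervalIntegrable _ _
  have hbottom : w (Φ (z, t₀ - 2 * a)) = 0 :=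
    image_eq_zero_of_notMem_tsupport fun h => by
      have hlt := (hΦ.mem_ball_and_abs_sub_lt (hs h)).2
      rw [sub_sub_cancel_left, abs_neg, abs_of_pos (by positivity)] at hlt
      linarith
  rw [hγ.indicator_slice hΩ hΦ (fun _ => fderiv_apply_eq_zero_of_tsupport_subset hs n) hz,
    integral_indicator measurableSet_Ioc,
    ← intervalIntegral.integral_of_le (by linarith [(abs_le.1 (hγ.abs_sub_le z hz)).1]),
    intervalIntegral.integral_eq_sub_of_hasDerivAt (fun t _ => hderiv t) hint, hbottom, sub_zero]

theorem IsGraphChart.integral_fderiv (hΩ : IsClosed Ω) (hΦ : IsSplitting n Φ)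
    (hγ : IsGraphChart Ω Φ z₀ t₀ a K γ) {w : Eucl (m + 1) → ℝ} (hw : ContDiff ℝ 1 w)
    (hs : tsupport w ⊆ Metric.ball (Φ (z₀, t₀)) a) :
    ∫ y in Ω, fderiv ℝ w y n = ∫ z in Metric.ball z₀ a, w (Φ (z, γ z)) := by
  have hc : HasCompactSupport w := (isCompact_closedBall (Φ (z₀, t₀)) a).of_isClosed_subset
    (isClosed_tsupport _) (hs.trans Metric.ball_subset_closedBall)
  have hi : Integrable (Ω.indicator (fun y => fderiv ℝ w y n)) volume :=
    ((continuous_fderiv_apply_of_contDiff hw (by simp) n).integrable_of_hasCompactSupport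
      (hc.fderiv_apply ℝ n)).indicator hΩ.measurableSet
  have hiΦ : Integrable (fun q => Ω.indicator (fun y => fderiv ℝ w y n) (Φ q))
      (volume.prod volume) := hΦ.measurePreserving.integrable_comp_of_integrable hi
  rw [← integral_indicator hΩ.measurableSet,
    ← hΦ.measurePreserving.integral_comp Φ.toHomeomorph.measurableEmbedding,
    Measure.volume_eq_prod, integral_prod _ hiΦ, ← integral_indicator measurableSet_ball]
  refine integral_congr_ae (.of_forall fun z => ?_)
  by_cases hz : z ∈ Metric.ball z₀ a
  · simp only [Set.indicator_of_mem hz]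
    exact hγ.integral_slice hΩ hΦ hw hs hz
  · simp only [Set.indicator_of_notMem hz]
    exact integral_eq_zero_of_ae (.of_forall fun t => Set.indicator_apply_eq_zero.2 fun _ =>
      fderiv_apply_eq_zero_of_tsupport_subset hs n fun h => hz (hΦ.mem_ball_and_abs_sub_lt h).1)

theorem IsGraphChart.image_eq (hΩ : IsClosed Ω) (hγ : IsGraphChart Ω Φ z₀ t₀ a K γ) :
    (fun z => Φ (z, γ z)) '' Metric.ball z₀ a = frontier Ω ∩ {y | (Φ.symm y).1 ∈ Metric.ball z₀ a ∧
      |(Φ.symm y).2 - t₀| < 2 * a} := by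
  ext y
  obtain ⟨⟨z, t⟩, rfl⟩ := Φ.surjective y
  simp only [Set.mem_inter_iff, Set.mem_ofPred_eq, Φ.symm_apply_apply, Set.mem_image,
    Φ.injective.eq_iff, Prod.mk.injEq]
  constructor
  · rintro ⟨z, hz, rfl, rfl⟩
    have ha : 0 < a := Metric.pos_of_mem_ball hz
    exact ⟨hγ.mem_frontier z hz, hz, (hγ.abs_sub_le z hz).trans_lt (by linarith)⟩
  · rintro ⟨hy, hz, ht⟩
    obtain ⟨hlow, hup⟩ := abs_lt.1 ht
    refine ⟨z, hz, rfl, ?_⟩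
    rcases lt_trichotomy t (γ z) with htγ | htγ | htγ
    · exact absurd (hγ.mem_interior z hz t ⟨by linarith, htγ⟩) hy.2
    · exact htγ.symm
    · exact absurd (hΩ.frontier_subset hy) (hγ.notMem z hz t ⟨htγ, by linarith⟩)

theorem IsGraphChart.measurableSet_image (hΩ : IsClosed Ω) (hγ : IsGraphChart Ω Φ z₀ t₀ a K γ) :
    MeasurableSet ((fun z => Φ (z, γ z)) '' Metric.ball z₀ a) := by
  have hfst : Continuous fun y => (Φ.symm y).1 := by fun_prop
  have hsnd : Continuous fun y => |(Φ.symm y).2 - t₀| := by fun_prop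
  rw [hγ.image_eq hΩ]
  exact isClosed_frontier.measurableSet.inter
    ((Metric.isOpen_ball.preimage hfst).inter (isOpen_lt hsnd continuous_const)).measurableSet

theorem IsGraphChart.frontier_inter_ball_subset (hΩ : IsClosed Ω) (hΦ : IsSplitting n Φ)
    (hγ : IsGraphChart Ω Φ z₀ t₀ a K γ) :
    frontier Ω ∩ Metric.ball (Φ (z₀, t₀)) a ⊆ (fun z => Φ (z, γ z)) '' Metric.ball z₀ a := by
  rw [hγ.image_eq hΩ]
  rintro y ⟨hy, hyb⟩
  have ha : 0 < a := Metric.pos_of_mem_ball hyb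
  obtain ⟨⟨z, t⟩, rfl⟩ := Φ.surjective y
  obtain ⟨hz, ht⟩ := hΦ.mem_ball_and_abs_sub_lt hyb
  rw [Set.mem_inter_iff, Set.mem_ofPred_eq, Φ.symm_apply_apply]
  exact ⟨hy, hz, by linarith⟩

theorem IsGraphChart.hausdorffMeasure_image_le (hγ : IsGraphChart Ω Φ z₀ t₀ a K γ)
    {A : Set (Eucl m)} (hA : A ⊆ Metric.ball z₀ a) :
    μH[m] ((fun z => Φ (z, γ z)) '' A) ≤ (K : ℝ≥0∞) ^ m * μH[m] A := by
  simpa using (hγ.lipschitzOnWith.mono hA).hausdorffMeasure_image_le (d := m) (by positivity)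

theorem IsSplitting.le_hausdorffMeasure_image (hΦ : IsSplitting n Φ) (γ : Eucl m → ℝ)
    (A : Set (Eucl m)) : μH[m] A ≤ μH[m] ((fun z => Φ (z, γ z)) '' A) := by
  have := hΦ.lipschitzWith_fst_symm.hausdorffMeasure_image_le (d := m) (by positivity)
    ((fun z => Φ (z, γ z)) '' A)
  rw [Set.image_image] at this
  simpa using this

section LeftInverse

variable {X Y : Type*} [MeasurableSpace X] [MeasurableSpace Y] {Γ : X → Y} {p : Y → X}

theorem map_restrict_image_apply (hp : Measurable p) (hpΓ : Function.LeftInverse p Γ)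
    (μ : Measure Y) (D : Set X) {A : Set X} (hA : MeasurableSet A) :
    (μ.restrict (Γ '' D)).map p A = μ (Γ '' (D ∩ A)) := by
  rw [Measure.map_apply hp hA, Measure.restrict_apply (hp hA), Set.inter_comm,
    ← Set.image_inter_preimage, ← Set.preimage_comp, hpΓ.comp_eq_id, Set.preimage_id]

theorem lintegral_map_restrict_image (hp : Measurable p) (hpΓ : Function.LeftInverse p Γ)
    {μ : Measure Y} {D : Set X} (hD : MeasurableSet (Γ '' D)) {f : Y → ℝ≥0∞}
    (hf : AEMeasurable (fun x => f (Γ x)) ((μ.restrict (Γ '' D)).map p)) :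
    ∫⁻ x, f (Γ x) ∂((μ.restrict (Γ '' D)).map p) = ∫⁻ y in Γ '' D, f y ∂μ := by
  rw [lintegral_map' hf hp.aemeasurable]
  refine setLIntegral_congr_fun hD ?_
  rintro _ ⟨x, -, rfl⟩
  simp only [hpΓ x]

end LeftInverse

theorem IsGraphChart.lintegral_frontier (hΩ : IsClosed Ω) (hΦ : IsSplitting n Φ)
    (hγ : IsGraphChart Ω Φ z₀ t₀ a K γ) {f : Eucl (m + 1) → ℝ≥0∞}
    (hs : ∀ y ∉ Metric.ball (Φ (z₀, t₀)) a, f y = 0) (μ : Measure (Eucl (m + 1))) :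
    ∫⁻ y in frontier Ω, f y ∂μ = ∫⁻ y in (fun z => Φ (z, γ z)) '' Metric.ball z₀ a, f y ∂μ := by
  have hsub : (fun z => Φ (z, γ z)) '' Metric.ball z₀ a ⊆ frontier Ω :=
    Set.image_subset_iff.2 hγ.mem_frontier
  rw [← lintegral_indicator (hγ.measurableSet_image hΩ),
    ← lintegral_indicator isClosed_frontier.measurableSet]
  refine lintegral_congr fun y => ?_
  by_cases hy : y ∈ (fun z => Φ (z, γ z)) '' Metric.ball z₀ a
  · rw [Set.indicator_of_mem hy, Set.indicator_of_mem (hsub hy)]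
  · rw [Set.indicator_of_notMem hy]
    exact Set.indicator_apply_eq_zero.2 fun hyf => hs y fun hyb =>
      hy (hγ.frontier_inter_ball_subset hΩ hΦ ⟨hyf, hyb⟩)

theorem IsGraphChart.lintegral_bounds (hΩ : IsClosed Ω) (hΦ : IsSplitting n Φ)
    (hγ : IsGraphChart Ω Φ z₀ t₀ a K γ) {f : Eucl (m + 1) → ℝ≥0∞} (hf : Measurable f)
    (hs : ∀ y ∉ Metric.ball (Φ (z₀, t₀)) a, f y = 0) :
    (∫⁻ z in Metric.ball z₀ a, f (Φ (z, γ z)) ∂μH[m] ≤ ∫⁻ y in frontier Ω, f y ∂μH[m]) ∧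
    ∫⁻ y in frontier Ω, f y ∂μH[m] ≤
      (K : ℝ≥0∞) ^ m * ∫⁻ z in Metric.ball z₀ a, f (Φ (z, γ z)) ∂μH[m] := by
  let Γ : Eucl m → Eucl (m + 1) := fun z => Φ (z, γ z)
  let p : Eucl (m + 1) → Eucl m := fun y => (Φ.symm y).1
  let D := Metric.ball z₀ a
  have hD : MeasurableSet D := measurableSet_ball
  have hp : Measurable p := (by fun_prop : Continuous p).measurable
  have hpΓ : Function.LeftInverse p Γ := fun z => by simp only [p, Γ, Φ.symm_apply_apply]
  let ν : Measure (Eucl m) := (μH[m].restrict (Γ '' D)).map p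
  have hle : μH[m].restrict D ≤ ν := Measure.le_iff.2 fun A hA => by
    rw [map_restrict_image_apply hp hpΓ _ _ hA, Measure.restrict_apply hA, Set.inter_comm]
    exact hΦ.le_hausdorffMeasure_image _ _
  have hge : ν ≤ (K : ℝ≥0∞) ^ m • μH[m].restrict D := Measure.le_iff.2 fun A hA => by
    rw [map_restrict_image_apply hp hpΓ _ _ hA, Measure.smul_apply, Measure.restrict_apply hA,
      Set.inter_comm A D, smul_eq_mul]
    exact hγ.hausdorffMeasure_image_le Set.inter_subset_left
  have hfΓ : AEMeasurable (fun z => f (Γ z)) ν :=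
    (hf.comp_aemeasurable (hγ.lipschitzOnWith.continuousOn.aemeasurable hD)).mono_ac
      ((Measure.absolutelyContinuous_of_le hge).trans Measure.smul_absolutelyContinuous)
  rw [hγ.lintegral_frontier hΩ hΦ hs,
    ← lintegral_map_restrict_image hp hpΓ (hγ.measurableSet_image hΩ) hfΓ]
  refine ⟨lintegral_mono' hle le_rfl, ?_⟩
  rw [← smul_eq_mul, ← lintegral_smul_measure]
  exact lintegral_mono' hge le_rfl

theorem exists_hausdorffMeasure_eq_smul (m : ℕ) :
    ∃ κ : ℝ≥0, 0 < κ ∧ (μH[m] : Measure (Eucl m)) = κ • volume := by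
  have : Measure.IsAddHaarMeasure (μH[m] : Measure (Eucl m)) := by
    simpa using MeasureTheory.isAddHaarMeasure_hausdorffMeasure (E := EuclideanSpace ℝ (Fin m))
  exact ⟨Measure.addHaarScalarFactor μH[m] volume,
    Measure.addHaarScalarFactor_pos_of_isAddHaarMeasure _ _,
    Measure.isAddLeftInvariant_eq_smul _ _⟩

end ChartIntegrals

/-! ### The divergence theorem -/

section DirectionalDerivative

variable {E : Type*} [NormedAddCommGroup E] [NormedSpace ℝ E] [MeasurableSpace E] [BorelSpace E]
  {w : E → ℝ}

theorem hasDerivAt_integral_comp_add_smul (μ : Measure E) [IsFiniteMeasure μ]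
    (hw : ContDiff ℝ 1 w) (hc : HasCompactSupport w) (v : E) :
    HasDerivAt (fun t : ℝ => ∫ y, w (y + t • v) ∂μ) (∫ y, fderiv ℝ w y v ∂μ) 0 := by
  have hfc := continuous_fderiv_apply_of_contDiff hw one_ne_zero v
  obtain ⟨B, hB⟩ := hw.continuous.bounded_above_of_compact_support hc
  obtain ⟨B', hB'⟩ := hfc.bounded_above_of_compact_support (hc.fderiv_apply ℝ v)
  have hline (y : E) (t : ℝ) :
      HasDerivAt (fun t : ℝ => w (y + t • v)) (fderiv ℝ w (y + t • v) v) t := by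
    have hpath : HasDerivAt (fun t : ℝ => y + t • v) v t := by
      simpa using ((hasDerivAt_id t).smul_const v).const_add y
    exact (hw.differentiable one_ne_zero).differentiableAt.hasFDerivAt.comp_hasDerivAt t hpath
  have hder := (hasDerivAt_integral_of_dominated_loc_of_deriv_le (μ := μ)
    (F := fun (t : ℝ) y => w (y + t • v)) (F' := fun t y => fderiv ℝ w (y + t • v) v) (x₀ := 0)
    (s := Set.univ) (bound := fun _ => B') univ_mem
    (.of_forall fun t => (hw.continuous.comp (by fun_prop)).aestronglyMeasurable)
    (.of_bound (hw.continuous.comp (by fun_prop)).aestronglyMeasurable B (.of_forall fun _ => hB _))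
    (hfc.comp (by fun_prop)).aestronglyMeasurable (.of_forall fun _ _ _ => hB' _)
    (integrable_const _) (.of_forall fun y t _ => hline y t)).2
  simpa only [zero_smul, add_zero] using hder

theorem setIntegral_le_setIntegral_comp_add {G : Type*} [AddGroup G] [MeasurableSpace G]
    [MeasurableAdd G] {μ : Measure G} [μ.IsAddRightInvariant] {Ω : Set G}
    (hΩ : MeasurableSet Ω) {w : G → ℝ} (hw : Integrable w μ) (hw0 : ∀ y, 0 ≤ w y) {v : G}
    (hv : ∀ y ∈ Ω, w y ≠ 0 → y - v ∈ Ω) : ∫ y in Ω, w y ∂μ ≤ ∫ y in Ω, w (y + v) ∂μ := by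
  let e := MeasurableEquiv.addRight v
  have hmeas : MeasurableSet (e '' Ω) := e.measurableSet_image.2 hΩ
  have htranslate : ∫ y in Ω, w (y + v) ∂μ = ∫ y in e '' Ω, w y ∂μ :=
    ((measurePreserving_add_right μ v).setIntegral_image_emb e.measurableEmbedding w Ω).symm
  rw [htranslate, ← integral_indicator hΩ, ← integral_indicator hmeas]
  refine integral_mono (hw.indicator hΩ) (hw.indicator hmeas) fun y => ?_
  have hnonneg : 0 ≤ (e '' Ω).indicator w y := Set.indicator_nonneg (fun _ _ => hw0 _) y
  by_cases hy : y ∈ Ω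
  · rw [Set.indicator_of_mem hy]
    by_cases hwy : w y = 0
    · rwa [hwy]
    · exact (Set.indicator_of_mem (s := e '' Ω) ⟨y - v, hv y hy hwy, sub_add_cancel y v⟩ w).ge
  · rwa [Set.indicator_of_notMem hy]

variable {μ : Measure E} [IsFiniteMeasureOnCompacts μ] {Ω : Set E}

theorem setIntegral_fderiv_nonneg [μ.IsAddRightInvariant] (hΩ : IsCompact Ω)
    (hw : ContDiff ℝ 1 w) (hc : HasCompactSupport w) (hw0 : ∀ y, 0 ≤ w y) {v : E}
    (hpush : ∀ᶠ t : ℝ in 𝓝[>] 0, ∀ y ∈ Ω, y ∈ tsupport w → y - t • v ∈ Ω) :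
    0 ≤ ∫ y in Ω, fderiv ℝ w y v ∂μ := by
  have : IsFiniteMeasure (μ.restrict Ω) := isFiniteMeasure_restrict.2 hΩ.measure_ne_top
  have hder := hasDerivAt_integral_comp_add_smul (μ.restrict Ω) hw hc v
  refine ge_of_tendsto hder.tendsto_slope_zero_right ?_
  filter_upwards [hpush, self_mem_nhdsWithin] with t ht ht0
  refine smul_nonneg (inv_nonneg.2 (Set.mem_Ioi.1 ht0).le) (sub_nonneg.2 ?_)
  simp only [zero_add, zero_smul, add_zero]
  exact setIntegral_le_setIntegral_comp_add hΩ.measurableSet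
    (hw.continuous.integrable_of_hasCompactSupport hc) hw0
    fun y hy hwy => ht y hy (subset_tsupport w hwy)

theorem setIntegral_fderiv_linear_combination (hΩ : IsCompact Ω) (hw : ContDiff ℝ 1 w) (s t : ℝ)
    (u v : E) : ∫ y in Ω, fderiv ℝ w y (s • u + t • v) ∂μ =
      s * (∫ y in Ω, fderiv ℝ w y u ∂μ) + t * ∫ y in Ω, fderiv ℝ w y v ∂μ := by
  have hint : ∀ v, IntegrableOn (fun y => fderiv ℝ w y v) Ω μ := fun v =>
    (continuous_fderiv_apply_of_contDiff hw one_ne_zero v).continuousOn.integrableOn_compact hΩ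
  simp only [map_add, map_smul, smul_eq_mul]
  rw [integral_add ((hint u).const_mul s) ((hint v).const_mul t), integral_const_mul,
    integral_const_mul]

end DirectionalDerivative

namespace HasConeProperty

variable {F : Type*} [NormedAddCommGroup F] [InnerProductSpace ℝ F] {Ω : Set F} {x n : F}
  {ε r : ℝ}

theorem mono (h : HasConeProperty Ω x n ε r) {r' : ℝ} (hr : r' ≤ r) :
    HasConeProperty Ω x n ε r' :=
  fun y hy y' hy' => h y (Metric.ball_subset_ball hr hy) y' (Metric.ball_subset_ball hr hy')

theorem eventually_sub_smul_mem (h : HasConeProperty Ω x n ε r) {a : ℝ} (ha : a < r) {v : F}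
    (hv : ε * ‖v‖ < inner ℝ n v) :
    ∀ᶠ t : ℝ in 𝓝[>] 0, ∀ y ∈ Ω, y ∈ Metric.ball x a → y - t • v ∈ Ω := by
  have hsmall : Tendsto (fun t : ℝ => t * ‖v‖) (𝓝[>] 0) (𝓝 0) :=
    ((continuous_mul_const ‖v‖).tendsto' 0 0 (zero_mul _)).mono_left nhdsWithin_le_nhds
  filter_upwards [hsmall.eventually_lt_const (sub_pos.2 ha), self_mem_nhdsWithin]
    with t ht ht0 y hy hyb
  have ht0 : 0 < t := ht0
  refine interior_subset (h y (Metric.ball_subset_ball ha.le hyb) _ ?_ ?_ hy)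
  · rw [mem_ball_iff_norm] at hyb
    rw [mem_ball_iff_norm, sub_right_comm]
    refine (norm_sub_le _ _).trans_lt ?_
    rw [norm_smul, Real.norm_of_nonneg ht0.le]
    linarith
  · rw [sub_sub_cancel, norm_smul, inner_smul_right, Real.norm_of_nonneg ht0.le,
      mul_left_comm]
    exact mul_lt_mul_of_pos_left hv ht0

variable [MeasurableSpace F] [BorelSpace F] {μ : Measure F} [IsFiniteMeasureOnCompacts μ]
  [μ.IsAddRightInvariant] {w : F → ℝ} {a : ℝ}

theorem setIntegral_fderiv_nonneg (h : HasConeProperty Ω x n ε r) (hΩ : IsCompact Ω)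
    (ha : a < r) (hw : ContDiff ℝ 1 w) (hc : HasCompactSupport w) (hw0 : ∀ y, 0 ≤ w y)
    (hs : tsupport w ⊆ Metric.ball x a) {v : F} (hv : ε * ‖v‖ < inner ℝ n v) :
    0 ≤ ∫ y in Ω, fderiv ℝ w y v ∂μ := by
  refine SteinKSD.setIntegral_fderiv_nonneg hΩ hw hc hw0 ?_
  filter_upwards [h.eventually_sub_smul_mem ha hv] with t ht y hy hyw using ht y hy (hs hyw)

theorem abs_setIntegral_fderiv_le (h : HasConeProperty Ω x n ε r) (hn : ‖n‖ = 1) (hε : 0 < ε)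
    (hε' : ε < 1 / 2) (hΩ : IsCompact Ω) (ha : a < r) (hw : ContDiff ℝ 1 w)
    (hc : HasCompactSupport w) (hw0 : ∀ y, 0 ≤ w y) (hs : tsupport w ⊆ Metric.ball x a) {q : F}
    (hnq : inner ℝ n q = 0) (hq : ‖q‖ ≤ 1) :
    |∫ y in Ω, fderiv ℝ w y q ∂μ| ≤ 2 * ε * ∫ y in Ω, fderiv ℝ w y n ∂μ := by
  have hnn : inner ℝ n n = (1 : ℝ) := by rw [real_inner_self_eq_norm_sq, hn, one_pow]
  have hsign (s : ℝ) (hs1 : |s| = 1) : 0 ≤ 2 * ε * (∫ y in Ω, fderiv ℝ w y n ∂μ) +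
      s * ∫ y in Ω, fderiv ℝ w y q ∂μ := by
    rw [← setIntegral_fderiv_linear_combination hΩ hw]
    refine h.setIntegral_fderiv_nonneg hΩ ha hw hc hw0 hs ?_
    have hnorm : ‖(2 * ε) • n + s • q‖ ≤ 2 * ε + 1 := by
      refine (norm_add_le _ _).trans ?_
      rw [norm_smul, norm_smul, hn, Real.norm_of_nonneg (by positivity), Real.norm_eq_abs, hs1]
      linarith
    rw [inner_add_right, inner_smul_right, inner_smul_right, hnn, hnq]
    nlinarith
  exact abs_le.2 ⟨by linarith [hsign 1 (by simp)], by linarith [hsign (-1) (by simp)]⟩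

end HasConeProperty

theorem norm_sub_inner_smul_le {F : Type*} [NormedAddCommGroup F] [InnerProductSpace ℝ F] {n : F}
    (hn : ‖n‖ = 1) (e : F) : ‖e - inner ℝ n e • n‖ ≤ ‖e‖ := by
  have hsq : ‖e - inner ℝ n e • n‖ ^ 2 = ‖e‖ ^ 2 - inner ℝ n e ^ 2 := by
    rw [norm_sub_sq_real, norm_smul, hn, inner_smul_right, real_inner_comm, Real.norm_eq_abs,
      mul_one, sq_abs]
    ring
  exact le_of_sq_le_sq (hsq.trans_le (sub_le_self _ (sq_nonneg _))) (norm_nonneg e)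

section SurfaceMeasure

open scoped NNReal MeasureTheory Measure

variable {m : ℕ} {Ω : Set (Eucl (m + 1))}

theorem surfaceMeasure_eq (Ω : Set (Eucl (m + 1))) :
    surfaceMeasure Ω = μH[m].restrict (frontier Ω) := by
  simp [surfaceMeasure]

theorem ae_surfaceMeasure_mem_frontier (Ω : Set (Eucl (m + 1))) :
    ∀ᵐ y ∂surfaceMeasure Ω, y ∈ frontier Ω :=
  ae_restrict_mem isClosed_frontier.measurableSet

namespace IsGraphChart

variable {n : Eucl (m + 1)} {Φ : (Eucl m × ℝ) ≃L[ℝ] Eucl (m + 1)} {z₀ : Eucl m} {t₀ a : ℝ}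
  {K κ : ℝ≥0} {γ : Eucl m → ℝ}

theorem surfaceMeasure_ball_lt_top (hΩ : IsClosed Ω) (hΦ : IsSplitting n Φ)
    (hγ : IsGraphChart Ω Φ z₀ t₀ a K γ) (hκ : (μH[m] : Measure (Eucl m)) = κ • volume) :
    surfaceMeasure Ω (Metric.ball (Φ (z₀, t₀)) a) < ⊤ := by
  rw [surfaceMeasure_eq, Measure.restrict_apply measurableSet_ball, Set.inter_comm]
  refine ((measure_mono (hγ.frontier_inter_ball_subset hΩ hΦ)).trans
    (hγ.hausdorffMeasure_image_le subset_rfl)).trans_lt ?_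
  rw [hκ, Measure.smul_apply, ENNReal.smul_def, smul_eq_mul]
  exact ENNReal.mul_lt_top (ENNReal.pow_lt_top ENNReal.coe_lt_top)
    (ENNReal.mul_lt_top ENNReal.coe_lt_top measure_ball_lt_top)

variable {w : Eucl (m + 1) → ℝ}

theorem integral_graph_eq_toReal (hγ : IsGraphChart Ω Φ z₀ t₀ a K γ)
    (hκ : (μH[m] : Measure (Eucl m)) = κ • volume) (hw : Continuous w) (hw0 : ∀ y, 0 ≤ w y) :
    κ * ∫ z in Metric.ball z₀ a, w (Φ (z, γ z)) =
      (∫⁻ z in Metric.ball z₀ a, ENNReal.ofReal (w (Φ (z, γ z))) ∂μH[m]).toReal := by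
  have hmeas : AEStronglyMeasurable (fun z => w (Φ (z, γ z)))
      (volume.restrict (Metric.ball z₀ a)) :=
    (hw.comp_continuousOn hγ.lipschitzOnWith.continuousOn).aestronglyMeasurable measurableSet_ball
  rw [hκ, Measure.restrict_smul, lintegral_smul_measure, ENNReal.smul_def, smul_eq_mul,
    ENNReal.toReal_mul, ENNReal.coe_toReal,
    integral_eq_lintegral_of_nonneg_ae (.of_forall fun _ => hw0 _) hmeas]

theorem integral_surfaceMeasure_bounds (hΩ : IsClosed Ω) (hΦ : IsSplitting n Φ)
    (hγ : IsGraphChart Ω Φ z₀ t₀ a K γ) (hκ : (μH[m] : Measure (Eucl m)) = κ • volume)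
    (hw : ContDiff ℝ 1 w) (hw0 : ∀ y, 0 ≤ w y) (hs : tsupport w ⊆ Metric.ball (Φ (z₀, t₀)) a)
    (hi : Integrable w (surfaceMeasure Ω)) :
    κ * ∫ y in Ω, fderiv ℝ w y n ≤ ∫ y, w y ∂surfaceMeasure Ω ∧
    ∫ y, w y ∂surfaceMeasure Ω ≤ (K : ℝ) ^ m * (κ * ∫ y in Ω, fderiv ℝ w y n) := by
  obtain ⟨hlower, hupper⟩ := hγ.lintegral_bounds hΩ hΦ (f := fun y => ENNReal.ofReal (w y))
    (ENNReal.continuous_ofReal.comp hw.continuous).measurable fun y hy => by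
      rw [image_eq_zero_of_notMem_tsupport fun h => hy (hs h), ENNReal.ofReal_zero]
  rw [← surfaceMeasure_eq] at hlower hupper
  have hfin : ∫⁻ y, ENNReal.ofReal (w y) ∂surfaceMeasure Ω ≠ ⊤ :=
    ((hasFiniteIntegral_iff_ofReal (.of_forall hw0)).1 hi.2).ne
  have hKfin : (K : ℝ≥0∞) ^ m ≠ ⊤ := ENNReal.pow_ne_top ENNReal.coe_ne_top
  rw [hγ.integral_fderiv hΩ hΦ hw hs, hγ.integral_graph_eq_toReal hκ hw.continuous hw0,
    integral_eq_lintegral_of_nonneg_ae (.of_forall hw0) hw.continuous.aestronglyMeasurable]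
  refine ⟨ENNReal.toReal_mono hfin hlower, ?_⟩
  simpa [ENNReal.toReal_mul] using
    ENNReal.toReal_mono (ENNReal.mul_ne_top hKfin (ne_top_of_le_ne_top hfin hlower)) hupper

end IsGraphChart

namespace IsSmoothCompactDomain

theorem exists_surfaceMeasure_ball_lt_top (hΩ : IsSmoothCompactDomain Ω) {x : Eucl (m + 1)}
    (hx : x ∈ frontier Ω) : ∃ r > 0, surfaceMeasure Ω (Metric.ball x r) < ⊤ := by
  obtain ⟨κ, -, hκ⟩ := exists_hausdorffMeasure_eq_smul m
  obtain ⟨r, hr, hcone⟩ := hΩ.exists_hasConeProperty hx (ε := 1 / 2) (by norm_num)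
  obtain ⟨Φ, hΦ⟩ := exists_isSplitting (hΩ.norm_outwardNormal hx)
  obtain ⟨⟨z₀, t₀⟩, rfl⟩ := Φ.surjective x
  have hclosed := hΩ.isCompact.isClosed
  obtain ⟨γ, hγ⟩ := exists_isGraphChart hclosed hΦ (a := r / 4) (by positivity) (by norm_num)
    le_rfl hx (hcone.mono (by linarith))
  exact ⟨r / 4, by positivity, hγ.surfaceMeasure_ball_lt_top hclosed hΦ hκ⟩

theorem isFiniteMeasure_surfaceMeasure (hΩ : IsSmoothCompactDomain Ω) :
    IsFiniteMeasure (surfaceMeasure Ω) := by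
  have hcompact : IsCompact (frontier Ω) :=
    hΩ.isCompact.of_isClosed_subset isClosed_frontier hΩ.isCompact.isClosed.frontier_subset
  have hlt : surfaceMeasure Ω (frontier Ω) < ⊤ := by
    refine hcompact.measure_lt_top_of_nhdsWithin fun x hx => ?_
    obtain ⟨r, hr, hfin⟩ := hΩ.exists_surfaceMeasure_ball_lt_top hx
    exact ⟨_, mem_nhdsWithin_of_mem_nhds (Metric.ball_mem_nhds x hr), hfin⟩
  rw [surfaceMeasure, Measure.restrict_apply_self] at hlt
  exact isFiniteMeasure_restrict.2 hlt.ne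

theorem integrable_surfaceMeasure (hΩ : IsSmoothCompactDomain Ω) {w : Eucl (m + 1) → ℝ}
    (hw : Continuous w) : Integrable w (surfaceMeasure Ω) := by
  have := hΩ.isFiniteMeasure_surfaceMeasure
  obtain ⟨B, hB⟩ := hΩ.isCompact.exists_bound_of_continuousOn hw.continuousOn
  refine .of_bound hw.aestronglyMeasurable B ?_
  filter_upwards [ae_surfaceMeasure_mem_frontier Ω] with y hy
    using hB y (hΩ.isCompact.isClosed.frontier_subset hy)

theorem abs_inner_outwardNormal_le (hΩ : IsSmoothCompactDomain Ω) (e : Eucl (m + 1))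
    {y : Eucl (m + 1)} (hy : y ∈ frontier Ω) : |inner ℝ (outwardNormal Ω y) e| ≤ ‖e‖ := by
  simpa [hΩ.norm_outwardNormal hy] using abs_real_inner_le_norm (outwardNormal Ω y) e

theorem aestronglyMeasurable_inner_outwardNormal (hΩ : IsSmoothCompactDomain Ω)
    (e : Eucl (m + 1)) :
    AEStronglyMeasurable (fun y => inner ℝ (outwardNormal Ω y) e) (surfaceMeasure Ω) :=
  (hΩ.continuousOn_outwardNormal.inner continuousOn_const).aestronglyMeasurable
    isClosed_frontier.measurableSet

theorem integrable_mul_inner_outwardNormal (hΩ : IsSmoothCompactDomain Ω) {w : Eucl (m + 1) → ℝ}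
    (hw : Integrable w (surfaceMeasure Ω)) (e : Eucl (m + 1)) :
    Integrable (fun y => w y * inner ℝ (outwardNormal Ω y) e) (surfaceMeasure Ω) := by
  refine hw.mul_bdd (c := ‖e‖) (hΩ.aestronglyMeasurable_inner_outwardNormal e) ?_
  filter_upwards [ae_surfaceMeasure_mem_frontier Ω] with y hy
    using hΩ.abs_inner_outwardNormal_le e hy

theorem abs_inner_mul_integral_sub_le (hΩ : IsSmoothCompactDomain Ω) {w : Eucl (m + 1) → ℝ}
    (hw : Integrable w (surfaceMeasure Ω)) (hw0 : ∀ y, 0 ≤ w y) {n e : Eucl (m + 1)}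
    (he : ‖e‖ = 1) {ε : ℝ}
    (hn : ∀ y ∈ frontier Ω, w y ≠ 0 → ‖n - outwardNormal Ω y‖ ≤ ε) :
    |inner ℝ n e * (∫ y, w y ∂surfaceMeasure Ω) -
      ∫ y, w y * inner ℝ (outwardNormal Ω y) e ∂surfaceMeasure Ω| ≤
      ε * ∫ y, w y ∂surfaceMeasure Ω := by
  rw [← Real.norm_eq_abs, ← integral_const_mul, ← integral_const_mul,
    ← integral_sub (hw.const_mul _) (hΩ.integrable_mul_inner_outwardNormal hw e)]
  refine norm_integral_le_of_norm_le (hw.const_mul ε) ?_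
  filter_upwards [ae_surfaceMeasure_mem_frontier Ω] with y hy
  by_cases hwy : w y = 0
  · simp [hwy]
  · have hsub : inner ℝ n e * w y - w y * inner ℝ (outwardNormal Ω y) e =
        w y * inner ℝ (n - outwardNormal Ω y) e := by
      rw [inner_sub_left]
      ring
    rw [hsub, Real.norm_eq_abs, abs_mul, abs_of_nonneg (hw0 y), mul_comm ε]
    refine mul_le_mul_of_nonneg_left ?_ (hw0 y)
    simpa [he] using (abs_real_inner_le_norm (n - outwardNormal Ω y) e).trans
      (mul_le_mul_of_nonneg_right (hn y hy hwy) (norm_nonneg e))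

end IsSmoothCompactDomain

end SurfaceMeasure

section Divergence

open scoped NNReal MeasureTheory Measure Manifold

variable {m : ℕ} {Ω : Set (Eucl (m + 1))} {κ : ℝ≥0} {e : Eucl (m + 1)} {w : Eucl (m + 1) → ℝ}

/-- The defect in the divergence theorem on `Ω` for the vector field `w • e`. The factor `κ`
accounts for the normalization of the Hausdorff measure, see `exists_hausdorffMeasure_eq_smul`. -/
def fluxDefect (Ω : Set (Eucl (m + 1))) (κ : ℝ) (e : Eucl (m + 1)) (w : Eucl (m + 1) → ℝ) : ℝ :=
  κ * (∫ y in Ω, fderiv ℝ w y e) - ∫ y, w y * inner ℝ (outwardNormal Ω y) e ∂surfaceMeasure Ω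

theorem abs_mul_add_sub_le {κ T Tq I J c ε k : ℝ} (hκ : 0 ≤ κ) (hε : 0 ≤ ε) (hk : 1 ≤ k)
    (hlower : κ * T ≤ I) (hupper : I ≤ k * (κ * T)) (hTq : |Tq| ≤ 2 * ε * T) (hc : |c| ≤ 1)
    (hJ : |c * I - J| ≤ ε * I) : |κ * (c * T + Tq) - J| ≤ (k - 1 + 3 * ε) * I := by
  have hnormal : |c * (κ * T - I)| ≤ (k - 1) * I := by
    rw [abs_mul, abs_sub_comm (κ * T), abs_of_nonneg (sub_nonneg.2 hlower)]
    refine (mul_le_of_le_one_left (sub_nonneg.2 hlower) hc).trans ?_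
    linarith [mul_le_mul_of_nonneg_left hlower (sub_nonneg.2 hk)]
  have htangent : |κ * Tq| ≤ 2 * ε * I := by
    rw [abs_mul, abs_of_nonneg hκ]
    linarith [mul_le_mul_of_nonneg_left hTq hκ,
      mul_le_mul_of_nonneg_left hlower (mul_nonneg zero_le_two hε)]
  calc |κ * (c * T + Tq) - J| = |κ * Tq + c * (κ * T - I) + (c * I - J)| := by ring_nf
    _ ≤ |κ * Tq| + |c * (κ * T - I)| + |c * I - J| := abs_add_three _ _ _
    _ ≤ (k - 1 + 3 * ε) * I := by linarith

theorem abs_fluxDefect_le_of_hasConeProperty (hΩ : IsSmoothCompactDomain Ω)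
    (hκ : (μH[m] : Measure (Eucl m)) = κ • volume) (he : ‖e‖ = 1) {x n : Eucl (m + 1)}
    (hx : x ∈ frontier Ω) (hn : ‖n‖ = 1) {ε a : ℝ} (hε : 0 < ε) (hε' : ε < 1 / 2) (ha : 0 < a)
    (hcone : HasConeProperty Ω x n ε (4 * a))
    (hnear : ∀ y ∈ frontier Ω, y ∈ Metric.ball x a → ‖n - outwardNormal Ω y‖ ≤ ε)
    (hw : ContDiff ℝ 1 w) (hw0 : ∀ y, 0 ≤ w y) (hs : tsupport w ⊆ Metric.ball x a) :
    |fluxDefect Ω κ e w| ≤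
      ((1 - ε)⁻¹ ^ m - 1 + 3 * ε) * ∫ y, w y ∂surfaceMeasure Ω := by
  obtain ⟨Φ, hΦ⟩ := exists_isSplitting hn
  obtain ⟨⟨z₀, t₀⟩, rfl⟩ := Φ.surjective x
  have hclosed := hΩ.isCompact.isClosed
  obtain ⟨γ, hγ⟩ := exists_isGraphChart hclosed hΦ ha hε.le hε'.le hx hcone
  have hc : HasCompactSupport w := (isCompact_closedBall _ a).of_isClosed_subset
    (isClosed_tsupport _) (hs.trans Metric.ball_subset_closedBall)
  have hwi := hΩ.integrable_surfaceMeasure hw.continuous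
  have hε1 : 0 < 1 - ε := by linarith
  have hK1 : 1 ≤ (1 - ε)⁻¹ ^ m := one_le_pow₀ ((one_le_inv₀ hε1).2 (by linarith))
  obtain ⟨hlower, hupper⟩ := hγ.integral_surfaceMeasure_bounds hclosed hΦ hκ hw hw0 hs hwi
  rw [Real.coe_toNNReal _ (inv_nonneg.2 hε1.le)] at hupper
  let q := e - inner ℝ n e • n
  have hnq : inner ℝ n q = 0 := by
    rw [inner_sub_right, inner_smul_right, real_inner_self_eq_norm_sq, hn]
    ring
  have htangent : |∫ y in Ω, fderiv ℝ w y q| ≤ 2 * ε * ∫ y in Ω, fderiv ℝ w y n :=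
    hcone.abs_setIntegral_fderiv_le hn hε hε' hΩ.isCompact (by linarith) hw hc hw0 hs hnq
      ((norm_sub_inner_smul_le hn e).trans he.le)
  have hnormal := hΩ.abs_inner_mul_integral_sub_le hwi hw0 (n := n) he fun y hy hwy =>
    hnear y hy (hs (subset_tsupport w hwy))
  have hdecomp : ∫ y in Ω, fderiv ℝ w y e =
      inner ℝ n e * (∫ y in Ω, fderiv ℝ w y n) + ∫ y in Ω, fderiv ℝ w y q := by
    rw [← one_mul (∫ y in Ω, fderiv ℝ w y q),
      ← setIntegral_fderiv_linear_combination hΩ.isCompact hw, one_smul, add_sub_cancel]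
  rw [fluxDefect, hdecomp]
  refine abs_mul_add_sub_le κ.coe_nonneg hε.le hK1 hlower hupper htangent ?_ hnormal
  simpa [hn, he] using abs_real_inner_le_norm n e

theorem exists_pos_inv_pow_sub_one_add_lt (m : ℕ) {η : ℝ} (hη : 0 < η) :
    ∃ ε > 0, ε < 1 / 2 ∧ (1 - ε)⁻¹ ^ m - 1 + 3 * ε < η := by
  have hcont : ContinuousAt (fun ε : ℝ => (1 - ε)⁻¹ ^ m - 1 + 3 * ε) 0 := by
    fun_prop (disch := norm_num)
  have hlim : Tendsto (fun ε : ℝ => (1 - ε)⁻¹ ^ m - 1 + 3 * ε) (𝓝[>] 0) (𝓝 0) := by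
    simpa using hcont.tendsto.mono_left nhdsWithin_le_nhds
  have hhalf : ∀ᶠ ε : ℝ in 𝓝[>] 0, ε < 1 / 2 :=
    nhdsWithin_le_nhds (gt_mem_nhds one_half_pos)
  have hpos : ∀ᶠ ε : ℝ in 𝓝[>] 0, ε > 0 := self_mem_nhdsWithin
  exact (hpos.and (hhalf.and (hlim.eventually_lt_const hη))).exists

theorem exists_ball_abs_fluxDefect_le (hΩ : IsSmoothCompactDomain Ω)
    (hκ : (μH[m] : Measure (Eucl m)) = κ • volume) (he : ‖e‖ = 1) {x : Eucl (m + 1)}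
    (hx : x ∈ frontier Ω) {η : ℝ} (hη : 0 < η) :
    ∃ r > 0, ∀ v : Eucl (m + 1) → ℝ, ContDiff ℝ 1 v → (∀ y, 0 ≤ v y) →
      tsupport v ⊆ Metric.ball x r →
      |fluxDefect Ω κ e v| ≤ η * ∫ y, v y ∂surfaceMeasure Ω := by
  obtain ⟨ε, hε, hε', hεη⟩ := exists_pos_inv_pow_sub_one_add_lt m hη
  obtain ⟨r, hr, hcone⟩ := hΩ.exists_hasConeProperty hx hε
  obtain ⟨δ, hδ, hnear⟩ := Metric.continuousWithinAt_iff.1 (hΩ.continuousOn_outwardNormal x hx) ε hε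
  have har : 4 * (min r δ / 4) ≤ r := by linarith [min_le_left r δ]
  have ha : 0 < min r δ / 4 := by positivity
  refine ⟨min r δ / 4, ha, fun v hv hv0 hs => ?_⟩
  refine (abs_fluxDefect_le_of_hasConeProperty hΩ hκ he hx (hΩ.norm_outwardNormal hx) hε hε' ha
    (hcone.mono har) (fun y hy hyb => ?_) hv hv0 hs).trans
    (mul_le_mul_of_nonneg_right hεη.le (integral_nonneg hv0))
  rw [← dist_eq_norm, dist_comm]
  exact (hnear hy (lt_of_lt_of_le hyb (by linarith [min_le_right r δ]))).le

theorem fluxDefect_sub (hΩ : IsSmoothCompactDomain Ω) {κ : ℝ} {v : Eucl (m + 1) → ℝ}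
    (hv : ContDiff ℝ 1 v) (hw : ContDiff ℝ 1 w) :
    fluxDefect Ω κ e (fun y => v y - w y) = fluxDefect Ω κ e v - fluxDefect Ω κ e w := by
  have hint {u : Eucl (m + 1) → ℝ} (hu : ContDiff ℝ 1 u) :
      IntegrableOn (fun y => fderiv ℝ u y e) Ω :=
    (continuous_fderiv_apply_of_contDiff hu one_ne_zero e).continuousOn.integrableOn_compact
      hΩ.isCompact
  have hsurf {u : Eucl (m + 1) → ℝ} (hu : ContDiff ℝ 1 u) :=
    hΩ.integrable_mul_inner_outwardNormal (hΩ.integrable_surfaceMeasure hu.continuous) e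
  have hfderiv (y : Eucl (m + 1)) :
      fderiv ℝ (fun y => v y - w y) y e = fderiv ℝ v y e - fderiv ℝ w y e := by
    rw [fderiv_fun_sub (hv.differentiable one_ne_zero).differentiableAt
      (hw.differentiable one_ne_zero).differentiableAt, sub_apply]
  simp only [fluxDefect, hfderiv, sub_mul]
  rw [integral_sub (hint hv) (hint hw), integral_sub (hsurf hv) (hsurf hw)]
  ring

theorem fluxDefect_sum (hΩ : IsSmoothCompactDomain Ω) {κ : ℝ} {ι : Type*} (s : Finset ι)
    {w : ι → Eucl (m + 1) → ℝ} (hw : ∀ i ∈ s, ContDiff ℝ 1 (w i)) :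
    fluxDefect Ω κ e (fun y => ∑ i ∈ s, w i y) = ∑ i ∈ s, fluxDefect Ω κ e (w i) := by
  have hfderiv (y : Eucl (m + 1)) :
      fderiv ℝ (fun y => ∑ i ∈ s, w i y) y e = ∑ i ∈ s, fderiv ℝ (w i) y e := by
    rw [fderiv_fun_sum fun i hi => ((hw i hi).differentiable one_ne_zero).differentiableAt,
      sum_apply]
  simp only [fluxDefect, hfderiv, Finset.sum_mul, Finset.sum_sub_distrib]
  rw [integral_finsetSum _ fun i hi => (continuous_fderiv_apply_of_contDiff (hw i hi) one_ne_zero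
      e).continuousOn.integrableOn_compact hΩ.isCompact,
    integral_finsetSum _ fun i hi => hΩ.integrable_mul_inner_outwardNormal
      (hΩ.integrable_surfaceMeasure (hw i hi).continuous) e, Finset.mul_sum]

theorem fluxDefect_congr (hΩ : IsSmoothCompactDomain Ω) {κ : ℝ} {v : Eucl (m + 1) → ℝ}
    (hvw : ∀ y ∈ Ω, v =ᶠ[𝓝 y] w) : fluxDefect Ω κ e v = fluxDefect Ω κ e w := by
  have hvolume : ∫ y in Ω, fderiv ℝ v y e = ∫ y in Ω, fderiv ℝ w y e :=
    setIntegral_congr_fun hΩ.isCompact.measurableSet fun y hy => by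
      simp only [(hvw y hy).fderiv_eq]
  have hsurface : ∫ y, v y * inner ℝ (outwardNormal Ω y) e ∂surfaceMeasure Ω =
      ∫ y, w y * inner ℝ (outwardNormal Ω y) e ∂surfaceMeasure Ω := by
    refine integral_congr_ae ?_
    filter_upwards [ae_surfaceMeasure_mem_frontier Ω] with y hy
    rw [(hvw y (hΩ.isCompact.isClosed.frontier_subset hy)).self_of_nhds]
  rw [fluxDefect, fluxDefect, hvolume, hsurface]

theorem fluxDefect_eq_zero_of_tsupport_subset_compl (hΩ : IsSmoothCompactDomain Ω) {κ : ℝ}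
    (hs : tsupport w ⊆ Ωᶜ) : fluxDefect Ω κ e w = 0 := by
  have hlocal (y) (hy : y ∈ Ω) : w =ᶠ[𝓝 y] fun _ => 0 :=
    notMem_tsupport_iff_eventuallyEq.1 fun h => hs h hy
  rw [fluxDefect_congr hΩ hlocal]
  simp [fluxDefect]

theorem integral_fderiv_apply_eq_zero {E : Type*} [NormedAddCommGroup E] [NormedSpace ℝ E]
    [FiniteDimensional ℝ E] [MeasurableSpace E] [BorelSpace E] (μ : Measure E)
    [μ.IsAddHaarMeasure] {w : E → ℝ} (hw : ContDiff ℝ 1 w) (hc : HasCompactSupport w) (v : E) :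
    ∫ y, fderiv ℝ w y v ∂μ = 0 := by
  have hfderiv := (continuous_fderiv_apply_of_contDiff hw one_ne_zero
    v).integrable_of_hasCompactSupport (hc.fderiv_apply ℝ v) (μ := μ)
  have hwi := hw.continuous.integrable_of_hasCompactSupport hc (μ := μ)
  simpa using integral_mul_fderiv_eq_neg_fderiv_mul_of_integrable (μ := μ)
    (f := fun _ => (1 : ℝ)) (g := w) (v := v) (by simp) (by simpa using hfderiv)
    (by simpa using hwi) (fun _ _ => differentiableAt_const _)
    fun _ _ => (hw.differentiable one_ne_zero).differentiableAt

theorem fluxDefect_eq_zero_of_tsupport_subset_interior {κ : ℝ} (hw : ContDiff ℝ 1 w)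
    (hc : HasCompactSupport w) (hs : tsupport w ⊆ interior Ω) : fluxDefect Ω κ e w = 0 := by
  have hvolume : ∫ y in Ω, fderiv ℝ w y e = 0 := by
    rw [setIntegral_eq_integral_of_tsupport_subset (hs.trans interior_subset) fun y =>
      fderiv_apply_eq_zero_of_tsupport_subset subset_rfl e]
    exact integral_fderiv_apply_eq_zero volume hw hc e
  have hsurface : ∫ y, w y * inner ℝ (outwardNormal Ω y) e ∂surfaceMeasure Ω = 0 := by
    refine integral_eq_zero_of_ae ?_
    filter_upwards [ae_surfaceMeasure_mem_frontier Ω] with y hy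
    rw [image_eq_zero_of_notMem_tsupport fun h => hy.2 (hs h), zero_mul, Pi.zero_apply]
  rw [fluxDefect, hvolume, hsurface, mul_zero, sub_zero]

theorem exists_nhds_abs_fluxDefect_le (hΩ : IsSmoothCompactDomain Ω)
    (hκ : (μH[m] : Measure (Eucl m)) = κ • volume) (he : ‖e‖ = 1) {η : ℝ} (hη : 0 < η)
    (x : Eucl (m + 1)) : ∃ U : Set (Eucl (m + 1)), IsOpen U ∧ x ∈ U ∧
      ∀ v : Eucl (m + 1) → ℝ, ContDiff ℝ 1 v → HasCompactSupport v → (∀ y, 0 ≤ v y) →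
      tsupport v ⊆ U → |fluxDefect Ω κ e v| ≤ η * ∫ y, v y ∂surfaceMeasure Ω := by
  have htrivial (v : Eucl (m + 1) → ℝ) (hv0 : ∀ y, 0 ≤ v y) (hv : fluxDefect Ω κ e v = 0) :
      |fluxDefect Ω κ e v| ≤ η * ∫ y, v y ∂surfaceMeasure Ω := by
    rw [hv, abs_zero]
    exact mul_nonneg hη.le (integral_nonneg hv0)
  by_cases hxi : x ∈ interior Ω
  · exact ⟨interior Ω, isOpen_interior, hxi, fun v hv hvc hv0 hvs => htrivial v hv0
      (fluxDefect_eq_zero_of_tsupport_subset_interior hv hvc hvs)⟩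
  by_cases hxΩ : x ∈ Ω
  · obtain ⟨r, hr, hest⟩ := exists_ball_abs_fluxDefect_le hΩ hκ he ⟨subset_closure hxΩ, hxi⟩ hη
    exact ⟨_, Metric.isOpen_ball, Metric.mem_ball_self hr, fun v hv _ => hest v hv⟩
  · exact ⟨Ωᶜ, hΩ.isCompact.isClosed.isOpen_compl, hxΩ, fun v _ _ hv0 hvs => htrivial v hv0
      (fluxDefect_eq_zero_of_tsupport_subset_compl hΩ hvs)⟩

theorem exists_contDiff_partition_of_nonneg {E : Type*} [NormedAddCommGroup E] [NormedSpace ℝ E]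
    [FiniteDimensional ℝ E] {U : E → Set E} (hUo : ∀ x, IsOpen (U x)) (hxU : ∀ x, x ∈ U x)
    {n : ℕ} {w : E → ℝ} (hw : ContDiff ℝ n w) (hc : HasCompactSupport w) (hw0 : ∀ y, 0 ≤ w y) :
    ∃ (t : Finset E) (v : t → E → ℝ), (∀ i, ContDiff ℝ n (v i)) ∧
      (∀ i, HasCompactSupport (v i)) ∧ (∀ i y, 0 ≤ v i y) ∧ (∀ i, tsupport (v i) ⊆ U i) ∧
      w = fun y => ∑ i, v i y := by
  obtain ⟨t, ht⟩ := hc.isCompact.elim_finite_subcover U hUo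
    fun x _ => Set.mem_iUnion.2 ⟨x, hxU x⟩
  obtain ⟨f, hf⟩ := SmoothPartitionOfUnity.exists_isSubordinate 𝓘(ℝ, E) (isClosed_tsupport w)
    (fun i : t => U i) (fun i => hUo i) (by rwa [Set.iUnion_subtype])
  refine ⟨t, fun i y => f i y * w y, fun i => ?_, fun _ => hc.mul_left,
    fun i y => mul_nonneg (f.nonneg i y) (hw0 y), fun i => tsupport_mul_subset_left.trans (hf i),
    ?_⟩
  · exact ((f i).contMDiff.contDiff.of_le (mod_cast le_top)).mul hw
  · ext y
    rw [← Finset.sum_mul]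
    by_cases hy : y ∈ tsupport w
    · rw [← finsum_eq_sum_of_fintype, f.sum_eq_one hy, one_mul]
    · rw [image_eq_zero_of_notMem_tsupport hy, mul_zero]

/-- The local estimates have a relative error with respect to `∫ w`, so a partition of unity sums
them up without loss, however many pieces it has. -/
theorem abs_fluxDefect_le_of_nonneg (hΩ : IsSmoothCompactDomain Ω)
    (hκ : (μH[m] : Measure (Eucl m)) = κ • volume) (he : ‖e‖ = 1) {η : ℝ} (hη : 0 < η)
    (hw : ContDiff ℝ 1 w) (hc : HasCompactSupport w) (hw0 : ∀ y, 0 ≤ w y) :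
    |fluxDefect Ω κ e w| ≤ η * ∫ y, w y ∂surfaceMeasure Ω := by
  choose U hUo hxU hest using exists_nhds_abs_fluxDefect_le hΩ hκ he hη
  obtain ⟨t, v, hv, hvc, hv0, hvU, rfl⟩ :=
    exists_contDiff_partition_of_nonneg hUo hxU (n := 1) hw hc hw0
  rw [fluxDefect_sum hΩ _ fun i _ => hv i,
    integral_finsetSum _ fun i _ => hΩ.integrable_surfaceMeasure (hv i).continuous, Finset.mul_sum]
  exact (Finset.abs_sum_le_sum_abs _ _).trans
    (Finset.sum_le_sum fun i _ => hest i (v i) (hv i) (hvc i) (hv0 i) (hvU i))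

theorem fluxDefect_eq_zero_of_nonneg (hΩ : IsSmoothCompactDomain Ω)
    (hκ : (μH[m] : Measure (Eucl m)) = κ • volume) (he : ‖e‖ = 1) (hw : ContDiff ℝ 1 w)
    (hc : HasCompactSupport w) (hw0 : ∀ y, 0 ≤ w y) : fluxDefect Ω κ e w = 0 := by
  have hlim : Tendsto (fun η : ℝ => η * ∫ y, w y ∂surfaceMeasure Ω) (𝓝[>] 0) (𝓝 0) :=
    ((continuous_mul_const _).tendsto' 0 0 (zero_mul _)).mono_left nhdsWithin_le_nhds
  refine abs_nonpos_iff.1 (ge_of_tendsto hlim ?_)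
  filter_upwards [self_mem_nhdsWithin] with η hη
    using abs_fluxDefect_le_of_nonneg hΩ hκ he hη hw hc hw0

theorem fluxDefect_eq_zero_of_hasCompactSupport (hΩ : IsSmoothCompactDomain Ω)
    (hκ : (μH[m] : Measure (Eucl m)) = κ • volume) (he : ‖e‖ = 1) (hw : ContDiff ℝ 1 w)
    (hc : HasCompactSupport w) : fluxDefect Ω κ e w = 0 := by
  obtain ⟨χ, hχ, hχc, -, hχ1, hχ01⟩ := exists_contDiff_eq_one_nhdsSet hc.isCompact isOpen_univ
    (Set.subset_univ (tsupport w))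
  obtain ⟨B, hB⟩ := hw.continuous.bounded_above_of_compact_support hc
  have hB0 : 0 ≤ B := (norm_nonneg _).trans (hB 0)
  have hBχ : ContDiff ℝ 1 fun y => B * χ y := contDiff_const.mul (hχ.of_le (mod_cast le_top))
  have hBχ0 (y) : 0 ≤ B * χ y := mul_nonneg hB0 (hχ01 y).1
  have hwBχ (y) : w y ≤ B * χ y := by
    by_cases hy : y ∈ tsupport w
    · rw [hχ1.self_of_nhdsSet y hy, mul_one]
      exact (le_abs_self _).trans (hB y)
    · rw [image_eq_zero_of_notMem_tsupport hy]
      exact hBχ0 y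
  have hdiff := fluxDefect_eq_zero_of_nonneg hΩ hκ he (hBχ.sub hw) (hχc.mul_left.sub hc)
    fun y => sub_nonneg.2 (hwBχ y)
  rwa [fluxDefect_sub hΩ hBχ hw, fluxDefect_eq_zero_of_nonneg hΩ hκ he hBχ hχc.mul_left hBχ0,
    zero_sub, neg_eq_zero] at hdiff

theorem fluxDefect_eq_zero (hΩ : IsSmoothCompactDomain Ω)
    (hκ : (μH[m] : Measure (Eucl m)) = κ • volume) (he : ‖e‖ = 1) (hw : ContDiff ℝ 1 w) :
    fluxDefect Ω κ e w = 0 := by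
  obtain ⟨χ, hχ, hχc, -, hχ1, -⟩ := exists_contDiff_eq_one_nhdsSet hΩ.isCompact isOpen_univ
    (Set.subset_univ Ω)
  have hlocal (y) (hy : y ∈ Ω) : w =ᶠ[𝓝 y] fun y => χ y * w y := by
    filter_upwards [eventually_nhdsSet_iff_forall.1 hχ1 y hy] with z hz
    rw [hz, one_mul]
  rw [fluxDefect_congr hΩ hlocal]
  exact fluxDefect_eq_zero_of_hasCompactSupport hΩ hκ he
    ((hχ.of_le (mod_cast le_top)).mul hw) hχc.mul_right

end Divergence

/-! ### Integration by parts for traces -/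

section Trace

open scoped NNReal MeasureTheory Measure

section L2

variable {α : Type*} [MeasurableSpace α] {μ : Measure α} {f g : α → ℝ}

theorem integral_mul_eq_inner_toLp (hf : MemLp f 2 μ) (hg : MemLp g 2 μ) :
    ∫ x, f x * g x ∂μ = inner ℝ (hf.toLp f) (hg.toLp g) := by
  rw [L2.inner_def]
  refine integral_congr_ae ?_
  filter_upwards [hf.coeFn_toLp, hg.coeFn_toLp] with x hfx hgx
  simp [hfx, hgx, mul_comm]

theorem tendsto_integral_mul_of_tendsto_eLpNorm {ι : Type*} {l : Filter ι} {fn gn : ι → α → ℝ}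
    (hf : MemLp f 2 μ) (hg : MemLp g 2 μ) (hfn : ∀ n, MemLp (fn n) 2 μ)
    (hgn : ∀ n, MemLp (gn n) 2 μ)
    (hfl : Tendsto (fun n => eLpNorm (fun x => fn n x - f x) 2 μ) l (𝓝 0))
    (hgl : Tendsto (fun n => eLpNorm (fun x => gn n x - g x) 2 μ) l (𝓝 0)) :
    Tendsto (fun n => ∫ x, fn n x * gn n x ∂μ) l (𝓝 (∫ x, f x * g x ∂μ)) := by
  rw [integral_mul_eq_inner_toLp hf hg]
  simp only [fun n => integral_mul_eq_inner_toLp (hfn n) (hgn n)]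
  exact ((Lp.tendsto_Lp_iff_tendsto_eLpNorm'' fn hfn f hf).2 hfl).inner
    ((Lp.tendsto_Lp_iff_tendsto_eLpNorm'' gn hgn g hg).2 hgl)

end L2

theorem memLp_of_continuous_of_isCompact {X F : Type*} [TopologicalSpace X] [MeasurableSpace X]
    [OpensMeasurableSpace X] [NormedAddCommGroup F] [SecondCountableTopologyEither X F] {K : Set X}
    (hK : IsCompact K) {f : X → F} (hf : Continuous f) {μ : Measure X} [IsFiniteMeasure μ]
    (hμ : ∀ᵐ x ∂μ, x ∈ K) {p : ℝ≥0∞} : MemLp f p μ := by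
  obtain ⟨M, hM⟩ := hK.exists_bound_of_continuousOn hf.continuousOn
  exact MemLp.of_bound hf.aestronglyMeasurable M (hμ.mono hM)

theorem tendsto_eLpNorm_inner_const {α F ι : Type*} [MeasurableSpace α] {μ : Measure α}
    [NormedAddCommGroup F] [InnerProductSpace ℝ F] {l : Filter ι} {p : ℝ≥0∞} {u : ι → α → F}
    (h : Tendsto (fun n => eLpNorm (u n) p μ) l (𝓝 0)) {e : F} (he : ‖e‖ ≤ 1) :
    Tendsto (fun n => eLpNorm (fun x => inner ℝ (u n x) e) p μ) l (𝓝 0) :=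
  tendsto_of_tendsto_of_tendsto_of_le_of_le tendsto_const_nhds h (fun _ => zero_le) fun _ =>
    eLpNorm_mono fun _ => (norm_inner_le_norm _ _).trans (mul_le_of_le_one_right (norm_nonneg _) he)

variable {m : ℕ} {Ω : Set (Eucl (m + 1))} {e : Eucl (m + 1)}

theorem IsSmoothCompactDomain.norm_mul_inner_outwardNormal_le (hΩ : IsSmoothCompactDomain Ω)
    (he : ‖e‖ = 1) (f : Eucl (m + 1) → ℝ) :
    ∀ᵐ x ∂surfaceMeasure Ω, ‖f x * inner ℝ (outwardNormal Ω x) e‖ ≤ ‖f x‖ := by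
  filter_upwards [ae_surfaceMeasure_mem_frontier Ω] with x hx
  rw [norm_mul]
  exact mul_le_of_le_one_right (norm_nonneg _) ((hΩ.abs_inner_outwardNormal_le e hx).trans he.le)

theorem IsSmoothCompactDomain.memLp_mul_inner_outwardNormal (hΩ : IsSmoothCompactDomain Ω)
    (he : ‖e‖ = 1) {f : Eucl (m + 1) → ℝ} {p : ℝ≥0∞} (hf : MemLp f p (surfaceMeasure Ω)) :
    MemLp (fun x => f x * inner ℝ (outwardNormal Ω x) e) p (surfaceMeasure Ω) :=
  hf.mono (hf.aestronglyMeasurable.mul (hΩ.aestronglyMeasurable_inner_outwardNormal e))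
    (hΩ.norm_mul_inner_outwardNormal_le he f)

theorem IsSmoothCompactDomain.tendsto_eLpNorm_mul_inner_outwardNormal
    (hΩ : IsSmoothCompactDomain Ω) (he : ‖e‖ = 1) {ι : Type*} {l : Filter ι} {p : ℝ≥0∞}
    {b : ι → Eucl (m + 1) → ℝ} {t : Eucl (m + 1) → ℝ}
    (h : Tendsto (fun n => eLpNorm (fun x => b n x - t x) p (surfaceMeasure Ω)) l (𝓝 0)) :
    Tendsto (fun n => eLpNorm (fun x => b n x * inner ℝ (outwardNormal Ω x) e -
      t x * inner ℝ (outwardNormal Ω x) e) p (surfaceMeasure Ω)) l (𝓝 0) := by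
  simp only [← sub_mul]
  exact tendsto_of_tendsto_of_tendsto_of_le_of_le tendsto_const_nhds h (fun _ => zero_le)
    fun n => eLpNorm_mono_ae (hΩ.norm_mul_inner_outwardNormal_le he _)

theorem IsSmoothCompactDomain.integral_mul_of_contDiff (hΩ : IsSmoothCompactDomain Ω) {κ : ℝ≥0}
    (hκ : (μH[m] : Measure (Eucl m)) = κ • volume) (he : ‖e‖ = 1) {a b : Eucl (m + 1) → ℝ}
    (ha : ContDiff ℝ 1 a) (hb : ContDiff ℝ 1 b) :
    κ * ((∫ x in Ω, inner ℝ (gradient a x) e * b x) + ∫ x in Ω, a x * inner ℝ (gradient b x) e) =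
      ∫ x, a x * (b x * inner ℝ (outwardNormal Ω x) e) ∂surfaceMeasure Ω := by
  have hflux := fluxDefect_eq_zero hΩ hκ he (ha.mul hb)
  rw [fluxDefect, sub_eq_zero] at hflux
  simp only [← mul_assoc, inner_gradient_left]
  rw [← hflux, ← integral_add]
  · congr 2 with x
    rw [fderiv_fun_mul (ha.differentiable one_ne_zero x) (hb.differentiable one_ne_zero x)]
    simp only [add_apply, smul_apply, smul_eq_mul]
    ring
  · exact ((continuous_fderiv_apply_of_contDiff ha one_ne_zero e).mul
      hb.continuous).continuousOn.integrableOn_compact hΩ.isCompact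
  · exact (ha.continuous.mul
      (continuous_fderiv_apply_of_contDiff hb one_ne_zero e)).continuousOn.integrableOn_compact
      hΩ.isCompact

theorem IsSmoothCompactDomain.integral_mul_of_isTrace (hΩ : IsSmoothCompactDomain Ω) {κ : ℝ≥0}
    (hκ : (μH[m] : Measure (Eucl m)) = κ • volume) (he : ‖e‖ = 1)
    {u v tu tv : Eucl (m + 1) → ℝ} (hu : MemH1 Ω u) (hv : MemH1 Ω v) (htu : IsTrace Ω u tu)
    (htv : IsTrace Ω v tv) :
    κ * (∫ x in Ω, (inner ℝ (weakGrad Ω u x) e * v x + u x * inner ℝ (weakGrad Ω v x) e)) =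
      ∫ x, tu x * (tv x * inner ℝ (outwardNormal Ω x) e) ∂surfaceMeasure Ω := by
  obtain ⟨htu₂, a, ha, hau, hagu, hat⟩ := htu
  obtain ⟨htv₂, b, hb, hbv, hbgv, hbt⟩ := htv
  have := hΩ.isFiniteMeasure_surfaceMeasure
  have : Fact (volume Ω < ⊤) := ⟨hΩ.isCompact.measure_lt_top⟩
  have memLp_Ω {f : Eucl (m + 1) → ℝ} (hf : Continuous f) : MemLp f 2 (volume.restrict Ω) :=
    memLp_of_continuous_of_isCompact hΩ.isCompact hf (ae_restrict_mem hΩ.isCompact.measurableSet)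
  have memLp_σ {f : Eucl (m + 1) → ℝ} (hf : Continuous f) : MemLp f 2 (surfaceMeasure Ω) :=
    memLp_of_continuous_of_isCompact hΩ.isCompact hf
      ((ae_surfaceMeasure_mem_frontier Ω).mono hΩ.isCompact.isClosed.frontier_subset)
  have continuous_grad {w : Eucl (m + 1) → ℝ} (hw : ContDiff ℝ ∞ w) :
      Continuous fun x => inner ℝ (gradient w x) e :=
    (continuous_gradient_of_contDiff hw (by simp)).inner continuous_const
  have htv₂e := hΩ.memLp_mul_inner_outwardNormal he htv₂
  have interior_left := tendsto_integral_mul_of_tendsto_eLpNorm (hu.2.2.inner_const e) hv.1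
    (fun n => memLp_Ω (continuous_grad (ha n))) (fun n => memLp_Ω (hb n).continuous)
    (by simpa only [inner_sub_left] using tendsto_eLpNorm_inner_const hagu he.le) hbv
  have interior_right := tendsto_integral_mul_of_tendsto_eLpNorm hu.1 (hv.2.2.inner_const e)
    (fun n => memLp_Ω (ha n).continuous) (fun n => memLp_Ω (continuous_grad (hb n))) hau
    (by simpa only [inner_sub_left] using tendsto_eLpNorm_inner_const hbgv he.le)
  have boundary := tendsto_integral_mul_of_tendsto_eLpNorm htu₂ htv₂e
    (fun n => memLp_σ (ha n).continuous)
    (fun n => hΩ.memLp_mul_inner_outwardNormal he (memLp_σ (hb n).continuous)) hat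
    (hΩ.tendsto_eLpNorm_mul_inner_outwardNormal he hbt)
  have interior_sum := (interior_left.add interior_right).const_mul (κ : ℝ)
  simp only [fun n => hΩ.integral_mul_of_contDiff hκ he ((ha n).of_le (mod_cast le_top))
    ((hb n).of_le (mod_cast le_top))] at interior_sum
  rw [tendsto_nhds_unique boundary interior_sum, integral_add]
  · exact (hu.2.2.inner_const e).integrable_mul hv.1
  · exact hu.1.integrable_mul (hv.2.2.inner_const e)

theorem MemSteinClass.sum_integral_eq_zero {d : ℕ} {Ω : Set (Eucl d)}
    (hΩ : IsSmoothCompactDomain Ω) {μ : Measure (Eucl d)} (hμ : MemH1 Ω (density μ))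
    {φ : Eucl d → Eucl d} (hφ : MemSteinClass Ω μ φ) :
    ∑ j, ∫ x in Ω, (weakGrad Ω (density μ) x j * φ x j +
      density μ x * weakGrad Ω (fun y => φ y j) x j) = 0 := by
  obtain _ | m := d
  · simp
  obtain ⟨κ, hκ₀, hκ⟩ := exists_hausdorffMeasure_eq_smul m
  obtain ⟨hφ₁, tμ, tφ, htμ, htφ, hflux⟩ := hφ
  have parts j := hΩ.integral_mul_of_isTrace hκ
    (e := EuclideanSpace.single j 1) (by simp) hμ (hφ₁ j) htμ (htφ j)
  have integrable j : Integrable (fun x => tμ x * _) _ := htμ.1.integrable_mul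
    (hΩ.memLp_mul_inner_outwardNormal (e := EuclideanSpace.single j 1) (by simp) (htφ j).1)
  simp only [EuclideanSpace.inner_single_right, one_mul, conj_trivial] at parts integrable
  suffices (κ : ℝ) * ∑ j, ∫ x in Ω, (weakGrad Ω (density μ) x j * φ x j +
      density μ x * weakGrad Ω (fun y => φ y j) x j) = 0 from
    (mul_eq_zero.1 this).resolve_left (mod_cast hκ₀.ne')
  rw [Finset.mul_sum, ← hflux]
  simp only [parts]
  rw [← integral_finsetSum _ fun j _ => integrable j]
  congr 1 with x
  simp [PiLp.inner_apply, Finset.mul_sum, mul_comm]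

end Trace

/-! ### Weak derivatives from dual bounds -/

section DualBound

theorem exists_inner_eq_of_abs_le {V H : Type*} [AddCommGroup V] [Module ℝ V]
    [NormedAddCommGroup H] [InnerProductSpace ℝ H] [CompleteSpace H] (J : V →ₗ[ℝ] H)
    (l : V →ₗ[ℝ] ℝ) {C : ℝ} (hC : 0 ≤ C) (h : ∀ v, |l v| ≤ C * ‖J v‖) :
    ∃ g : H, ‖g‖ ≤ C ∧ ∀ v, l v = inner ℝ g (J v) := by
  obtain ⟨s, hs⟩ := J.rangeRestrict.exists_rightInverse_of_surjective J.range_rangeRestrict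
  have hJs (y : LinearMap.range J) : J (s y) = y := congrArg Subtype.val (LinearMap.congr_fun hs y)
  let L : LinearMap.range J →L[ℝ] ℝ := (l ∘ₗ s).mkContinuous C fun y => by
    simpa [hJs] using h (s y)
  obtain ⟨g, hg, hgL⟩ := exists_extension_norm_eq (LinearMap.range J) L
  refine ⟨(InnerProductSpace.toDual ℝ H).symm g, ?_, fun v => ?_⟩
  · rw [LinearIsometryEquiv.norm_map, hgL]
    exact LinearMap.mkContinuous_norm_le _ hC _
  · let y : LinearMap.range J := ⟨J v, LinearMap.mem_range_self J v⟩
    have hl : l v = l (s y) := by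
      rw [← sub_eq_zero, ← map_sub, ← abs_nonpos_iff]
      simpa [hJs, y] using h (v - s y)
    rw [InnerProductSpace.toDual_symm_apply, hg y, hl]
    rfl

variable {E : Type*} [NormedAddCommGroup E] [NormedSpace ℝ E] [MeasureSpace E] [BorelSpace E]
  {U : Set E} {u : E → ℝ}

variable (U) in
/-- The space `𝒟(U)` of smooth functions with compact support in `U`. -/
def testFunctions : Submodule ℝ (E → ℝ) where
  carrier := {φ | ContDiff ℝ ∞ φ ∧ HasCompactSupport φ ∧ tsupport φ ⊆ U}
  add_mem' := fun {φ ψ} h h' => ⟨h.1.add h'.1, h.2.1.add h'.2.1,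
    (tsupport_add φ ψ).trans (Set.union_subset h.2.2 h'.2.2)⟩
  zero_mem' := ⟨contDiff_const, HasCompactSupport.zero, by simp [tsupport]⟩
  smul_mem' := fun c φ h => ⟨contDiff_const.smul h.1, h.2.1.smul_left (f := fun _ => c),
    (closure_mono (Function.support_const_smul_subset c φ)).trans h.2.2⟩

theorem testFunctions.memLp [IsFiniteMeasureOnCompacts (volume : Measure E)]
    [SecondCountableTopologyEither E ℝ] (φ : testFunctions U) :
    MemLp φ.1 2 (volume.restrict U) :=
  φ.2.1.continuous.memLp_of_hasCompactSupport φ.2.2.1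

variable (U) in
/-- The inclusion of the test functions on `U` into `L²(U)`. -/
def testFunctionsToLp [IsFiniteMeasureOnCompacts (volume : Measure E)] :
    testFunctions U →ₗ[ℝ] Lp ℝ 2 (volume.restrict U) where
  toFun φ := (testFunctions.memLp φ).toLp φ
  map_add' φ ψ := MemLp.toLp_add (testFunctions.memLp φ) (testFunctions.memLp ψ)
  map_smul' c φ := MemLp.toLp_const_smul c (testFunctions.memLp φ)

/-- The distributional derivative of `u` on `U` in the direction `a`. -/
def distribDeriv (hu : LocallyIntegrableOn u U) (a : E) : testFunctions U →ₗ[ℝ] ℝ where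
  toFun φ := -∫ x, u x * fderiv ℝ φ.1 x a
  map_add' φ ψ := by
    have integrable (φ : testFunctions U) := integrable_mul_fderiv_of_locallyIntegrableOn hu
      (φ.2.1.of_le (mod_cast le_top)) φ.2.2.1 φ.2.2.2 (a := a)
    rw [← neg_add, ← integral_add (integrable φ) (integrable ψ)]
    congr 2 with x
    have hadd : fderiv ℝ (φ + ψ).1 x = fderiv ℝ φ.1 x + fderiv ℝ ψ.1 x :=
      fderiv_add (φ.2.1.differentiable (by simp) x) (ψ.2.1.differentiable (by simp) x)
    rw [hadd, add_apply, mul_add]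
  map_smul' c φ := by
    rw [RingHom.id_apply, smul_eq_mul, mul_neg, ← integral_const_mul]
    congr 2 with x
    have hsmul : fderiv ℝ (c • φ).1 x = c • fderiv ℝ φ.1 x :=
      fderiv_const_smul (φ.2.1.differentiable (by simp) x) c
    rw [hsmul, smul_apply, smul_eq_mul, mul_left_comm]

theorem exists_hasWeakDeriv_of_abs_integral_le [IsLocallyFiniteMeasure (volume : Measure E)]
    (hu : LocallyIntegrableOn u U) {a : E} {C : ℝ} (hC : 0 ≤ C)
    (h : ∀ φ : E → ℝ, ContDiff ℝ ∞ φ → HasCompactSupport φ → tsupport φ ⊆ U →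
      |∫ x, u x * fderiv ℝ φ x a| ≤ C * (eLpNorm φ 2 (volume.restrict U)).toReal) :
    ∃ g, MemLp g 2 (volume.restrict U) ∧ (eLpNorm g 2 (volume.restrict U)).toReal ≤ C ∧
      HasWeakDeriv U u a g := by
  obtain ⟨g, hgC, hg⟩ := exists_inner_eq_of_abs_le (testFunctionsToLp U) (distribDeriv hu a) hC
    fun φ => by
      simpa [distribDeriv, testFunctionsToLp, Lp.norm_toLp] using h φ φ.2.1 φ.2.2.1 φ.2.2.2
  refine ⟨g, Lp.memLp g, hgC, hu, locallyIntegrableOn_of_locallyIntegrable_restrict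
    ((Lp.memLp g).locallyIntegrable one_le_two), fun φ hφ hc hs => ?_⟩
  let φ' : testFunctions U := ⟨φ, hφ, hc, hs⟩
  have hinner : inner ℝ (testFunctionsToLp U φ') g = ∫ x in U, φ x * g x := by
    conv_lhs => rw [← Lp.toLp_coeFn g (Lp.memLp g)]
    exact (integral_mul_eq_inner_toLp (testFunctions.memLp φ') (Lp.memLp g)).symm
  calc ∫ x, u x * fderiv ℝ φ x a = -distribDeriv hu a φ' := (neg_neg _).symm
    _ = -∫ x in U, φ x * g x := by rw [hg, real_inner_comm, hinner]
    _ = -∫ x, φ x * g x := by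
      rw [setIntegral_eq_integral_of_tsupport_subset hs fun x hx => by
        rw [image_eq_zero_of_notMem_tsupport hx, zero_mul]]

end DualBound

/-! ### Functions and sections of a reproducing kernel Hilbert space -/

section KernelSections

variable {X : Type*} (Ω : Set X) {k : X → X → ℝ} {H₀ : Type*} [NormedAddCommGroup H₀]
  [InnerProductSpace ℝ H₀] [RKHS ℝ H₀ Ω ℝ]

/-- The function on the ambient space defined by an element of a reproducing kernel Hilbert space
of functions on `Ω`, with the value `0` off `Ω`. -/
def scalarField : H₀ →ₗ[ℝ] X → ℝ :=
  Function.ExtendByZero.linearMap ℝ Subtype.val ∘ₗ (RKHS.coeCLM ℝ).toLinearMap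

variable {Ω}

theorem scalarField_of_mem (f : H₀) {x : X} (hx : x ∈ Ω) : scalarField Ω f x = f ⟨x, hx⟩ :=
  Subtype.val_injective.extend_apply (f : Ω → ℝ) 0 ⟨x, hx⟩

theorem scalarField_of_notMem (f : H₀) {x : X} (hx : x ∉ Ω) : scalarField Ω f x = 0 :=
  Function.extend_apply' (f : Ω → ℝ) (0 : X → ℝ) x fun ⟨y, hy⟩ => hx (hy ▸ y.2)

variable [CompleteSpace H₀]

variable (Ω H₀) in
open Classical in
/-- The representer `k(·, x)` of the evaluation at `x`, with the value `0` off `Ω`. -/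
def kernelSection (x : X) : H₀ := if h : x ∈ Ω then RKHS.kerFun H₀ (⟨x, h⟩ : Ω) (1 : ℝ) else 0

theorem inner_kernelSection (f : H₀) (x : X) :
    inner ℝ f (kernelSection Ω H₀ x) = scalarField Ω f x := by
  by_cases hx : x ∈ Ω
  · rw [kernelSection, dif_pos hx, scalarField_of_mem _ hx, RKHS.inner_kerFun]
    simp
  · rw [kernelSection, dif_neg hx, scalarField_of_notMem _ hx, inner_zero_right]

theorem scalarField_kernelSection (hH₀ : ∀ x y : Ω, RKHS.kernel H₀ x y 1 = k x y) {x y : X}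
    (hx : x ∈ Ω) (hy : y ∈ Ω) : scalarField Ω (kernelSection Ω H₀ y) x = k x y := by
  rw [scalarField_of_mem _ hx, kernelSection, dif_pos hy, RKHS.kerFun_apply, hH₀]

theorem inner_kernelSection_kernelSection (hH₀ : ∀ x y : Ω, RKHS.kernel H₀ x y 1 = k x y)
    {x y : X} (hx : x ∈ Ω) (hy : y ∈ Ω) :
    inner ℝ (kernelSection Ω H₀ x) (kernelSection Ω H₀ y) = k y x := by
  rw [inner_kernelSection, scalarField_kernelSection hH₀ hy hx]

theorem inner_integral_smul_kernelSection [MeasurableSpace X] {ν : Measure X} {g : X → ℝ}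
    (hg : Integrable (fun x => g x • kernelSection Ω H₀ x) ν) (f : H₀) :
    inner ℝ f (∫ x, g x • kernelSection Ω H₀ x ∂ν) = ∫ x, g x * scalarField Ω f x ∂ν := by
  simp only [← integral_inner hg, inner_smul_right, inner_kernelSection]

theorem norm_sq_setIntegral_smul_kernelSection [MeasurableSpace X] {ν : Measure X}
    (hΩ : MeasurableSet Ω) (hH₀ : ∀ x y : Ω, RKHS.kernel H₀ x y 1 = k x y) {g : X → ℝ}
    (hg : IntegrableOn (fun x => g x • kernelSection Ω H₀ x) Ω ν) :
    ‖∫ x in Ω, g x • kernelSection Ω H₀ x ∂ν‖ ^ 2 =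
      ∫ x in Ω, ∫ y in Ω, k x y * (g x * g y) ∂ν ∂ν := by
  rw [← real_inner_self_eq_norm_sq, inner_integral_smul_kernelSection hg]
  refine setIntegral_congr_fun hΩ fun x hx => ?_
  simp only [← inner_kernelSection]
  rw [real_inner_comm, inner_integral_smul_kernelSection hg, ← integral_const_mul]
  refine setIntegral_congr_fun hΩ fun y hy => ?_
  have hsymm : k y x = k x y := by
    rw [← inner_kernelSection_kernelSection hH₀ hx hy, real_inner_comm,
      inner_kernelSection_kernelSection hH₀ hy hx]
  simp only [← inner_kernelSection, inner_kernelSection_kernelSection hH₀ hx hy, hsymm]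
  ring

variable [TopologicalSpace X]

theorem continuousOn_kernelSection (hH₀ : ∀ x y : Ω, RKHS.kernel H₀ x y 1 = k x y)
    (hk : ContinuousOn (Function.uncurry k) (Ω ×ˢ Ω)) : ContinuousOn (kernelSection Ω H₀) Ω := by
  intro x hx
  have hnorm : ∀ y ∈ Ω, ‖kernelSection Ω H₀ y - kernelSection Ω H₀ x‖ =
      √(k y y - 2 * k x y + k x x) := fun y hy => by
    rw [← inner_kernelSection_kernelSection hH₀ hy hy,
      ← inner_kernelSection_kernelSection hH₀ hy hx,
      ← inner_kernelSection_kernelSection hH₀ hx hx, real_inner_self_eq_norm_sq,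
      real_inner_self_eq_norm_sq, ← norm_sub_sq_real, Real.sqrt_sq (norm_nonneg _)]
  have hdiag : ContinuousOn (fun y => k y y) Ω :=
    hk.comp (f := fun y => (y, y)) (by fun_prop) fun y hy => ⟨hy, hy⟩
  have hsection : ContinuousOn (fun y => k x y) Ω :=
    hk.comp (f := fun y => (x, y)) (by fun_prop) fun y hy => ⟨hx, hy⟩
  have hsqrt : ContinuousOn (fun y => √(k y y - 2 * k x y + k x x)) Ω :=
    ((hdiag.sub (continuousOn_const.mul hsection)).add continuousOn_const).sqrt
  have hlim := (hsqrt.congr hnorm x hx).tendsto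
  rw [sub_self, norm_zero] at hlim
  exact tendsto_iff_norm_sub_tendsto_zero.2 hlim

theorem exists_abs_scalarField_le (hΩ : IsCompact Ω)
    (hH₀ : ∀ x y : Ω, RKHS.kernel H₀ x y 1 = k x y)
    (hk : ContinuousOn (Function.uncurry k) (Ω ×ˢ Ω)) :
    ∃ B, 0 ≤ B ∧ ∀ (f : H₀) (x : X), |scalarField Ω f x| ≤ B * ‖f‖ := by
  obtain ⟨B, hB⟩ := hΩ.exists_bound_of_continuousOn
    (continuousOn_kernelSection (H₀ := H₀) hH₀ hk)
  refine ⟨max B 0, le_max_right _ _, fun f x => ?_⟩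
  by_cases hx : x ∈ Ω
  · rw [← inner_kernelSection, mul_comm]
    refine (abs_real_inner_le_norm _ _).trans ?_
    gcongr
    exact (hB x hx).trans (le_max_left _ _)
  · rw [scalarField_of_notMem _ hx, abs_zero]
    positivity

theorem continuousOn_scalarField (hH₀ : ∀ x y : Ω, RKHS.kernel H₀ x y 1 = k x y)
    (hk : ContinuousOn (Function.uncurry k) (Ω ×ˢ Ω)) (f : H₀) :
    ContinuousOn (scalarField Ω f) Ω :=
  (continuousOn_const.inner (continuousOn_kernelSection hH₀ hk)).congr fun _ _ =>
    (inner_kernelSection f _).symm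

variable [MeasurableSpace X] {ν : Measure X}

theorem memLp_scalarField [OpensMeasurableSpace X] [IsFiniteMeasureOnCompacts ν]
    (hΩ : IsCompact Ω) (hΩm : MeasurableSet Ω) (hH₀ : ∀ x y : Ω, RKHS.kernel H₀ x y 1 = k x y)
    (hk : ContinuousOn (Function.uncurry k) (Ω ×ˢ Ω)) {p : ℝ≥0∞} (f : H₀) :
    MemLp (scalarField Ω f) p (ν.restrict Ω) := by
  have := isFiniteMeasure_restrict.2 (hΩ.measure_ne_top (μ := ν))
  obtain ⟨B, -, hB⟩ := exists_abs_scalarField_le hΩ hH₀ hk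
  exact MemLp.of_bound ((continuousOn_scalarField hH₀ hk f).aestronglyMeasurable hΩm) _
    (.of_forall (hB f))

theorem exists_eLpNorm_scalarField_le [IsFiniteMeasureOnCompacts ν] (hΩ : IsCompact Ω)
    (hH₀ : ∀ x y : Ω, RKHS.kernel H₀ x y 1 = k x y)
    (hk : ContinuousOn (Function.uncurry k) (Ω ×ˢ Ω)) (p : ℝ≥0∞) :
    ∃ C, 0 ≤ C ∧ ∀ f : H₀, (eLpNorm (scalarField Ω f) p (ν.restrict Ω)).toReal ≤ C * ‖f‖ := by
  have := isFiniteMeasure_restrict.2 (hΩ.measure_ne_top (μ := ν))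
  obtain ⟨B, hB0, hB⟩ := exists_abs_scalarField_le (H₀ := H₀) hΩ hH₀ hk
  refine ⟨((ν.restrict Ω) Set.univ ^ p.toReal⁻¹).toReal * B, by positivity, fun f => ?_⟩
  rw [mul_assoc, ← ENNReal.toReal_ofReal (mul_nonneg hB0 (norm_nonneg f)), ← ENNReal.toReal_mul]
  refine ENNReal.toReal_mono ?_ (eLpNorm_le_of_ae_bound (.of_forall (hB f)))
  finiteness

end KernelSections

/-! ### Weak derivatives in a reproducing kernel Hilbert space -/

section SquareIntegrable

variable {α β : Type*} [MeasurableSpace α] [MeasurableSpace β] {μ : Measure α} {ν : Measure β}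

theorem toReal_eLpNorm_two_sq {f : α → ℝ} (hf : MemLp f 2 μ) :
    (eLpNorm f 2 μ).toReal ^ 2 = ∫ x, f x * f x ∂μ := by
  rw [integral_mul_eq_inner_toLp hf hf, real_inner_self_eq_norm_sq, Lp.norm_toLp]

theorem abs_integral_mul_le {f g : α → ℝ} (hf : MemLp f 2 μ) (hg : MemLp g 2 μ) :
    |∫ x, f x * g x ∂μ| ≤ (eLpNorm f 2 μ).toReal * (eLpNorm g 2 μ).toReal := by
  rw [integral_mul_eq_inner_toLp hf hg, ← Lp.norm_toLp f hf, ← Lp.norm_toLp g hg]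
  exact abs_real_inner_le_norm _ _

theorem toReal_eLpNorm_two_prod_mul [SFinite μ] [SFinite ν] {f : α → ℝ} {g : β → ℝ}
    (hf : MemLp f 2 μ) (hg : MemLp g 2 ν)
    (hfg : MemLp (fun p => f p.1 * g p.2) 2 (μ.prod ν)) :
    (eLpNorm (fun p => f p.1 * g p.2) 2 (μ.prod ν)).toReal =
      (eLpNorm f 2 μ).toReal * (eLpNorm g 2 ν).toReal := by
  rw [← sq_eq_sq₀ ENNReal.toReal_nonneg (by positivity), mul_pow, toReal_eLpNorm_two_sq hf,
    toReal_eLpNorm_two_sq hg, toReal_eLpNorm_two_sq hfg, ← integral_prod_mul]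
  simp only [mul_mul_mul_comm]

end SquareIntegrable

section Tensor

variable {E F : Type*} [NormedAddCommGroup E] [NormedAddCommGroup F] {φ : E → ℝ} {χ : F → ℝ}

theorem tsupport_fst_mul_snd_subset :
    tsupport (fun q : E × F => φ q.1 * χ q.2) ⊆ tsupport φ ×ˢ tsupport χ :=
  closure_minimal (fun _ hq => ⟨subset_tsupport _ (left_ne_zero_of_mul hq),
    subset_tsupport _ (right_ne_zero_of_mul hq)⟩)
    ((isClosed_tsupport φ).prod (isClosed_tsupport χ))

theorem hasCompactSupport_fst_mul_snd (hφ : HasCompactSupport φ) (hχ : HasCompactSupport χ) :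
    HasCompactSupport (fun q : E × F => φ q.1 * χ q.2) :=
  (hφ.isCompact.prod hχ.isCompact).of_isClosed_subset (isClosed_tsupport _)
    tsupport_fst_mul_snd_subset

theorem fderiv_fst_mul_snd_apply [NormedSpace ℝ E] [NormedSpace ℝ F] (hφ : Differentiable ℝ φ)
    (hχ : Differentiable ℝ χ) (p v : E × F) :
    fderiv ℝ (fun q : E × F => φ q.1 * χ q.2) p v =
      fderiv ℝ φ p.1 v.1 * χ p.2 + φ p.1 * fderiv ℝ χ p.2 v.2 := by
  have hfst : HasFDerivAt (fun q : E × F => φ q.1) _ p :=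
    (hφ p.1).hasFDerivAt.comp p hasFDerivAt_fst
  have hsnd : HasFDerivAt (fun q : E × F => χ q.2) _ p :=
    (hχ p.2).hasFDerivAt.comp p hasFDerivAt_snd
  have hmul : HasFDerivAt (fun q : E × F => φ q.1 * χ q.2) _ p := hfst.mul hsnd
  rw [hmul.fderiv]
  simp [mul_comm, add_comm]

end Tensor

section KernelDerivatives

variable {d : ℕ} {Ω : Set (Eucl d)} {k : Eucl d → Eucl d → ℝ} {i j : Fin d}
  {m : Eucl d × Eucl d → ℝ} {φ χ : Eucl d → ℝ}

theorem IsWeakMixedDeriv.integral_mul_fderiv_mul_fderiv (hm : IsWeakMixedDeriv Ω k i j m)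
    (hφ : φ ∈ testFunctions (interior Ω)) (hχ : χ ∈ testFunctions (interior Ω)) :
    ∫ p, k p.1 p.2 * (fderiv ℝ φ p.1 (EuclideanSpace.single i 1) *
        fderiv ℝ χ p.2 (EuclideanSpace.single j 1))
        ∂((volume.restrict Ω).prod (volume.restrict Ω)) =
      ∫ p, m p * (φ p.1 * χ p.2) ∂((volume.restrict Ω).prod (volume.restrict Ω)) := by
  have hχ' : ContDiff ℝ ∞ fun y => fderiv ℝ χ y (EuclideanSpace.single j 1) :=
    (hχ.1.fderiv_right (m := ∞) (by simp)).clm_apply contDiff_const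
  have hψ := hm (fun q => φ q.1 * χ q.2)
    ((hφ.1.comp contDiff_fst).mul (hχ.1.comp contDiff_snd))
    (hasCompactSupport_fst_mul_snd hφ.2.1 hχ.2.1)
    (tsupport_fst_mul_snd_subset.trans (Set.prod_mono hφ.2.2 hχ.2.2))
  simpa only [fderiv_fst_mul_snd_apply (hφ.1.differentiable (by simp))
    (hχ.1.differentiable (by simp)), fderiv_fst_mul_snd_apply (hφ.1.differentiable (by simp))
    (hχ'.differentiable (by simp)), map_zero, zero_mul, zero_add, mul_zero, add_zero] using hψ

theorem IsWeakMixedDeriv.integral_mul_fderiv_mul_fderiv_le (hm : IsWeakMixedDeriv Ω k i j m)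
    (hm2 : MemLp m 2 ((volume.restrict Ω).prod (volume.restrict Ω)))
    (hφ : φ ∈ testFunctions (interior Ω)) (hχ : χ ∈ testFunctions (interior Ω)) :
    ∫ p, k p.1 p.2 * (fderiv ℝ φ p.1 (EuclideanSpace.single i 1) *
        fderiv ℝ χ p.2 (EuclideanSpace.single j 1))
        ∂((volume.restrict Ω).prod (volume.restrict Ω)) ≤
      (eLpNorm m 2 ((volume.restrict Ω).prod (volume.restrict Ω))).toReal *
        ((eLpNorm φ 2 (volume.restrict Ω)).toReal *
          (eLpNorm χ 2 (volume.restrict Ω)).toReal) := by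
  have hφ2 : MemLp φ 2 (volume.restrict Ω) := hφ.1.continuous.memLp_of_hasCompactSupport hφ.2.1
  have hχ2 : MemLp χ 2 (volume.restrict Ω) := hχ.1.continuous.memLp_of_hasCompactSupport hχ.2.1
  have hψ2 : MemLp (fun p => φ p.1 * χ p.2) 2 ((volume.restrict Ω).prod (volume.restrict Ω)) :=
    ((hφ.1.continuous.comp continuous_fst).mul
      (hχ.1.continuous.comp continuous_snd)).memLp_of_hasCompactSupport
      (hasCompactSupport_fst_mul_snd hφ.2.1 hχ.2.1)
  rw [hm.integral_mul_fderiv_mul_fderiv hφ hχ, ← toReal_eLpNorm_two_prod_mul hφ2 hχ2 hψ2]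
  exact (le_abs_self _).trans (abs_integral_mul_le hm2 hψ2)

variable {H₀ : Type*} [NormedAddCommGroup H₀] [InnerProductSpace ℝ H₀] [RKHS ℝ H₀ Ω ℝ]
  [CompleteSpace H₀]

theorem abs_setIntegral_scalarField_mul_fderiv_le (hΩ : IsCompact Ω)
    (hH₀ : ∀ x y : Ω, RKHS.kernel H₀ x y 1 = k x y)
    (hk : ContinuousOn (Function.uncurry k) (Ω ×ˢ Ω)) (hm : IsWeakMixedDeriv Ω k i i m)
    (hm2 : MemLp m 2 ((volume.restrict Ω).prod (volume.restrict Ω))) (f : H₀)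
    (hφ : φ ∈ testFunctions (interior Ω)) :
    |∫ x in Ω, scalarField Ω f x * fderiv ℝ φ x (EuclideanSpace.single i 1)| ≤
      √(eLpNorm m 2 ((volume.restrict Ω).prod (volume.restrict Ω))).toReal * ‖f‖ *
        (eLpNorm φ 2 (volume.restrict Ω)).toReal := by
  set M := (eLpNorm m 2 ((volume.restrict Ω).prod (volume.restrict Ω))).toReal
  set N := (eLpNorm φ 2 (volume.restrict Ω)).toReal
  set g : Eucl d → ℝ := fun x => fderiv ℝ φ x (EuclideanSpace.single i 1)
  have hg : Continuous g := continuous_fderiv_apply_of_contDiff hφ.1 (by simp) _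
  have hgK : IntegrableOn (fun x => g x • kernelSection Ω H₀ x) Ω :=
    (hg.continuousOn.smul (continuousOn_kernelSection hH₀ hk)).integrableOn_compact hΩ
  have hkgg : Integrable (fun p : Eucl d × Eucl d => k p.1 p.2 * (g p.1 * g p.2))
      ((volume.restrict Ω).prod (volume.restrict Ω)) := by
    rw [Measure.prod_restrict]
    exact (hk.mul (by fun_prop)).integrableOn_compact (hΩ.prod hΩ)
  set S : H₀ := ∫ x in Ω, g x • kernelSection Ω H₀ x with hS
  have hS_sq : ‖S‖ ^ 2 ≤ (√M * N) ^ 2 := by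
    rw [hS, norm_sq_setIntegral_smul_kernelSection hΩ.measurableSet hH₀ hgK,
      ← integral_prod _ hkgg, mul_pow, Real.sq_sqrt ENNReal.toReal_nonneg, sq]
    exact hm.integral_mul_fderiv_mul_fderiv_le hm2 hφ hφ
  calc |∫ x in Ω, scalarField Ω f x * g x| = |inner ℝ f S| := by
        rw [hS, inner_integral_smul_kernelSection hgK]
        simp only [mul_comm]
    _ ≤ ‖f‖ * ‖S‖ := abs_real_inner_le_norm f S
    _ ≤ ‖f‖ * (√M * N) := by
        gcongr
        exact le_of_sq_le_sq hS_sq (by positivity)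
    _ = √M * ‖f‖ * N := by ring

theorem exists_hasWeakDeriv_scalarField (hΩ : IsSmoothCompactDomain Ω)
    (hH₀ : ∀ x y : Ω, RKHS.kernel H₀ x y 1 = k x y)
    (hk : ContinuousOn (Function.uncurry k) (Ω ×ˢ Ω)) (hm : IsWeakMixedDeriv Ω k i i m)
    (hm2 : MemLp m 2 ((volume.restrict Ω).prod (volume.restrict Ω))) (f : H₀) :
    ∃ g, MemLp g 2 (volume.restrict Ω) ∧ (eLpNorm g 2 (volume.restrict Ω)).toReal ≤
        √(eLpNorm m 2 ((volume.restrict Ω).prod (volume.restrict Ω))).toReal * ‖f‖ ∧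
      HasWeakDeriv (interior Ω) (scalarField Ω f) (EuclideanSpace.single i 1) g := by
  have hf : LocallyIntegrableOn (scalarField Ω f) (interior Ω) :=
    ((continuousOn_scalarField hH₀ hk f).mono interior_subset).locallyIntegrableOn
      isOpen_interior.measurableSet
  rw [← hΩ.restrict_interior]
  refine exists_hasWeakDeriv_of_abs_integral_le hf (by positivity) fun φ hφ hc hs => ?_
  rw [← setIntegral_eq_integral_of_tsupport_subset (hs.trans interior_subset) fun x hx => by
    rw [fderiv_of_notMem_tsupport ℝ hx, zero_apply, mul_zero],
    hΩ.restrict_interior]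
  exact abs_setIntegral_scalarField_mul_fderiv_le hΩ.isCompact hH₀ hk hm hm2 f ⟨hφ, hc, hs⟩

theorem weaklyDifferentiable_scalarField (hΩ : IsSmoothCompactDomain Ω)
    (hH₀ : ∀ x y : Ω, RKHS.kernel H₀ x y 1 = k x y)
    (hk : ContinuousOn (Function.uncurry k) (Ω ×ˢ Ω))
    (hm : ∀ i, ∃ m, MemLp m 2 ((volume.restrict Ω).prod (volume.restrict Ω)) ∧
      IsWeakMixedDeriv Ω k i i m) (f : H₀) : WeaklyDifferentiable Ω (scalarField Ω f) := by
  choose m hm2 hm using hm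
  choose g hg _ hgw using fun i => exists_hasWeakDeriv_scalarField hΩ hH₀ hk (hm i) (hm2 i) f
  have := isFiniteMeasure_restrict.2 (hΩ.isCompact.measure_ne_top (μ := volume))
  have hG : IntegrableOn (fun x => (WithLp.toLp 2 fun i => g i x : Eucl d)) Ω :=
    .of_eval_piLp fun i => (hg i).integrable one_le_two
  exact ⟨_, isWeakGrad_of_hasWeakDeriv_single
    (((continuousOn_scalarField hH₀ hk f).mono interior_subset).locallyIntegrableOn
      isOpen_interior.measurableSet)
    (hG.mono_set interior_subset).locallyIntegrableOn hgw⟩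

theorem exists_eLpNorm_weakGrad_scalarField_le (hΩ : IsSmoothCompactDomain Ω)
    (hH₀ : ∀ x y : Ω, RKHS.kernel H₀ x y 1 = k x y)
    (hk : ContinuousOn (Function.uncurry k) (Ω ×ˢ Ω))
    (hm : ∀ i, ∃ m, MemLp m 2 ((volume.restrict Ω).prod (volume.restrict Ω)) ∧
      IsWeakMixedDeriv Ω k i i m) (i : Fin d) :
    ∃ C, 0 ≤ C ∧ ∀ f : H₀, MemLp (fun x => weakGrad Ω (scalarField Ω f) x i) 2 (volume.restrict Ω) ∧
      (eLpNorm (fun x => weakGrad Ω (scalarField Ω f) x i) 2 (volume.restrict Ω)).toReal ≤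
        C * ‖f‖ := by
  obtain ⟨m, hm2, hmi⟩ := hm i
  refine ⟨√(eLpNorm m 2 ((volume.restrict Ω).prod (volume.restrict Ω))).toReal,
    Real.sqrt_nonneg _, fun f => ?_⟩
  obtain ⟨g, hg, hgC, hgw⟩ := exists_hasWeakDeriv_scalarField hΩ hH₀ hk hmi hm2 f
  have hgrad : (fun x => weakGrad Ω (scalarField Ω f) x i) =ᵐ[volume.restrict Ω] g := by
    rw [← hΩ.restrict_interior]
    exact ((weaklyDifferentiable_scalarField hΩ hH₀ hk hm f).isWeakGrad.hasWeakDeriv_single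
      i).unique isOpen_interior hgw
  exact ⟨(memLp_congr_ae hgrad).2 hg, (congrArg _ (eLpNorm_congr_ae hgrad)).trans_le hgC⟩

end KernelDerivatives

/-! ### The Stein functional -/

section SteinFunctional

variable {d : ℕ} {Ω : Set (Eucl d)} {u v : Eucl d → ℝ} {G : Eucl d → Eucl d}

theorem IsWeakGrad.weakGrad_ae_eq (hΩ : IsSmoothCompactDomain Ω) (h : IsWeakGrad Ω u G) :
    weakGrad Ω u =ᵐ[volume.restrict Ω] G := by
  rw [← hΩ.restrict_interior]
  exact (WeaklyDifferentiable.isWeakGrad ⟨G, h⟩).unique h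

theorem weakGrad_add_ae (hΩ : IsSmoothCompactDomain Ω) (hu : WeaklyDifferentiable Ω u)
    (hv : WeaklyDifferentiable Ω v) :
    weakGrad Ω (u + v) =ᵐ[volume.restrict Ω] weakGrad Ω u + weakGrad Ω v :=
  (hu.isWeakGrad.add hv.isWeakGrad).weakGrad_ae_eq hΩ

theorem weakGrad_const_smul_ae (hΩ : IsSmoothCompactDomain Ω) (hu : WeaklyDifferentiable Ω u)
    (c : ℝ) : weakGrad Ω (c • u) =ᵐ[volume.restrict Ω] c • weakGrad Ω u :=
  (hu.isWeakGrad.const_mul c).weakGrad_ae_eq hΩ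

theorem weakGrad_congr_ae (hΩ : IsSmoothCompactDomain Ω) (hv : WeaklyDifferentiable Ω v)
    (huv : u =ᵐ[volume.restrict Ω] v) :
    weakGrad Ω u =ᵐ[volume.restrict Ω] weakGrad Ω v := by
  refine (hv.isWeakGrad.congr_ae ?_).weakGrad_ae_eq hΩ
  rw [hΩ.restrict_interior]
  exact huv.symm

variable {μ π : Measure (Eucl d)}

theorem integrable_of_integrableOn_density_mul [SigmaFinite μ] (hμ : μ ≪ volume) (hμΩ : μ Ωᶜ = 0)
    (hΩ : MeasurableSet Ω) {F : Eucl d → ℝ} (hF : IntegrableOn (fun x => density μ x * F x) Ω) :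
    Integrable F μ := by
  have hF' : Integrable (fun x => (μ.rnDeriv volume x).toReal • Ω.indicator F x) volume := by
    refine ((integrable_indicator_iff hΩ).2 hF).congr (.of_forall fun x => ?_)
    exact Set.indicator_mul_right Ω (density μ) F
  rw [integrable_rnDeriv_smul_iff hμ, integrable_indicator_iff hΩ] at hF'
  rwa [IntegrableOn, Measure.restrict_eq_self_of_ae_mem (mem_ae_iff.2 hμΩ)] at hF'

theorem integral_eq_setIntegral_density_mul [SigmaFinite μ] (hμ : μ ≪ volume) (hμΩ : μ Ωᶜ = 0)
    (hΩ : MeasurableSet Ω) (F : Eucl d → ℝ) :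
    ∫ x, F x ∂μ = ∫ x in Ω, density μ x * F x := by
  conv_lhs => rw [← Measure.restrict_eq_self_of_ae_mem (mem_ae_iff.2 hμΩ)]
  exact (setIntegral_rnDeriv_smul hμ hΩ).symm

variable (Ω μ π) in
/-- The product of the density of `μ` and `A_π (f e_i)`: the contribution of the `i`-th component
of a vector field to the expectation of the Stein operator. -/
def steinIntegrand (i : Fin d) (f : Eucl d → ℝ) (x : Eucl d) : ℝ :=
  density μ x * score Ω π x i * f x + density μ x * weakGrad Ω f x i

theorem density_mul_steinOp (φ : Eucl d → Eucl d) (x : Eucl d) :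
    density μ x * steinOp Ω π φ x = ∑ i, steinIntegrand Ω μ π i (fun y => φ y i) x := by
  simp only [steinOp, steinIntegrand, PiLp.inner_apply, RCLike.inner_apply', conj_trivial,
    mul_add, Finset.mul_sum, Finset.sum_add_distrib, mul_assoc]

theorem HasSquareIntegrableScore.memLp_apply (h : HasSquareIntegrableScore Ω μ π) (i : Fin d) :
    MemLp (fun x => density μ x * score Ω π x i) 2 (volume.restrict Ω) :=
  h.2.eval_piLp i

theorem exists_inner_eq_integral_mul {H α : Type*} [NormedAddCommGroup H] [InnerProductSpace ℝ H]
    [CompleteSpace H] [MeasurableSpace α] {ν : Measure α} {F : α → ℝ} {T : H → α → ℝ} {C : ℝ}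
    (hF : MemLp F 2 ν) (hT : ∀ f, MemLp (T f) 2 ν) (hadd : ∀ f g, T (f + g) =ᵐ[ν] T f + T g)
    (hsmul : ∀ (c : ℝ) f, T (c • f) =ᵐ[ν] c • T f) (hC : 0 ≤ C)
    (hTC : ∀ f, (eLpNorm (T f) 2 ν).toReal ≤ C * ‖f‖) :
    ∃ a : H, ∀ f, ∫ x, F x * T f x ∂ν = inner ℝ a f := by
  have hint : ∀ f, Integrable (fun x => F x * T f x) ν := fun f => hF.integrable_mul (hT f)
  let l : H →ₗ[ℝ] ℝ :=
    { toFun f := ∫ x, F x * T f x ∂ν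
      map_add' f g := by
        rw [← integral_add (hint f) (hint g)]
        refine integral_congr_ae ?_
        filter_upwards [hadd f g] with x hx
        rw [hx, Pi.add_apply, mul_add]
      map_smul' c f := by
        rw [RingHom.id_apply, smul_eq_mul, ← integral_const_mul]
        refine integral_congr_ae ?_
        filter_upwards [hsmul c f] with x hx
        rw [hx, Pi.smul_apply, smul_eq_mul, mul_left_comm] }
  obtain ⟨a, -, ha⟩ := exists_inner_eq_of_abs_le (LinearMap.id : H →ₗ[ℝ] H) l
    (C := (eLpNorm F 2 ν).toReal * C) (by positivity) fun f =>
    calc |∫ x, F x * T f x ∂ν| ≤ (eLpNorm F 2 ν).toReal * (eLpNorm (T f) 2 ν).toReal :=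
          abs_integral_mul_le hF (hT f)
      _ ≤ (eLpNorm F 2 ν).toReal * (C * ‖f‖) := by gcongr; exact hTC f
      _ = (eLpNorm F 2 ν).toReal * C * ‖f‖ := (mul_assoc _ _ _).symm
  exact ⟨a, ha⟩

variable {H₀ : Type*} [NormedAddCommGroup H₀] [InnerProductSpace ℝ H₀] [RKHS ℝ H₀ Ω ℝ]

theorem isGreatest_steinValues {a : ProductRKHS d H₀}
    (ha : ∀ f : ProductRKHS d H₀, ∫ x, steinOp Ω π (toField f) x ∂μ = inner ℝ a f) :
    IsGreatest (steinValues Ω H₀ μ π) ‖a‖ := by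
  refine ⟨⟨‖a‖⁻¹ • a, ?_, ?_⟩, ?_⟩
  · rw [norm_smul, norm_inv, norm_norm]
    exact inv_mul_le_one
  · rw [ha, inner_smul_right, real_inner_self_eq_norm_sq, sq, ← mul_assoc,
      inv_mul_mul_self]
  · rintro r ⟨f, hf, rfl⟩
    rw [ha]
    exact (real_inner_le_norm a f).trans (mul_le_of_le_one_right (norm_nonneg _) hf)

theorem integral_steinOp_toField [SigmaFinite μ] (hμ : μ ≪ volume) (hμΩ : μ Ωᶜ = 0)
    (hΩ : MeasurableSet Ω) {f : ProductRKHS d H₀}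
    (hf : ∀ i, IntegrableOn (steinIntegrand Ω μ π i (scalarField Ω (f i))) Ω) :
    Integrable (steinOp Ω π (toField f)) μ ∧ ∫ x, steinOp Ω π (toField f) x ∂μ =
      ∑ i, ∫ x in Ω, steinIntegrand Ω μ π i (scalarField Ω (f i)) x := by
  have hsum (x : Eucl d) : density μ x * steinOp Ω π (toField f) x =
      ∑ i, steinIntegrand Ω μ π i (scalarField Ω (f i)) x := density_mul_steinOp _ x
  refine ⟨integrable_of_integrableOn_density_mul hμ hμΩ hΩ ?_, ?_⟩
  · simp only [hsum]
    exact integrable_finsetSum Finset.univ fun i _ => hf i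
  · rw [integral_eq_setIntegral_density_mul hμ hμΩ hΩ]
    simp only [hsum]
    exact integral_finsetSum _ fun i _ => hf i

variable [CompleteSpace H₀] {k : Eucl d → Eucl d → ℝ}

theorem integrableOn_steinIntegrand (hΩ : IsSmoothCompactDomain Ω)
    (hμ : MemLp (density μ) 2 (volume.restrict Ω)) (hscore : HasSquareIntegrableScore Ω μ π)
    (hH₀ : ∀ x y : Ω, RKHS.kernel H₀ x y 1 = k x y)
    (hk : ContinuousOn (Function.uncurry k) (Ω ×ˢ Ω))
    (hm : ∀ i, ∃ m, MemLp m 2 ((volume.restrict Ω).prod (volume.restrict Ω)) ∧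
      IsWeakMixedDeriv Ω k i i m) (i : Fin d) (f : H₀) :
    IntegrableOn (steinIntegrand Ω μ π i (scalarField Ω f)) Ω := by
  obtain ⟨C, -, hC⟩ := exists_eLpNorm_weakGrad_scalarField_le (H₀ := H₀) hΩ hH₀ hk hm i
  have hf : MemLp (scalarField Ω f) 2 (volume.restrict Ω) :=
    memLp_scalarField hΩ.isCompact hΩ.isCompact.measurableSet hH₀ hk f
  exact ((hscore.memLp_apply i).integrable_mul hf).add (hμ.integrable_mul (hC f).1)

theorem exists_inner_eq_integral_steinIntegrand (hΩ : IsSmoothCompactDomain Ω)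
    (hμ : MemLp (density μ) 2 (volume.restrict Ω)) (hscore : HasSquareIntegrableScore Ω μ π)
    (hH₀ : ∀ x y : Ω, RKHS.kernel H₀ x y 1 = k x y)
    (hk : ContinuousOn (Function.uncurry k) (Ω ×ˢ Ω))
    (hm : ∀ i, ∃ m, MemLp m 2 ((volume.restrict Ω).prod (volume.restrict Ω)) ∧
      IsWeakMixedDeriv Ω k i i m) (i : Fin d) :
    ∃ a : H₀, ∀ f, ∫ x in Ω, steinIntegrand Ω μ π i (scalarField Ω f) x = inner ℝ a f := by
  obtain ⟨B, hB₀, hB⟩ :=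
    exists_eLpNorm_scalarField_le (H₀ := H₀) (ν := volume) hΩ.isCompact hH₀ hk 2
  obtain ⟨C, hC₀, hC⟩ := exists_eLpNorm_weakGrad_scalarField_le (H₀ := H₀) hΩ hH₀ hk hm i
  have hLp (f : H₀) : MemLp (scalarField Ω f) 2 (volume.restrict Ω) :=
    memLp_scalarField hΩ.isCompact hΩ.isCompact.measurableSet hH₀ hk f
  have hdiff := weaklyDifferentiable_scalarField (H₀ := H₀) hΩ hH₀ hk hm
  obtain ⟨a, ha⟩ := exists_inner_eq_integral_mul (hscore.memLp_apply i) hLp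
    (fun f g => .of_eq (map_add _ f g)) (fun c f => .of_eq (map_smul _ c f)) hB₀ hB
  obtain ⟨b, hb⟩ := exists_inner_eq_integral_mul hμ (fun f => (hC f).1)
    (fun f g => by
      rw [map_add]
      filter_upwards [weakGrad_add_ae hΩ (hdiff f) (hdiff g)] with x hx
      simp only [hx, Pi.add_apply, PiLp.add_apply])
    (fun c f => by
      rw [map_smul]
      filter_upwards [weakGrad_const_smul_ae hΩ (hdiff f) c] with x hx
      simp only [hx, Pi.smul_apply, PiLp.smul_apply]) hC₀ (fun f => (hC f).2)
  refine ⟨a + b, fun f => ?_⟩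
  rw [inner_add_left, ← ha, ← hb]
  exact integral_add ((hscore.memLp_apply i).integrable_mul (hLp f)) (hμ.integrable_mul (hC f).1)

end SteinFunctional

/-! ### Logarithmic derivatives -/

section LogarithmicDerivative

variable {E : Type*} [NormedAddCommGroup E] [NormedSpace ℝ E] [FiniteDimensional ℝ E]
  [MeasureSpace E] [BorelSpace E] [(volume : Measure E).IsAddHaarMeasure]
  {U : Set E} {u g L σ τ : E → ℝ} {a : E}

theorem abs_one_div_one_add_sq_le_one (s : ℝ) : |1 / (1 + s ^ 2)| ≤ 1 := by
  rw [abs_of_nonneg (by positivity), div_le_one (by positivity)]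
  linarith [sq_nonneg s]

theorem HasWeakDeriv.arctan (hU : IsOpen U) (hu : HasWeakDeriv U u a g) :
    HasWeakDeriv U (fun x => Real.arctan (u x)) a (fun x => 1 / (1 + u x ^ 2) * g x) :=
  hu.comp hU (F' := fun s => 1 / (1 + s ^ 2)) Real.hasDerivAt_arctan
    (by fun_prop (disch := intros; positivity)) abs_one_div_one_add_sq_le_one

/-- Neither `log` nor `exp` is Lipschitz, so the chain rule is applied to `arctan` and
`arctan ∘ exp` instead. -/
theorem HasWeakDeriv.ae_eq_mul_of_log (hU : IsOpen U) (hu : HasWeakDeriv U u a g)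
    (hlog : HasWeakDeriv U (fun x => Real.log (u x)) a σ)
    (hpos : ∀ᵐ x ∂(volume.restrict U), 0 < u x) :
    g =ᵐ[volume.restrict U] fun x => u x * σ x := by
  have harctan_exp := hlog.comp hU (F := fun s => Real.arctan (Real.exp s))
    (F' := fun s => 1 / (1 + Real.exp s ^ 2) * Real.exp s) (C := 1)
    (fun s => (Real.hasDerivAt_exp s).arctan)
    (by fun_prop (disch := intros; positivity)) fun s => by
      rw [abs_of_nonneg (by positivity), one_div_mul_eq_div, div_le_one (by positivity)]
      nlinarith [sq_nonneg (Real.exp s - 1), Real.exp_pos s]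
  have hcongr : (fun x => Real.arctan (Real.exp (Real.log (u x))))
      =ᵐ[volume.restrict U] fun x => Real.arctan (u x) := by
    filter_upwards [hpos] with x hx
    rw [Real.exp_log hx]
  filter_upwards [(hu.arctan hU).unique hU (harctan_exp.congr_ae hcongr (.refl _ _)),
    hpos] with x hx hux
  rw [Real.exp_log hux, mul_assoc] at hx
  exact mul_left_cancel₀ (by positivity) hx

theorem abs_div_sq_add_sq_le {δ : ℝ} (hδ : 0 < δ) (s : ℝ) : |s / (s ^ 2 + δ ^ 2)| ≤ 1 / δ := by
  have hpos : 0 < s ^ 2 + δ ^ 2 := by positivity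
  rw [abs_div, abs_of_pos hpos, div_le_div_iff₀ hpos hδ, one_mul]
  nlinarith [sq_nonneg (|s| - δ), sq_abs s, abs_nonneg s]

theorem hasDerivAt_half_log_sq_add_sq {δ : ℝ} (hδ : 0 < δ) (s : ℝ) :
    HasDerivAt (fun s => 1 / 2 * Real.log (s ^ 2 + δ ^ 2)) (s / (s ^ 2 + δ ^ 2)) s := by
  have hpos : s ^ 2 + δ ^ 2 ≠ 0 := by positivity
  have hsq : HasDerivAt (fun s : ℝ => s ^ 2 + δ ^ 2) (2 * s) s := by
    simpa using (hasDerivAt_pow 2 s).add_const (δ ^ 2)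
  exact ((hsq.log hpos).const_mul (1 / 2)).congr_deriv (by ring)

theorem tendsto_half_log_sq_add_sq {ι : Type*} {l : Filter ι} {δ : ι → ℝ} (hδ : Tendsto δ l (𝓝 0))
    {s : ℝ} (hs : s ≠ 0) :
    Tendsto (fun i => 1 / 2 * Real.log (s ^ 2 + δ i ^ 2)) l (𝓝 (Real.log s)) := by
  have hlog : 1 / 2 * Real.log (s ^ 2 + 0 ^ 2) = Real.log s := by
    rw [zero_pow two_ne_zero, add_zero, Real.log_pow]
    push_cast
    ring
  rw [← hlog]
  exact (((hδ.pow 2).const_add (s ^ 2)).log (by positivity)).const_mul (1 / 2)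

theorem HasWeakDeriv.half_log_sq_add_sq (hU : IsOpen U) (hu : HasWeakDeriv U u a g) {δ : ℝ}
    (hδ : 0 < δ) : HasWeakDeriv U (fun x => 1 / 2 * Real.log (u x ^ 2 + δ ^ 2)) a
      (fun x => u x / (u x ^ 2 + δ ^ 2) * g x) :=
  hu.comp hU (hasDerivAt_half_log_sq_add_sq hδ) (by fun_prop (disch := intros; positivity))
    (abs_div_sq_add_sq_le hδ)

/-- Since `log ∘ u` need not be locally integrable, its difference with `L` is truncated by
`arctan` and obtained as the limit of `log (u² + δ²) / 2 - L` as `δ → 0`. -/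
theorem HasWeakDeriv.arctan_log_sub (hU : IsOpen U) (hu : HasWeakDeriv U u a g)
    (hL : HasWeakDeriv U L a σ) (hτ : LocallyIntegrableOn τ U)
    (hg : g =ᵐ[volume.restrict U] fun x => u x * τ x)
    (hu₀ : ∀ᵐ x ∂(volume.restrict U), u x ≠ 0) :
    HasWeakDeriv U (fun x => Real.arctan (Real.log (u x) - L x)) a
      (fun x => 1 / (1 + (Real.log (u x) - L x) ^ 2) * (τ x - σ x)) := by
  set δ : ℕ → ℝ := fun n => 1 / ((n : ℝ) + 1)
  have hδ : ∀ n, 0 < δ n := fun n => by positivity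
  have hδ_lim : Tendsto δ atTop (𝓝 0) := tendsto_one_div_add_atTop_nhds_zero_nat
  set w : ℕ → E → ℝ := fun n x => 1 / 2 * Real.log (u x ^ 2 + δ n ^ 2) - L x
  have hw : ∀ n, HasWeakDeriv U (fun x => Real.arctan (w n x)) a
      (fun x => 1 / (1 + w n x ^ 2) * (u x / (u x ^ 2 + δ n ^ 2) * g x - σ x)) := fun n =>
    ((hu.half_log_sq_add_sq hU (hδ n)).sub hL).arctan hU
  have hw_lim : ∀ x, u x ≠ 0 → Tendsto (fun n => w n x) atTop (𝓝 (Real.log (u x) - L x)) :=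
    fun x hx => (tendsto_half_log_sq_add_sq hδ_lim hx).sub_const _
  refine .of_tendsto_of_abs_le hU hw (b := fun _ => Real.pi / 2) (c := fun x => |τ x| + |σ x|)
    ((locallyIntegrable_const _).locallyIntegrableOn _)
    (hτ.norm.add hL.locallyIntegrableOn_deriv.norm)
    (fun n => .of_forall fun x => abs_le.2 ⟨(Real.neg_pi_div_two_lt_arctan _).le,
      (Real.arctan_lt_pi_div_two _).le⟩) (fun n => ?_) ?_ ?_
  · filter_upwards [hg] with x hx
    have hquot : |u x / (u x ^ 2 + δ n ^ 2) * g x| ≤ |τ x| := by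
      rw [hx, ← mul_assoc, abs_mul, div_mul_eq_mul_div, ← sq]
      refine mul_le_of_le_one_left (abs_nonneg _) ?_
      rw [abs_of_nonneg (by positivity)]
      exact div_le_one_of_le₀ (by linarith [sq_nonneg (δ n)]) (by positivity)
    rw [abs_mul]
    exact (mul_le_of_le_one_left (abs_nonneg _) (abs_one_div_one_add_sq_le_one _)).trans
      ((abs_sub _ _).trans (add_le_add_left hquot _))
  · filter_upwards [hu₀] with x hx
    exact (Real.continuous_arctan.tendsto _).comp (hw_lim x hx)
  · filter_upwards [hu₀, hg] with x hx hgx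
    have hquot : u x / (u x ^ 2 + 0 ^ 2) * g x = τ x := by
      rw [hgx]
      field_simp
      ring
    rw [← hquot]
    exact (tendsto_const_nhds.div (((hw_lim x hx).pow 2).const_add 1) (by positivity)).mul
      (((tendsto_const_nhds.div ((hδ_lim.pow 2).const_add _) (by positivity)).mul_const _).sub_const
        _)

theorem exists_ae_eq_const_mul_exp (hU : IsOpen U) (hUc : IsPreconnected U) {g σ : E → E → ℝ}
    (hu : ∀ a, HasWeakDeriv U u a (g a)) (hL : ∀ a, HasWeakDeriv U L a (σ a))
    (hg : ∀ a, g a =ᵐ[volume.restrict U] fun x => u x * σ a x)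
    (hpos : ∀ᵐ x ∂(volume.restrict U), 0 < u x) :
    ∃ c, ∀ᵐ x ∂(volume.restrict U), u x = c * Real.exp (L x) := by
  obtain ⟨c, hc⟩ := exists_ae_eq_const_of_hasWeakDeriv_zero hU hUc fun a =>
    ((hu a).arctan_log_sub hU (hL a) (hL a).locallyIntegrableOn_deriv (hg a)
      (hpos.mono fun _ => ne_of_gt)).congr_ae (h := 0) (.refl _ _)
      (.of_forall fun x => by simp only [sub_self, mul_zero, Pi.zero_apply])
  refine ⟨Real.exp (Real.tan c), ?_⟩
  filter_upwards [hc, hpos] with x hx hux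
  rw [← hx, Real.tan_arctan, ← Real.exp_add, sub_add_cancel, Real.exp_log hux]

end LogarithmicDerivative

/-! ### Separation of measures -/

section Separation

variable {d : ℕ} {Ω : Set (Eucl d)} {μ π : Measure (Eucl d)}

theorem ae_density_pos (h : ∀ᵐ x ∂(volume.restrict Ω), density μ x ≠ 0) :
    ∀ᵐ x ∂(volume.restrict Ω), 0 < density μ x :=
  h.mono fun _ hx => lt_of_le_of_ne ENNReal.toReal_nonneg hx.symm

theorem eq_of_density_ae_eq_const_mul [IsProbabilityMeasure μ] [IsProbabilityMeasure π]
    (hμ : μ ≪ volume) (hπ : π ≪ volume) (hμΩ : μ Ωᶜ = 0) (hπΩ : π Ωᶜ = 0) (hΩ : MeasurableSet Ω)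
    {c : ℝ} (h : ∀ᵐ x ∂(volume.restrict Ω), density μ x = c * density π x) : μ = π := by
  have hreal {s : Set (Eucl d)} (hs : MeasurableSet s) : μ.real s = c * π.real s := by
    rw [← integral_indicator_one hs, ← integral_indicator_one hs,
      integral_eq_setIntegral_density_mul hμ hμΩ hΩ,
      integral_eq_setIntegral_density_mul hπ hπΩ hΩ, ← integral_const_mul]
    refine integral_congr_ae ?_
    filter_upwards [h] with x hx
    rw [hx, mul_assoc]
  have hc : 1 = c := by simpa only [probReal_univ, mul_one] using hreal MeasurableSet.univ
  refine Measure.ext fun s hs => (measureReal_eq_measureReal_iff).1 ?_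
  rw [hreal hs, ← hc, one_mul]

theorem ae_weakGrad_density_eq_iff_eq [IsProbabilityMeasure μ] [IsProbabilityMeasure π]
    (hΩ : IsSmoothCompactDomain Ω) (hμ : μ ≪ volume) (hπ : π ≪ volume) (hμΩ : μ Ωᶜ = 0)
    (hπΩ : π Ωᶜ = 0) (hμ₀ : ∀ᵐ x ∂(volume.restrict Ω), density μ x ≠ 0)
    (hπ₀ : ∀ᵐ x ∂(volume.restrict Ω), density π x ≠ 0)
    (hdiff : WeaklyDifferentiable Ω (density μ))
    (hlog : WeaklyDifferentiable Ω fun x => Real.log (density π x)) :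
    (∀ i, ∀ᵐ x ∂(volume.restrict Ω),
      weakGrad Ω (density μ) x i = density μ x * score Ω π x i) ↔ μ = π := by
  constructor
  · intro h
    obtain ⟨c, hc⟩ := exists_ae_eq_const_mul_exp isOpen_interior hΩ.isPreconnected_interior
      hdiff.isWeakGrad.hasWeakDeriv hlog.isWeakGrad.hasWeakDeriv
      (fun a => by
        rw [hΩ.restrict_interior]
        filter_upwards [ae_all_iff.2 h] with x hx
        have hgrad : weakGrad Ω (density μ) x = density μ x • score Ω π x := by
          ext i
          exact hx i
        rw [hgrad, real_inner_smul_left, score])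
      (by
        rw [hΩ.restrict_interior]
        exact ae_density_pos hμ₀)
    rw [hΩ.restrict_interior] at hc
    refine eq_of_density_ae_eq_const_mul hμ hπ hμΩ hπΩ hΩ.isCompact.measurableSet (c := c) ?_
    filter_upwards [hc, ae_density_pos hπ₀] with x hx hpos
    rw [hx, Real.exp_log hpos]
  · rintro rfl i
    have hpos := ae_density_pos hμ₀
    rw [← hΩ.restrict_interior] at hpos ⊢
    exact (hdiff.isWeakGrad.hasWeakDeriv_single i).ae_eq_mul_of_log isOpen_interior
      (hlog.isWeakGrad.hasWeakDeriv_single i) hpos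

theorem weakGrad_zero_ae (hΩ : IsSmoothCompactDomain Ω) :
    weakGrad Ω 0 =ᵐ[volume.restrict Ω] 0 :=
  IsWeakGrad.weakGrad_ae_eq hΩ
    ⟨locallyIntegrable_zero.locallyIntegrableOn _, locallyIntegrable_zero.locallyIntegrableOn _,
      by simp⟩

variable {u : Eucl d → ℝ} {i : Fin d}

theorem smul_single_apply_self : (fun y => (u y • EuclideanSpace.single i (1 : ℝ)) i) = u := by
  ext y
  simp

theorem MemSteinClass.memH1_of_smul_single
    (hu : MemSteinClass Ω μ fun y => u y • EuclideanSpace.single i (1 : ℝ)) : MemH1 Ω u := by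
  simpa only [smul_single_apply_self] using hu.1 i

theorem MemSteinClass.integral_density_mul_weakGrad (hΩ : IsSmoothCompactDomain Ω)
    (hμ : MemH1 Ω (density μ))
    (hu : MemSteinClass Ω μ fun y => u y • EuclideanSpace.single i (1 : ℝ)) :
    ∫ y in Ω, density μ y * weakGrad Ω u y i = -∫ y in Ω, weakGrad Ω (density μ) y i * u y := by
  have huH := hu.memH1_of_smul_single
  have hsum := hu.sum_integral_eq_zero hΩ hμ
  rw [Finset.sum_eq_single_of_mem i (Finset.mem_univ i), smul_single_apply_self] at hsum
  · have hgrad : Integrable (fun y => weakGrad Ω (density μ) y i * u y) (volume.restrict Ω) :=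
      (hμ.2.2.eval_piLp i).integrable_mul huH.1
    have hgrad' : Integrable (fun y => density μ y * weakGrad Ω u y i) (volume.restrict Ω) :=
      hμ.1.integrable_mul (huH.2.2.eval_piLp i)
    simp only [PiLp.smul_apply, PiLp.single_apply, if_true, smul_eq_mul, mul_one] at hsum
    rw [integral_add hgrad hgrad'] at hsum
    exact eq_neg_of_add_eq_zero_right hsum
  · intro j _ hj
    have hzero : (fun y => (u y • EuclideanSpace.single i (1 : ℝ)) j) = 0 := by
      ext y
      simp [hj]
    refine integral_eq_zero_of_ae ?_
    filter_upwards [weakGrad_zero_ae hΩ] with y hy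
    simp only [hzero, hy, congrFun hzero y, Pi.zero_apply, PiLp.zero_apply, mul_zero, add_zero]

theorem integral_steinIntegrand_eq (hΩ : IsSmoothCompactDomain Ω) (hμ : MemH1 Ω (density μ))
    (hscore : HasSquareIntegrableScore Ω μ π)
    (hu : MemSteinClass Ω μ fun y => u y • EuclideanSpace.single i (1 : ℝ)) :
    ∫ y in Ω, steinIntegrand Ω μ π i u y =
      ∫ y in Ω, (density μ y * score Ω π y i - weakGrad Ω (density μ) y i) * u y := by
  have huH := hu.memH1_of_smul_single
  have hscore_mul : Integrable (fun y => density μ y * score Ω π y i * u y) (volume.restrict Ω) :=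
    (hscore.memLp_apply i).integrable_mul huH.1
  have hgrad : Integrable (fun y => weakGrad Ω (density μ) y i * u y) (volume.restrict Ω) :=
    (hμ.2.2.eval_piLp i).integrable_mul huH.1
  have hgrad' : Integrable (fun y => density μ y * weakGrad Ω u y i) (volume.restrict Ω) :=
    hμ.1.integrable_mul (huH.2.2.eval_piLp i)
  simp only [steinIntegrand, sub_mul]
  rw [integral_add hscore_mul hgrad', integral_sub hscore_mul hgrad,
    hu.integral_density_mul_weakGrad hΩ hμ, sub_eq_add_neg]

variable {k : Eucl d → Eucl d → ℝ}

theorem ae_eq_zero_of_integral_mul_kernel_eq_zero (hΩ : MeasurableSet Ω)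
    (hk : IntegrallyPosDef Ω k) (hsymm : ∀ x ∈ Ω, ∀ y ∈ Ω, k x y = k y x) {g : Eucl d → ℝ}
    (hg : MemLp g 2 (volume.restrict Ω)) (h : ∀ x ∈ Ω, ∫ y in Ω, g y * k y x = 0) :
    g =ᵐ[volume.restrict Ω] 0 := by
  by_contra hne
  refine (hk g hg hne).ne' (setIntegral_eq_zero_of_forall_eq_zero fun x hx => ?_)
  calc ∫ y in Ω, g x * k x y * g y = ∫ y in Ω, g x * (g y * k y x) :=
        setIntegral_congr_fun hΩ fun y hy => by
          simp only [hsymm x hx y hy]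
          ring
    _ = 0 := by rw [integral_const_mul, h x hx, mul_zero]

variable {H₀ : Type*} [NormedAddCommGroup H₀] [InnerProductSpace ℝ H₀] [CompleteSpace H₀]
  [RKHS ℝ H₀ Ω ℝ]

theorem eq_zero_iff_forall_inner_kernelSection {a : H₀} :
    a = 0 ↔ ∀ x ∈ Ω, inner ℝ a (kernelSection Ω H₀ x) = 0 := by
  refine ⟨fun h x _ => by rw [h, inner_zero_left], fun h => ?_⟩
  ext x
  have hx := h x x.2
  rw [inner_kernelSection, scalarField_of_mem a x.2] at hx
  simpa using hx

theorem integral_steinIntegrand_kernelSection (hΩ : IsSmoothCompactDomain Ω)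
    (hμ : MemH1 Ω (density μ)) (hscore : HasSquareIntegrableScore Ω μ π)
    (hH₀ : ∀ x y : Ω, RKHS.kernel H₀ x y 1 = k x y) {x : Eucl d} (hx : x ∈ Ω)
    (hu : MemSteinClass Ω μ fun y => k y x • EuclideanSpace.single i (1 : ℝ)) :
    ∫ y in Ω, steinIntegrand Ω μ π i (scalarField Ω (kernelSection Ω H₀ x)) y =
      ∫ y in Ω, (density μ y * score Ω π y i - weakGrad Ω (density μ) y i) * k y x := by
  have hae : scalarField Ω (kernelSection Ω H₀ x) =ᵐ[volume.restrict Ω] fun y => k y x :=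
    ae_restrict_of_forall_mem hΩ.isCompact.measurableSet fun y hy =>
      scalarField_kernelSection hH₀ hy hx
  rw [← integral_steinIntegrand_eq hΩ hμ hscore hu]
  refine integral_congr_ae ?_
  filter_upwards [hae, weakGrad_congr_ae hΩ hu.memH1_of_smul_single.2.1 hae] with y hy hgrad
  simp only [steinIntegrand, hy, hgrad]

theorem eq_zero_iff_ae_weakGrad_density_eq (hΩ : IsSmoothCompactDomain Ω)
    (hμ : MemH1 Ω (density μ)) (hscore : HasSquareIntegrableScore Ω μ π)
    (hk : IsSteinKernel Ω μ μ k) (hH₀ : ∀ x y : Ω, RKHS.kernel H₀ x y 1 = k x y) {a : H₀}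
    (ha : ∀ f : H₀, ∫ x in Ω, steinIntegrand Ω μ π i (scalarField Ω f) x = inner ℝ a f) :
    a = 0 ↔ ∀ᵐ x ∂(volume.restrict Ω),
      weakGrad Ω (density μ) x i = density μ x * score Ω π x i := by
  have hinner {x : Eucl d} (hx : x ∈ Ω) : inner ℝ a (kernelSection Ω H₀ x) =
      ∫ y in Ω, (density μ y * score Ω π y i - weakGrad Ω (density μ) y i) * k y x := by
    rw [← ha, integral_steinIntegrand_kernelSection hΩ hμ hscore hH₀ hx
      (hk.memSteinClass_left x hx i)]
  rw [eq_zero_iff_forall_inner_kernelSection (Ω := Ω)]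
  constructor
  · intro h
    filter_upwards [ae_eq_zero_of_integral_mul_kernel_eq_zero hΩ.isCompact.measurableSet
      hk.integrallyPosDef hk.symm ((hscore.memLp_apply i).sub (hμ.2.2.eval_piLp i))
      fun x hx => (hinner hx).symm.trans (h x hx)] with y hy
    exact (sub_eq_zero.1 hy).symm
  · intro h x hx
    rw [hinner hx]
    refine integral_eq_zero_of_ae ?_
    filter_upwards [h] with y hy
    rw [hy, sub_self, zero_mul, Pi.zero_apply]

theorem exists_inner_eq_integral_steinOp [SigmaFinite μ] (hΩ : IsSmoothCompactDomain Ω)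
    (hμ : μ ≪ volume) (hμΩ : μ Ωᶜ = 0) (hμH : MemH1 Ω (density μ))
    (hscore : HasSquareIntegrableScore Ω μ π) (hk : IsSteinKernel Ω μ μ k)
    (hH₀ : ∀ x y : Ω, RKHS.kernel H₀ x y 1 = k x y) :
    ∃ a : ProductRKHS d H₀, (∀ f : ProductRKHS d H₀, Integrable (steinOp Ω π (toField f)) μ ∧
      ∫ x, steinOp Ω π (toField f) x ∂μ = inner ℝ a f) ∧
      (a = 0 ↔ ∀ i, ∀ᵐ x ∂(volume.restrict Ω),
        weakGrad Ω (density μ) x i = density μ x * score Ω π x i) := by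
  have hmixed := fun i => hk.mixedDeriv i i
  choose a ha using exists_inner_eq_integral_steinIntegrand (H₀ := H₀) hΩ hμH.1 hscore hH₀
    hk.continuousOn hmixed
  refine ⟨WithLp.toLp 2 a, fun f => ?_, ?_⟩
  · obtain ⟨hint, heq⟩ := integral_steinOp_toField hμ hμΩ hΩ.isCompact.measurableSet fun i =>
      integrableOn_steinIntegrand hΩ hμH.1 hscore hH₀ hk.continuousOn hmixed i (f i)
    exact ⟨hint, heq.trans (Finset.sum_congr rfl fun i _ => ha i (f i))⟩
  · rw [WithLp.toLp_eq_zero, funext_iff]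
    exact forall_congr' fun i => eq_zero_iff_ae_weakGrad_density_eq hΩ hμH hscore hk hH₀ (ha i)

end Separation

end

end SteinKSD

open SteinKSD in
theorem mainTheorem3_general {d : ℕ} {Ω : Set (Eucl d)} (hΩ : IsSmoothCompactDomain Ω)
    {μ π : Measure (Eucl d)} (hμ : MemP2 Ω μ) [IsProbabilityMeasure π] (hπΩ : π Ωᶜ = 0)
    (hπ : π ≪ volume) (hπ₀ : ∀ᵐ x ∂(volume.restrict Ω), density π x ≠ 0)
    (hscore : HasSquareIntegrableScore Ω μ π) {k : Eucl d → Eucl d → ℝ}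
    (hk : IsSteinKernel Ω μ μ k) (H₀ : Type*) [NormedAddCommGroup H₀] [InnerProductSpace ℝ H₀]
    [CompleteSpace H₀] [RKHS ℝ H₀ Ω ℝ] (hH₀ : ∀ x y : Ω, RKHS.kernel H₀ x y 1 = k x y) :
    (∀ f : ProductRKHS d H₀, (∀ i, WeaklyDifferentiable Ω fun x => toField f x i) ∧
      Integrable (steinOp Ω π (toField f)) μ) ∧
    IsGreatest (steinValues Ω H₀ μ π) (ksd Ω H₀ μ π) ∧ (μ = π ↔ ksd Ω H₀ μ π = 0) := by
  have := hμ.isProbabilityMeasure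
  obtain ⟨a, ha, ha₀⟩ := exists_inner_eq_integral_steinOp (H₀ := H₀) hΩ hμ.absolutelyContinuous
    hμ.measure_compl hμ.memH1_density hscore hk hH₀
  have hgreatest := isGreatest_steinValues fun f => (ha f).2
  have hksd : ksd Ω H₀ μ π = ‖a‖ := hgreatest.csSup_eq
  refine ⟨fun f => ⟨fun i => ?_, (ha f).1⟩, hksd ▸ hgreatest, ?_⟩
  · exact weaklyDifferentiable_scalarField hΩ hH₀ hk.continuousOn
      (fun i => hk.mixedDeriv i i) (f i)
  · rw [hksd, norm_eq_zero, ha₀, ae_weakGrad_density_eq_iff_eq hΩ hμ.absolutelyContinuous hπ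
      hμ.measure_compl hπΩ hμ.density_ne_zero hπ₀ hμ.memH1_density.2.1 hscore.1]

theorem mainTheorem3 {d : ℕ} (Ω : Set (SteinKSD.Eucl d)) (hΩ : SteinKSD.IsSmoothCompactDomain Ω)
    (μ π : MeasureTheory.Measure (SteinKSD.Eucl d))
    (hμ : SteinKSD.MemP2 Ω μ) (hπ : SteinKSD.MemP2 Ω π)
    (hscore : SteinKSD.HasSquareIntegrableScore Ω μ π)
    (k : SteinKSD.Eucl d → SteinKSD.Eucl d → ℝ) (hk : SteinKSD.IsSteinKernel Ω μ π k)
    (H₀ : Type*) [NormedAddCommGroup H₀] [InnerProductSpace ℝ H₀] [CompleteSpace H₀]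
    [RKHS ℝ H₀ Ω ℝ] (hH₀ : ∀ x y : Ω, RKHS.kernel H₀ x y 1 = k x y) :
    -- `E_{x ∼ μ}[A_π f(x)]` is well defined for every `f` in the product RKHS,
    (∀ f : SteinKSD.ProductRKHS d H₀,
      (∀ i, SteinKSD.WeaklyDifferentiable Ω (fun x => SteinKSD.toField f x i)) ∧
      MeasureTheory.Integrable (SteinKSD.steinOp Ω π (SteinKSD.toField f)) μ) ∧
    -- the discrepancy is a maximum,
    IsGreatest (SteinKSD.steinValues Ω H₀ μ π) (SteinKSD.ksd Ω H₀ μ π) ∧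
    -- and it separates `μ` and `π`.
    (μ = π ↔ SteinKSD.ksd Ω H₀ μ π = 0) := by
  have := hπ.isProbabilityMeasure
  exact mainTheorem3_general hΩ hμ hπ.measure_compl hπ.absolutelyContinuous hπ.density_ne_zero
    hscore { hk with memSteinClass_right := hk.memSteinClass_left } H₀ hH₀
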